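/- Let $(M,g)$ be a (smooth, connected, nonempty) oriented pseudo-Riemannian Einstein four-manifold of the neutral signature $(-,-,+,+)$, with Levi-Civita connection $\nabla$. Let $\Lambda^\pm M$ be the bundles of self-dual and anti-self-dual $2$-forms, with the inner product $2\langle\zeta,\eta\rangle=\zeta_{jk}\eta^{jk}$, and let the Weyl tensor $W$ act on $2$-forms by $2(W\zeta)_{jk}=W_{jklp}\zeta^{lp}$, where the curvature tensor is $R(u,v,w,w')=g(R(u,v)w,w')$ with $R(u,v)w=\nabla_v\nabla_u w-\nabla_u\nabla_v w+\nabla_{[u,v]}w$. Suppose that $g$ is self-dual of Petrov type III, that is, $W=0$ on $\Lambda^-M$ and, at every point $x$, the restriction $W^+$ of $W$ to $\Lambda^+_xM$ is self-adjoint and sends some ordered basis $(\mathbf{x},\mathbf{y},\mathbf{z})$ of $\Lambda^+_xM$ to $(0,\mathbf{x},\mathbf{y})$. Then there exist smooth sections $\zeta,\eta,\theta$ of $\Lambda^+M$ and $1$-forms $\alpha,\beta,\gamma$ on $M$ such that $$W\zeta=0,\quad W\eta=-\zeta,\quad W\theta=\eta,\qquad \langle\zeta,\theta\rangle=2=-\langle\eta,\eta\rangle,\quad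 \langle\zeta,\zeta\rangle=\langle\zeta,\eta\rangle=\langle\eta,\theta\rangle=\langle\theta,\theta\rangle=0,$$ $\eta v=v$ for all $v\in\mathcal V:=\mathrm{Ker}\,\zeta$ and $\eta w=-w$ for all $w\in\mathrm{Ker}\,\theta$ (where $\eta v$ is defined by $g(\eta v,\cdot)=\eta(v,\cdot)$), and $$\nabla\zeta=2\alpha\otimes\zeta+2\beta\otimes\eta,\qquad \nabla\eta=2\gamma\otimes\zeta+2\beta\otimes\theta,\qquad \nabla\theta=2\gamma\otimes\eta-2\alpha\otimes\theta.$$ For any such $\zeta,\eta,\theta,\alpha,\beta,\gamma$, and $\mathcal V=\mathrm{Ker}\,\zeta$: (i) $\mathcal V$ is a (smooth) two-dimensional null distribution compatible with the orientation, in the sense that, at every point, the bivector $u\wedge v$ (identified by means of $g$ with the $2$-form $g(u,\cdot)\wedge g(v,\cdot)$) is self-dual for any basis $u,v$ of $\mathcal V_x$. (ii) $\mathcal V$ is parallel (that is, $\nabla_w v$ lies in $\mathcal V$ for every smooth local section $v$ of $\mathcal V$ and every tangent vector $w$) if and only if $\beta=0$ identically. (iii) If $\mathcal V$ is parallel, then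 $g$ is Ricci-flat. (iv) If $\beta\neq0$ everywhere, then $(M,g)$ does not admit a smooth two-dimensional null parallel distribution compatible with the orientation. -/

import Mathlib

open scoped Manifold ContDiff Topology

noncomputable section

namespace NeutralFour

/-- The model space `ℝ⁴`. -/
abbrev E4 : Type := EuclideanSpace ℝ (Fin 4)

variable {M : Type*} [TopologicalSpace M] [ChartedSpace E4 M]

/-- The tangent space `T_xM`. -/
abbrev T (x : M) : Type := TangentSpace 𝓘(ℝ, E4) x

/-- Twice-covariant tensors at `x`. -/
abbrev Bil (x : M) : Type := T x →L[ℝ] T x →L[ℝ] ℝ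

/-- `X` is a `C^∞` vector field on the open set `U`. -/
def SmoothFieldOn [IsManifold 𝓘(ℝ, E4) ∞ M] (X : Π x : M, T x) (U : Set M) : Prop :=
  ContMDiffOn 𝓘(ℝ, E4) (𝓘(ℝ, E4)).tangent ∞
    (fun x ↦ (⟨x, X x⟩ : TangentBundle 𝓘(ℝ, E4) M)) U

/-- `φ` is a `C^∞` twice-covariant tensor field on `M`. -/
def SmoothBil [IsManifold 𝓘(ℝ, E4) ∞ M] (φ : Π x : M, Bil x) : Prop :=
  ContMDiff 𝓘(ℝ, E4) (𝓘(ℝ, E4).prod 𝓘(ℝ, E4 →L[ℝ] E4 →L[ℝ] ℝ)) ∞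
    (fun x ↦ Bundle.TotalSpace.mk' (E4 →L[ℝ] E4 →L[ℝ] ℝ)
      (E := fun x : M ↦ (T x →L[ℝ] T x →L[ℝ] ℝ)) x (φ x))

/-- The signs `(-,-,+,+)`. -/
def sgn : Fin 4 → ℝ := ![-1, -1, 1, 1]

/-- A smooth pseudo-Riemannian metric of the neutral signature `(-,-,+,+)` on `M`. -/
structure NeutralMetric (M : Type*) [TopologicalSpace M] [ChartedSpace E4 M]
    [IsManifold 𝓘(ℝ, E4) ∞ M] where
  val : Π x : M, Bil x
  smooth : SmoothBil val
  symm : ∀ (x : M) (u v : T x), val x u v = val x v u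
  signature : ∀ x : M, ∃ b : Module.Basis (Fin 4) ℝ (T x),
    ∀ i j, val x (b i) (b j) = if i = j then sgn i else 0

/-- `o` is an orientation of the manifold `M`: a choice of an orientation in each tangent space
such that, locally, some smooth frame of the tangent bundle is positively oriented. -/
def IsOrientation [IsManifold 𝓘(ℝ, E4) ∞ M] (o : Π x : M, Orientation ℝ (T x) (Fin 4)) : Prop :=
  ∀ x₀ : M, ∃ U : Set M, IsOpen U ∧ x₀ ∈ U ∧ ∃ X : Fin 4 → Π x : M, T x,
    (∀ i, SmoothFieldOn (X i) U) ∧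
    ∀ x ∈ U, ∃ b : Module.Basis (Fin 4) ℝ (T x), (∀ i, b i = X i x) ∧ b.orientation = o x

/-- The basis `∂_1, …, ∂_4` of `T_xM` given by the preferred chart at `x`. -/
def coordVec (x : M) (i : Fin 4) : T x := (EuclideanSpace.single i (1 : ℝ) : E4)

/-- A local vector field near `x` with the value `v` at `x`
(the one with constant components in the preferred chart at `x`). -/
def ext [IsManifold 𝓘(ℝ, E4) ∞ M] {x : M} (v : T x) : Π y : M, T y := FiberBundle.extend E4 v

/-- The Lie bracket of vector fields. -/
def bracket (X Y : Π x : M, T x) (x : M) : T x := VectorField.mlieBracket 𝓘(ℝ, E4) X Y x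

/-- The directional derivative `d_v f` of a function `f` at `x`, for `v ∈ T_xM`. -/
def dirDeriv (f : M → ℝ) (x : M) (v : T x) : ℝ := mvfderiv 𝓘(ℝ, E4) f x v

namespace NeutralMetric

variable [IsManifold 𝓘(ℝ, E4) ∞ M] (g : NeutralMetric M)

/-- The components `g^{ij}` at `x` of the inverse metric in the basis `coordVec x`. -/
def inv (x : M) : Matrix (Fin 4) (Fin 4) ℝ :=
  (Matrix.of fun i j ↦ g.val x (coordVec x i) (coordVec x j))⁻¹

/-- The metric contraction `g^{ij} B_{ij}` at `x`. -/
def contract (x : M) (B : T x → T x → ℝ) : ℝ :=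
  ∑ i, ∑ j, g.inv x i j * B (coordVec x i) (coordVec x j)

/-- The expression
`d_v[g(u,w)] + d_u[g(v,w)] - d_w[g(v,u)] + g(u,[w,v]) + g(w,[v,u]) - g(v,[u,w])`
of the Koszul formula for `2 g(∇_v u, w)`. -/
def koszul (v u w : Π x : M, T x) (x : M) : ℝ :=
  dirDeriv (fun y ↦ g.val y (u y) (w y)) x (v x)
  + dirDeriv (fun y ↦ g.val y (v y) (w y)) x (u x)
  - dirDeriv (fun y ↦ g.val y (v y) (u y)) x (w x)
  + g.val x (u x) (bracket w v x) + g.val x (w x) (bracket v u x)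
  - g.val x (v x) (bracket u w x)

/-- The Levi-Civita covariant derivative `∇_v u ∈ T_xM` of a vector field `u`
(differentiable at `x`) in the direction of `v ∈ T_xM`: the vector with
`2 g(∇_v u, w) = koszul v u w` for all `w`, that is, the one with the components
`(1/2) g^{ij} koszul v u ∂_j`. -/
def nabla (u : Π x : M, T x) (x : M) (v : T x) : T x :=
  ∑ i, ∑ j, ((1 / 2 : ℝ) * g.inv x i j * g.koszul (ext v) u (ext (coordVec x j)) x) • coordVec x i

/-- The curvature `R(u,v)w = ∇_v ∇_u w - ∇_u ∇_v w + ∇_{[u,v]} w` of vector fields. -/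
def curvField (u v w : Π x : M, T x) (x : M) : T x :=
  g.nabla (fun y ↦ g.nabla w y (u y)) x (v x) - g.nabla (fun y ↦ g.nabla w y (v y)) x (u x)
    + g.nabla w x (bracket u v x)

/-- The four-times covariant curvature tensor `R(a,b,c,d) = g(R(a,b)c, d)` at `x`. -/
def curv (x : M) (a b c d : T x) : ℝ :=
  g.val x (g.curvField (ext a) (ext b) (ext c) x) d

/-- The Ricci tensor `Ric_{kp} = g^{jl} R_{jklp}`. -/
def ricci (x : M) (u v : T x) : ℝ := g.contract x fun a b ↦ g.curv x a u b v

/-- The scalar curvature. -/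
def scal (x : M) : ℝ := g.contract x fun a b ↦ g.ricci x a b

/-- The Weyl tensor in dimension four (with the scalar curvature `s`):
`W_{jklp} = R_{jklp} - (1/2)(g_{jl} Ric_{kp} + g_{kp} Ric_{jl} - g_{kl} Ric_{jp} - g_{jp} Ric_{kl})
+ (s/6)(g_{jl} g_{kp} - g_{kl} g_{jp})`. -/
def weyl (x : M) (a b c d : T x) : ℝ :=
  g.curv x a b c d
  - (1 / 2) * (g.val x a c * g.ricci x b d + g.val x b d * g.ricci x a c
      - g.val x b c * g.ricci x a d - g.val x a d * g.ricci x b c)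
  + (g.scal x / 6) * (g.val x a c * g.val x b d - g.val x b c * g.val x a d)

/-- The inner product of `2`-forms, `2⟨ζ,η⟩ = ζ_{jk} η^{jk}`. -/
def pairing (x : M) (ζ η : T x → T x → ℝ) : ℝ :=
  (1 / 2) * g.contract x fun j a ↦ g.contract x fun k b ↦ ζ j k * η a b

/-- The Weyl tensor acting on `2`-forms, `2 (Wζ)_{jk} = W_{jklp} ζ^{lp}`. -/
def weylOp (x : M) (ζ : Bil x) (u v : T x) : ℝ :=
  g.pairing x (fun a b ↦ g.weyl x u v a b) (fun a b ↦ ζ a b)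

/-- `g` is an Einstein metric: its Ricci tensor is a constant multiple of `g`. -/
def IsEinstein : Prop := ∃ c : ℝ, ∀ (x : M) (u v : T x), g.ricci x u v = c * g.val x u v

/-- `g` is Ricci-flat. -/
def IsRicciFlat : Prop := ∀ (x : M) (u v : T x), g.ricci x u v = 0

/-- The `2`-form `g(u,·) ∧ g(v,·) = g(u,·) ⊗ g(v,·) - g(v,·) ⊗ g(u,·)` corresponding to the
bivector `u ∧ v`. -/
def bivector {x : M} (u v : T x) : Bil x :=
  (g.val x u).smulRight (g.val x v) - (g.val x v).smulRight (g.val x u)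

end NeutralMetric

/-- Skew-symmetry: `φ` is a `2`-form at `x`. -/
def IsTwoForm {x : M} (φ : Bil x) : Prop := ∀ v, φ v v = 0

/-- The value `(φ ∧ ζ)(b₀,b₁,b₂,b₃)` of the exterior product of two `2`-forms. -/
def wedgeEval {x : M} (φ ζ : Bil x) (b : Fin 4 → T x) : ℝ :=
  φ (b 0) (b 1) * ζ (b 2) (b 3) - φ (b 0) (b 2) * ζ (b 1) (b 3) + φ (b 0) (b 3) * ζ (b 1) (b 2)
  + φ (b 1) (b 2) * ζ (b 0) (b 3) - φ (b 1) (b 3) * ζ (b 0) (b 2) + φ (b 2) (b 3) * ζ (b 0) (b 1)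

namespace NeutralMetric

variable [IsManifold 𝓘(ℝ, E4) ∞ M] (g : NeutralMetric M)
  (o : Π x : M, Orientation ℝ (T x) (Fin 4))

/-- `b` is a positively oriented orthonormal basis of `T_xM`. -/
def IsPosOrthonormal {x : M} (b : Module.Basis (Fin 4) ℝ (T x)) : Prop :=
  b.orientation = o x ∧ ∀ i j, g.val x (b i) (b j) = if i = j then sgn i else 0

/-- `ζ' = *ζ` for the Hodge star `*`, characterized by `φ ∧ *ζ = ⟨φ,ζ⟩ vol` for all `2`-forms `φ`,
where the volume form `vol` has the value `1` on positively oriented orthonormal bases. -/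
def IsHodgeDual {x : M} (ζ ζ' : Bil x) : Prop :=
  ∀ b : Module.Basis (Fin 4) ℝ (T x), g.IsPosOrthonormal o b → ∀ φ : Bil x, IsTwoForm φ →
    wedgeEval φ ζ' b = g.pairing x (fun u v ↦ φ u v) (fun u v ↦ ζ u v)

/-- `ζ` is a self-dual `2`-form at `x`, that is, an element of `Λ⁺_xM`. -/
def SelfDualForm {x : M} (ζ : Bil x) : Prop := IsTwoForm ζ ∧ g.IsHodgeDual o ζ ζ

/-- `ζ` is an anti-self-dual `2`-form at `x`, that is, an element of `Λ⁻_xM`. -/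
def AntiSelfDualForm {x : M} (ζ : Bil x) : Prop := IsTwoForm ζ ∧ g.IsHodgeDual o ζ (-ζ)

/-- `g` is self-dual: `W⁻ = 0`. -/
def IsSelfDual : Prop :=
  ∀ (x : M) (ζ : Bil x), g.AntiSelfDualForm o ζ → ∀ u v, g.weylOp x ζ u v = 0

/-- `W⁺` is of Petrov type III at every point: it is self-adjoint and sends some ordered basis
`(a,b,c)` of `Λ⁺_xM` to `(0,a,b)` (which also makes it traceless). -/
def IsPetrovIII : Prop :=
  ∀ x : M,
    (∀ φ φ' : Bil x, g.SelfDualForm o φ → g.SelfDualForm o φ' →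
      g.pairing x (g.weylOp x φ) (fun u v ↦ φ' u v) =
        g.pairing x (fun u v ↦ φ u v) (g.weylOp x φ')) ∧
    ∃ a b c : Bil x,
      g.SelfDualForm o a ∧ g.SelfDualForm o b ∧ g.SelfDualForm o c ∧
      LinearIndependent ℝ ![a, b, c] ∧
      (∀ φ : Bil x, g.SelfDualForm o φ → φ ∈ Submodule.span ℝ {a, b, c}) ∧
      (∀ u v, g.weylOp x a u v = 0) ∧
      (∀ u v, g.weylOp x b u v = a u v) ∧
      (∀ u v, g.weylOp x c u v = b u v)

/-- The covariant derivative of a twice-covariant tensor field,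
`(∇_w ζ)(u,v) = d_w[ζ(u,v)] - ζ(∇_w u, v) - ζ(u, ∇_w v)`. -/
def nablaBil (ζ : Π x : M, Bil x) (x : M) (w u v : T x) : ℝ :=
  dirDeriv (fun y ↦ ζ y (ext u y) (ext v y)) x w
  - ζ x (g.nabla (ext u) x w) v - ζ x u (g.nabla (ext v) x w)

/-- `D` is a two-dimensional null distribution on `M`, spanned near each point by smooth
local sections. -/
structure IsNullDistribution (D : Π x : M, Submodule ℝ (T x)) : Prop where
  dim : ∀ x, Module.finrank ℝ (D x) = 2
  null : ∀ x, ∀ u ∈ D x, ∀ v ∈ D x, g.val x u v = 0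
  smooth : ∀ x, ∀ v ∈ D x, ∃ U : Set M, IsOpen U ∧ x ∈ U ∧
    ∃ X : Π y : M, T y, SmoothFieldOn X U ∧ X x = v ∧ ∀ y ∈ U, X y ∈ D y

/-- The distribution `D` is parallel: `∇_w X` lies in `D` for all smooth local sections `X`
of `D` and all tangent vectors `w`. -/
def IsParallel (D : Π x : M, Submodule ℝ (T x)) : Prop :=
  ∀ U : Set M, IsOpen U → ∀ X : Π y : M, T y, SmoothFieldOn X U → (∀ y ∈ U, X y ∈ D y) →
    ∀ x ∈ U, ∀ w : T x, g.nabla X x w ∈ D x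

/-- A distribution of null planes is compatible with the orientation: at every point, the
bivector `u ∧ v` is self-dual for any basis `u, v` of the plane. -/
def IsCompatible (D : Π x : M, Submodule ℝ (T x)) : Prop :=
  ∀ x, ∀ u ∈ D x, ∀ v ∈ D x, LinearIndependent ℝ ![u, v] →
    g.SelfDualForm o (g.bivector u v)

end NeutralMetric

/-- Three twice-covariant tensor fields `ζ, η, θ` and three `1`-forms `α, β, γ` on `M`. -/
structure FrameData (M : Type*) [TopologicalSpace M] [ChartedSpace E4 M] where
  ζ : Π x : M, Bil x
  η : Π x : M, Bil x
  θ : Π x : M, Bil x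
  α : Π x : M, T x →L[ℝ] ℝ
  β : Π x : M, T x →L[ℝ] ℝ
  γ : Π x : M, T x →L[ℝ] ℝ

namespace FrameData

/-- The distribution `𝒱 = Ker ζ`. -/
def V (F : FrameData M) (x : M) : Submodule ℝ (T x) := LinearMap.ker (F.ζ x).toLinearMap

/-- The distribution `ℋ = Ker θ`. -/
def H (F : FrameData M) (x : M) : Submodule ℝ (T x) := LinearMap.ker (F.θ x).toLinearMap

/-- `(ζ, η, θ)` is the canonical trivialization of `Λ⁺M` determined by `W⁺`, and `α, β, γ` are its
connection forms. (The inner products make `ζ, η, θ` linearly independent at each point, and the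
last three conditions determine `α, β, γ`, which are consequently smooth.) -/
structure IsCanonical [IsManifold 𝓘(ℝ, E4) ∞ M] (F : FrameData M) (g : NeutralMetric M)
    (o : Π x : M, Orientation ℝ (T x) (Fin 4)) : Prop where
  smooth_ζ : SmoothBil F.ζ
  smooth_η : SmoothBil F.η
  smooth_θ : SmoothBil F.θ
  selfDual_ζ : ∀ x, g.SelfDualForm o (F.ζ x)
  selfDual_η : ∀ x, g.SelfDualForm o (F.η x)
  selfDual_θ : ∀ x, g.SelfDualForm o (F.θ x)
  weyl_ζ : ∀ x u v, g.weylOp x (F.ζ x) u v = 0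
  weyl_η : ∀ x u v, g.weylOp x (F.η x) u v = -F.ζ x u v
  weyl_θ : ∀ x u v, g.weylOp x (F.θ x) u v = F.η x u v
  ζθ : ∀ x, g.pairing x (fun u v ↦ F.ζ x u v) (fun u v ↦ F.θ x u v) = 2
  ηη : ∀ x, g.pairing x (fun u v ↦ F.η x u v) (fun u v ↦ F.η x u v) = -2
  ζζ : ∀ x, g.pairing x (fun u v ↦ F.ζ x u v) (fun u v ↦ F.ζ x u v) = 0
  ζη : ∀ x, g.pairing x (fun u v ↦ F.ζ x u v) (fun u v ↦ F.η x u v) = 0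
  ηθ : ∀ x, g.pairing x (fun u v ↦ F.η x u v) (fun u v ↦ F.θ x u v) = 0
  θθ : ∀ x, g.pairing x (fun u v ↦ F.θ x u v) (fun u v ↦ F.θ x u v) = 0
  /- `η v = v` on `𝒱` and `η w = -w` on `ℋ`, where `g(ηv, u) = η(v, u)`. -/
  η_V : ∀ x, ∀ v ∈ F.V x, ∀ u, F.η x v u = g.val x v u
  η_H : ∀ x, ∀ w ∈ F.H x, ∀ u, F.η x w u = -g.val x w u
  /- `∇ζ = 2α⊗ζ + 2β⊗η`, `∇η = 2γ⊗ζ + 2β⊗θ`, `∇θ = 2γ⊗η - 2α⊗θ`. -/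
  nabla_ζ : ∀ x w u v, g.nablaBil F.ζ x w u v =
    2 * F.α x w * F.ζ x u v + 2 * F.β x w * F.η x u v
  nabla_η : ∀ x w u v, g.nablaBil F.η x w u v =
    2 * F.γ x w * F.ζ x u v + 2 * F.β x w * F.θ x u v
  nabla_θ : ∀ x w u v, g.nablaBil F.θ x w u v =
    2 * F.γ x w * F.η x u v - 2 * F.α x w * F.θ x u v

end FrameData

end NeutralFour

end

/-! # Self-dual neutral Einstein four-manifolds of Petrov type III

At each point, the self-dual `2`-forms, viewed as endomorphisms `φ^♯` of the tangent space, satisfy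
the Clifford relation `φ^♯ ψ^♯ + ψ^♯ φ^♯ = -⟨φ, ψ⟩ Id` and commute with the anti-self-dual ones
(`SelfDualForm.anticomm`, `IsFrame.comm`). All the pointwise algebra follows from this: if `ζ` is
null, then `Ker ζ` is the image of `ζ^♯`, which is a null plane whose bivector is self-dual.

*Existence.* On `Λ⁺` the operator `W` is nilpotent and self-adjoint, so that a basis
`Wc = b`, `Wb = a`, `Wa = 0` can be modified until its inner products are the required ones; this
leaves only a common sign, which is fixed by `η = 1` on `Ker ζ` (`IsPetrovIII.exists_frame`). The
frame chosen pointwise is automatically smooth: for a smooth `2`-form `φ` with `⟨φ, ζ⟩ ≠ 0`, whose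
coefficients in the frame are `p, q, r`, one has `Wφ = -qζ + rη` and `W²φ = -rζ`, since `W` vanishes
on `Λ⁻`, and the signs of the frame can be recovered from `Wφ` and `W²φ` because `η ζ = ζ` as
endomorphisms (`smooth_frame`). Differentiating the Clifford relations shows that the covariant
derivatives of `ζ, η, θ` are self-dual again, and differentiating the inner products leaves three
coefficients `α, β, γ` (`exists_connection`).

*The distribution `Ker ζ`.* If `X` is a section of `Ker ζ`, then differentiating `ζ^♯ X = 0` gives
`ζ(∇_w X, ·) = -2 β(w) g(X, ·)` (`ζ_nabla`), so that `Ker ζ` is parallel if and only if `β = 0`.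

*Parallel null distributions.* The curvature operators preserve a parallel distribution `D`. If `D`
is a null plane field, it follows that `g(R(a, b)d, d') = 0` for `d, d'` in `D`, and for an Einstein
metric with `Ric = c g` this makes the bivector of `D` an eigenvector of `W` for the eigenvalue
`-c / 3` (`weylOp_bivector`). If `D` is compatible with the orientation, the nilpotency of `W` on
`Λ⁺` forces `c = 0`, and the bivector is a multiple of `ζ`, that is, `D = Ker ζ`
(`eq_V_of_isParallel`).

The Levi-Civita connection and the curvature are given on vector fields extended by constant
components in a chart, so that their tensorial nature has to be established. This is done by means
of the predicate `Tensorial`, for operations on vector fields that are linear over smooth functions.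
-/

open scoped Manifold ContDiff Topology

noncomputable section

namespace NeutralFour

/-! ### Contraction with the metric -/

section

variable {M : Type*} [TopologicalSpace M] [ChartedSpace E4 M]

instance finiteDimensional_tangent (x : M) : FiniteDimensional ℝ (T x) :=
  inferInstanceAs (FiniteDimensional ℝ E4)

instance t2Space_tangent (x : M) : T2Space (T x) :=
  inferInstanceAs (T2Space E4)

lemma finrank_tangent (x : M) : Module.finrank ℝ (T x) = 4 := by
  change Module.finrank ℝ E4 = 4
  simp

/-- The vectors `coordVec x i` as a basis of `T_xM`. -/
def coordBasis (x : M) : Module.Basis (Fin 4) ℝ (T x) :=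
  (EuclideanSpace.basisFun (Fin 4) ℝ).toBasis

@[simp] lemma coordBasis_apply (x : M) (i : Fin 4) : coordBasis x i = coordVec x i := by
  change (EuclideanSpace.basisFun (Fin 4) ℝ).toBasis i = EuclideanSpace.single i (1 : ℝ)
  simp

namespace NeutralMetric

variable [IsManifold 𝓘(ℝ, E4) ∞ M] (g : NeutralMetric M) {x : M}

lemma sum_sgn_smul {b : Module.Basis (Fin 4) ℝ (T x)}
    (hb : ∀ i j, g.val x (b i) (b j) = if i = j then sgn i else 0) (u : T x) :
    u = ∑ k, (sgn k * g.val x u (b k)) • b k := by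
  have h : ∀ k, g.val x u (b k) = sgn k * b.repr u k := by
    intro k
    have := congrArg (fun t ↦ g.val x t (b k)) (b.sum_repr u)
    simpa [hb, mul_comm, _root_.sum_apply, -Module.Basis.sum_repr] using this.symm
  conv_lhs => rw [← b.sum_repr u]
  refine Finset.sum_congr rfl fun k _ ↦ ?_
  rw [h k, ← mul_assoc]
  have : sgn k * sgn k = 1 := by fin_cases k <;> simp [sgn]
  rw [this, one_mul]

lemma eq_zero_of_forall {u : T x} (h : ∀ w, g.val x u w = 0) : u = 0 := by
  obtain ⟨b, hb⟩ := g.signature x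
  rw [g.sum_sgn_smul hb u]
  simp [h]

lemma eq_of_forall {u v : T x} (h : ∀ w, g.val x u w = g.val x v w) : u = v := by
  rw [← sub_eq_zero]
  exact g.eq_zero_of_forall fun w ↦ by simp [h]

/-- The matrix of the metric at `x` in a basis. -/
def gram (b : Module.Basis (Fin 4) ℝ (T x)) : Matrix (Fin 4) (Fin 4) ℝ :=
  Matrix.of fun i j ↦ g.val x (b i) (b j)

/-- The metric is nondegenerate. -/
lemma gram_det_ne_zero (b : Module.Basis (Fin 4) ℝ (T x)) : (g.gram b).det ≠ 0 := by
  intro h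
  obtain ⟨v, hv, hv0⟩ := Matrix.exists_mulVec_eq_zero_iff.mpr h
  apply hv
  have h0 : ∑ j, v j • b j = 0 := by
    refine g.eq_zero_of_forall fun w ↦ ?_
    rw [g.symm, ← b.sum_repr w]
    simp only [map_sum, map_smul, _root_.sum_apply, _root_.smul_apply, smul_eq_mul]
    simp_rw [Finset.mul_sum]
    rw [Finset.sum_comm]
    refine Finset.sum_eq_zero fun i _ ↦ ?_
    have := congrFun hv0 i
    simp only [Matrix.mulVec, dotProduct, gram, Matrix.of_apply, Pi.zero_apply] at this
    have h2 : ∑ j, v j * g.val x (b i) (b j) = 0 := by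
      rw [← this]
      exact Finset.sum_congr rfl fun j _ ↦ mul_comm _ _
    simp_rw [mul_left_comm (v _)]
    rw [← Finset.mul_sum, h2, mul_zero]
  exact funext fun j ↦ Fintype.linearIndependent_iff.mp b.linearIndependent v h0 j

/-- Raising an index: the components of `u` are `h^{ij} g(u, b_j)`,
where `h` is the inverse of the matrix of the metric. -/
lemma sum_gram_inv (b : Module.Basis (Fin 4) ℝ (T x)) (u : T x) :
    u = ∑ i, ∑ j, ((g.gram b)⁻¹ i j * g.val x u (b j)) • b i := by
  have hdet : IsUnit (g.gram b).det := (g.gram_det_ne_zero b).isUnit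
  have h1 : ∀ j, g.val x u (b j) = ((g.gram b).mulVec (b.repr u)) j := by
    intro j
    rw [g.symm]
    have := congrArg (g.val x (b j)) (b.sum_repr u)
    rw [← this]
    simp [Matrix.mulVec, dotProduct, gram, mul_comm, -Module.Basis.sum_repr]
  have h2 : ∀ i, ∑ j, (g.gram b)⁻¹ i j * g.val x u (b j) = b.repr u i := by
    intro i
    simp_rw [h1]
    change ((g.gram b)⁻¹.mulVec ((g.gram b).mulVec (b.repr u))) i = _
    rw [Matrix.mulVec_mulVec, Matrix.nonsing_inv_mul _ hdet, Matrix.one_mulVec]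
  simp_rw [← Finset.sum_smul, h2]
  exact (b.sum_repr u).symm

lemma gram_inv_symm (b : Module.Basis (Fin 4) ℝ (T x)) (i j : Fin 4) :
    (g.gram b)⁻¹ i j = (g.gram b)⁻¹ j i := by
  have : (g.gram b).transpose = g.gram b := by
    ext i j
    exact g.symm x _ _
  conv_lhs => rw [← this, ← Matrix.transpose_nonsing_inv]
  rfl

lemma inv_eq : g.inv x = (g.gram (coordBasis x))⁻¹ := by
  simp [inv, gram]

/-- Contracting with the form `g(u, ·)` is inserting `u`. -/
lemma contract_left (u : T x) {L : T x → ℝ} (hL : IsLinearMap ℝ L) :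
    g.contract x (fun a b ↦ g.val x u a * L b) = L u := by
  have h := congrArg (hL.mk' L) (g.sum_gram_inv (coordBasis x) u)
  simp only [map_sum, map_smul, smul_eq_mul, IsLinearMap.mk'_apply] at h
  rw [h, contract, inv_eq, Finset.sum_comm]
  refine Finset.sum_congr rfl fun i _ ↦ Finset.sum_congr rfl fun j _ ↦ ?_
  rw [g.gram_inv_symm]
  simp only [coordBasis_apply]
  ring

lemma contract_sum {ι : Type*} (s : Finset ι) (B : ι → T x → T x → ℝ) :
    g.contract x (fun a b ↦ ∑ k ∈ s, B k a b) = ∑ k ∈ s, g.contract x (B k) := by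
  simp only [contract, Finset.mul_sum]
  rw [Finset.sum_comm]
  rw [Finset.sum_comm]
  simp_rw [Finset.sum_comm (s := s)]

lemma contract_mul_left (r : ℝ) (B : T x → T x → ℝ) :
    g.contract x (fun a b ↦ r * B a b) = r * g.contract x B := by
  simp only [contract, Finset.mul_sum]
  exact Finset.sum_congr rfl fun i _ ↦ Finset.sum_congr rfl fun j _ ↦ by ring

lemma contract_add (B B' : T x → T x → ℝ) :
    g.contract x (fun a b ↦ B a b + B' a b) = g.contract x B + g.contract x B' := by
  simp only [contract, mul_add, Finset.sum_add_distrib]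

/-- The contraction does not depend on the basis. -/
lemma contract_eq_basis (b : Module.Basis (Fin 4) ℝ (T x)) {B : T x → T x → ℝ}
    (hB : IsBilinearMap ℝ B) :
    g.contract x B = ∑ i, ∑ j, (g.gram b)⁻¹ i j * B (b i) (b j) := by
  have hl : ∀ c, IsLinearMap ℝ fun a ↦ B a c := fun c ↦
    ⟨fun u v ↦ hB.add_left u v c, fun r u ↦ hB.smul_left r u c⟩
  have hr : ∀ a, IsLinearMap ℝ fun c ↦ B a c := fun a ↦
    ⟨fun u v ↦ hB.add_right a u v, fun r u ↦ hB.smul_right r a u⟩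
  have h : ∀ a c, B a c = ∑ i, ∑ j, (g.gram b)⁻¹ i j * (g.val x (b j) a * B (b i) c) := by
    intro a c
    have h := congrArg ((hl c).mk' _) (g.sum_gram_inv b a)
    simp only [map_sum, map_smul, smul_eq_mul, IsLinearMap.mk'_apply] at h
    rw [h]
    refine Finset.sum_congr rfl fun i _ ↦ Finset.sum_congr rfl fun j _ ↦ ?_
    rw [g.symm]
    ring
  have h' : B = fun a c ↦ ∑ i, ∑ j, (g.gram b)⁻¹ i j * (g.val x (b j) a * B (b i) c) :=
    funext fun a ↦ funext fun c ↦ h a c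
  conv_lhs => rw [h']
  rw [contract_sum]
  refine Finset.sum_congr rfl fun i _ ↦ ?_
  rw [contract_sum]
  refine Finset.sum_congr rfl fun j _ ↦ ?_
  rw [contract_mul_left, g.contract_left (b j) (hr (b i))]

lemma contract_orthonormal {b : Module.Basis (Fin 4) ℝ (T x)}
    (hb : ∀ i j, g.val x (b i) (b j) = if i = j then sgn i else 0) {B : T x → T x → ℝ}
    (hB : IsBilinearMap ℝ B) :
    g.contract x B = ∑ i, sgn i * B (b i) (b i) := by
  have hG : g.gram b = Matrix.diagonal sgn := by
    ext i j
    simp [gram, hb, Matrix.diagonal_apply]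
  have hG' : (g.gram b)⁻¹ = Matrix.diagonal sgn := by
    refine Matrix.inv_eq_left_inv ?_
    rw [hG, Matrix.diagonal_mul_diagonal, ← Matrix.diagonal_one]
    congr 1
    ext k
    fin_cases k <;> simp [sgn]
  rw [g.contract_eq_basis b hB, hG']
  simp [Matrix.diagonal_apply]

lemma contract_metric : g.contract x (fun a b ↦ g.val x a b) = 4 := by
  obtain ⟨b, hb⟩ := g.signature x
  rw [g.contract_orthonormal hb ⟨by simp, by simp, by simp, by simp⟩]
  simp [hb, Fin.sum_univ_four, sgn]
  norm_num

/-- The endomorphism `φ^♯` with `g(φ^♯ u, v) = φ(u, v)`. It is defined by raising an index in the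
basis `coordVec x`; see `val_sharp` for the characterization. -/
def sharp (φ : Bil x) : T x →ₗ[ℝ] T x :=
  ∑ i, ∑ j, (g.inv x i j) • ((φ.toLinearMap₁₂).flip (coordVec x j)).smulRight (coordVec x i)

/-- The vector `g^{ij} K(∂_j) ∂_i` represents the linear form `K`. -/
lemma val_sum_inv {K : T x → ℝ} (hK : IsLinearMap ℝ K) (w : T x) :
    g.val x (∑ i, ∑ j, (g.inv x i j * K (coordVec x j)) • coordVec x i) w = K w := by
  have h := g.contract_left w hK
  rw [← h, contract]
  simp only [map_sum, map_smul, _root_.sum_apply, _root_.smul_apply,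
      smul_eq_mul]
  refine Finset.sum_congr rfl fun i _ ↦ Finset.sum_congr rfl fun j _ ↦ ?_
  rw [g.symm]
  ring

@[simp] lemma val_sharp (φ : Bil x) (u v : T x) : g.val x (g.sharp φ u) v = φ u v := by
  have hK : IsLinearMap ℝ (fun v ↦ φ u v) := ⟨by simp, by simp⟩
  rw [← g.val_sum_inv hK v]
  congr 2
  simp [sharp, mul_smul]

lemma pairing_orthonormal {b : Module.Basis (Fin 4) ℝ (T x)}
    (hb : ∀ i j, g.val x (b i) (b j) = if i = j then sgn i else 0) (φ ψ : Bil x) :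
    g.pairing x (fun u v ↦ φ u v) (fun u v ↦ ψ u v) =
      (1 / 2) * ∑ i, ∑ j, sgn i * (sgn j * (φ (b i) (b j) * ψ (b i) (b j))) := by
  have h1 : ∀ j a : T x, g.contract x (fun k c ↦ φ j k * ψ a c) =
      ∑ l, sgn l * (φ j (b l) * ψ a (b l)) := fun j a ↦
    g.contract_orthonormal hb ⟨by simp [add_mul], by simp [mul_assoc], by simp [mul_add],
      by simp [mul_left_comm]⟩
  unfold pairing
  simp_rw [h1]
  rw [g.contract_orthonormal hb]
  · simp_rw [Finset.mul_sum]
  · constructor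
    · intro u v w
      simp only [map_add, _root_.add_apply, ← Finset.sum_add_distrib]
      exact Finset.sum_congr rfl fun _ _ ↦ by ring
    · intro r u w
      simp only [map_smul, _root_.smul_apply, smul_eq_mul, Finset.mul_sum]
      exact Finset.sum_congr rfl fun _ _ ↦ by ring
    · intro u v w
      simp only [map_add, _root_.add_apply, ← Finset.sum_add_distrib]
      exact Finset.sum_congr rfl fun _ _ ↦ by ring
    · intro r u w
      simp only [map_smul, _root_.smul_apply, smul_eq_mul, Finset.mul_sum]
      exact Finset.sum_congr rfl fun _ _ ↦ by ring

lemma pairing_comm (φ ψ : Bil x) :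
    g.pairing x (fun u v ↦ φ u v) (fun u v ↦ ψ u v) =
      g.pairing x (fun u v ↦ ψ u v) (fun u v ↦ φ u v) := by
  obtain ⟨b, hb⟩ := g.signature x
  rw [g.pairing_orthonormal hb, g.pairing_orthonormal hb]
  simp only [mul_comm (φ _ _)]

lemma pairing_add_right (A B C : T x → T x → ℝ) :
    g.pairing x A (fun u v ↦ B u v + C u v) = g.pairing x A B + g.pairing x A C := by
  simp only [pairing, mul_add, contract_add]

lemma pairing_smul_right (r : ℝ) (A B : T x → T x → ℝ) :
    g.pairing x A (fun u v ↦ r * B u v) = r * g.pairing x A B := by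
  simp only [pairing, mul_left_comm _ r, contract_mul_left]

lemma pairing_add_left (A B C : T x → T x → ℝ) :
    g.pairing x (fun u v ↦ B u v + C u v) A = g.pairing x B A + g.pairing x C A := by
  simp only [pairing, mul_add, add_mul, contract_add]

lemma pairing_smul_left (r : ℝ) (A B : T x → T x → ℝ) :
    g.pairing x (fun u v ↦ r * B u v) A = r * g.pairing x B A := by
  simp only [pairing, mul_assoc, mul_left_comm _ r, contract_mul_left]

end NeutralMetric

lemma isBilinearMap_bil {x : M} (φ : Bil x) : IsBilinearMap ℝ fun u v ↦ φ u v :=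
  ⟨by simp, by simp, by simp, by simp⟩

lemma IsTwoForm.swap {x : M} {φ : Bil x} (h : IsTwoForm φ) (u v : T x) : φ u v = -φ v u := by
  have := h (u + v)
  simp [h u, h v] at this
  linarith

namespace NeutralMetric

variable [IsManifold 𝓘(ℝ, E4) ∞ M] (g : NeutralMetric M) {x : M}

lemma bivector_apply (u v a b : T x) :
    g.bivector u v a b = g.val x u a * g.val x v b - g.val x v a * g.val x u b := by
  simp [bivector]

lemma isTwoForm_bivector (u v : T x) : IsTwoForm (g.bivector u v) := fun a ↦ by
  rw [bivector_apply]; ring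

/-- Pairing with a bivector is evaluation of the skew-symmetric part. -/
lemma two_mul_pairing_bivector {A : T x → T x → ℝ} (hA : IsBilinearMap ℝ A) (u v : T x) :
    2 * g.pairing x (fun a b ↦ g.bivector u v a b) A = A u v - A v u := by
  have hl : ∀ c, IsLinearMap ℝ fun a ↦ A a c := fun c ↦
    ⟨fun u v ↦ hA.add_left u v c, fun r u ↦ hA.smul_left r u c⟩
  have hr : ∀ a, IsLinearMap ℝ fun c ↦ A a c := fun a ↦
    ⟨fun u v ↦ hA.add_right a u v, fun r u ↦ hA.smul_right r a u⟩
  have h1 : ∀ j a : T x, g.contract x (fun k c ↦ g.bivector u v j k * A a c) =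
      g.val x u j * A a v + (-1) * (g.val x v j * A a u) := by
    intro j a
    rw [← g.contract_left v (hr a), ← g.contract_left u (hr a), ← contract_mul_left,
      ← contract_mul_left, ← contract_mul_left, ← contract_add]
    congr 1
    ext k c
    rw [bivector_apply]
    ring
  unfold pairing
  simp_rw [h1]
  rw [contract_add, contract_mul_left, g.contract_left u (hl v), g.contract_left v (hl u)]
  ring

lemma pairing_bivector {φ : Bil x} (hφ : IsTwoForm φ) (u v : T x) :
    g.pairing x (fun a b ↦ g.bivector u v a b) (fun a b ↦ φ a b) = φ u v := by
  have h := g.two_mul_pairing_bivector (isBilinearMap_bil φ) u v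
  rw [hφ.swap v u] at h
  linarith

end NeutralMetric

end

/-! ### Self-dual and anti-self-dual forms at a point -/

section

variable {M : Type*} [TopologicalSpace M] [ChartedSpace E4 M]

lemma bil_ext {x : M} (b : Module.Basis (Fin 4) ℝ (T x)) {φ ψ : Bil x}
    (h : ∀ i j, φ (b i) (b j) = ψ (b i) (b j)) : φ = ψ := by
  have h1 : φ.toLinearMap₁₂ = ψ.toLinearMap₁₂ := b.ext fun i ↦ b.ext fun j ↦ h i j
  ext u v
  exact congrArg (fun f ↦ f u v) h1

lemma IsTwoForm.add {x : M} {φ ψ : Bil x} (hφ : IsTwoForm φ) (hψ : IsTwoForm ψ) :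
    IsTwoForm (φ + ψ) := fun v ↦ by simp [hφ v, hψ v]

lemma IsTwoForm.smul {x : M} {φ : Bil x} (r : ℝ) (hφ : IsTwoForm φ) :
    IsTwoForm (r • φ) := fun v ↦ by simp [hφ v]

/-- Linear independence of three forms at a point, spelled out so that no family indexed by
`Fin 3` is needed. -/
def Independent {x : M} (A B C : Bil x) : Prop :=
  ∀ p q r : ℝ, p • A + q • B + r • C = 0 → p = 0 ∧ q = 0 ∧ r = 0

lemma Independent.of_linearIndependent {x : M} {A B C : Bil x}
    (h : LinearIndependent ℝ ![A, B, C]) : Independent A B C := by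
  intro p q r h0
  have hc := (Fintype.linearIndependent_iff (R := ℝ) (v := ![A, B, C])).mp h ![p, q, r]
    (by rw [Fin.sum_univ_three]; exact h0)
  exact ⟨hc 0, hc 1, hc 2⟩

/-- The components `φ₀₁ = φ₂₃`, `φ₀₂ = φ₁₃`, `φ₀₃ = -φ₁₂` of a self-dual form in a positively
oriented orthonormal basis. -/
structure SDIn {x : M} (b : Module.Basis (Fin 4) ℝ (T x)) (φ : Bil x) : Prop where
  form : IsTwoForm φ
  c01 : φ (b 2) (b 3) = φ (b 0) (b 1)
  c02 : φ (b 1) (b 3) = φ (b 0) (b 2)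
  c03 : φ (b 1) (b 2) = -φ (b 0) (b 3)

/-- The components `φ₀₁ = -φ₂₃`, `φ₀₂ = -φ₁₃`, `φ₀₃ = φ₁₂` of an anti-self-dual form in a
positively oriented orthonormal basis. -/
structure ASDIn {x : M} (b : Module.Basis (Fin 4) ℝ (T x)) (φ : Bil x) : Prop where
  form : IsTwoForm φ
  c01 : φ (b 2) (b 3) = -φ (b 0) (b 1)
  c02 : φ (b 1) (b 3) = -φ (b 0) (b 2)
  c03 : φ (b 1) (b 2) = φ (b 0) (b 3)

namespace SDIn

variable {x : M} {b : Module.Basis (Fin 4) ℝ (T x)} {φ ψ : Bil x}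

lemma add (hφ : SDIn b φ) (hψ : SDIn b ψ) : SDIn b (φ + ψ) where
  form := hφ.form.add hψ.form
  c01 := by simp [hφ.c01, hψ.c01]
  c02 := by simp [hφ.c02, hψ.c02]
  c03 := by simp [hφ.c03, hψ.c03]; ring

lemma smul (r : ℝ) (hφ : SDIn b φ) : SDIn b (r • φ) where
  form := hφ.form.smul r
  c01 := by simp [hφ.c01]
  c02 := by simp [hφ.c02]
  c03 := by simp [hφ.c03]

/-- The matrix of a self-dual form with the components `p, q, r` along `01`, `02`, `03`. -/
def mat (p q r : ℝ) : Fin 4 → Fin 4 → ℝ :=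
  ![![0, p, q, r], ![-p, 0, -r, q], ![-q, r, 0, p], ![-r, -q, -p, 0]]

lemma exists_mat (h : SDIn b φ) :
    ∃ p q r : ℝ, ∀ i j, φ (b i) (b j) = mat p q r i j := by
  refine ⟨φ (b 0) (b 1), φ (b 0) (b 2), φ (b 0) (b 3), fun i j ↦ ?_⟩
  have s := h.form.swap
  fin_cases i <;> fin_cases j <;>
    simp [mat, h.form _, h.c01, h.c02, h.c03, s (b 1) (b 0), s (b 2) (b 0), s (b 3) (b 0),
      s (b 2) (b 1), s (b 3) (b 1), s (b 3) (b 2)]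

lemma eq_zero (h : SDIn b φ) (h1 : φ (b 0) (b 1) = 0) (h2 : φ (b 0) (b 2) = 0)
    (h3 : φ (b 0) (b 3) = 0) : φ = 0 := by
  obtain ⟨p, q, r, hm⟩ := h.exists_mat
  rw [hm] at h1 h2 h3
  simp only [mat, Matrix.cons_val] at h1 h2 h3
  refine bil_ext b fun i j ↦ ?_
  rw [hm, h1, h2, h3]
  fin_cases i <;> fin_cases j <;> simp [mat]

/-- `Λ⁺` is at most three-dimensional. -/
lemma exists_eq_comb {A B C : Bil x} (hA : SDIn b A) (hB : SDIn b B) (hC : SDIn b C)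
    (hLI : Independent A B C) (hφ : SDIn b φ) :
    ∃ p q r : ℝ, φ = p • A + q • B + r • C := by
  let f : Bil x →ₗ[ℝ] (Fin 3 → ℝ) :=
    { toFun := fun φ ↦ ![φ (b 0) (b 1), φ (b 0) (b 2), φ (b 0) (b 3)]
      map_add' := fun φ ψ ↦ by ext i; fin_cases i <;> simp
      map_smul' := fun r φ ↦ by ext i; fin_cases i <;> simp }
  have hf : ∀ ψ, SDIn b ψ → f ψ = 0 → ψ = 0 := fun ψ hψ h ↦
    hψ.eq_zero (congrFun h 0) (congrFun h 1) (congrFun h 2)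
  have hLI' : LinearIndependent ℝ ![f A, f B, f C] := by
    rw [Fintype.linearIndependent_iff]
    intro c hc
    simp only [Fin.sum_univ_three, Matrix.cons_val_zero, Matrix.cons_val_one, Matrix.cons_val]
      at hc
    rw [← map_smul, ← map_smul, ← map_smul, ← map_add, ← map_add] at hc
    obtain ⟨h0, h1, h2⟩ :=
      hLI _ _ _ (hf _ (((hA.smul _).add (hB.smul _)).add (hC.smul _)) hc)
    intro i
    fin_cases i
    exacts [h0, h1, h2]
  have hspan := hLI'.span_eq_top_of_card_eq_finrank (by simp)
  have hmem : f φ ∈ Submodule.span ℝ (Set.range ![f A, f B, f C]) := by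
    rw [hspan]; trivial
  rw [Submodule.mem_span_range_iff_exists_fun] at hmem
  obtain ⟨c, hc⟩ := hmem
  refine ⟨c 0, c 1, c 2, ?_⟩
  have h0 := hf (φ + (-1 : ℝ) • (c 0 • A + c 1 • B + c 2 • C))
    (hφ.add ((((hA.smul _).add (hB.smul _)).add (hC.smul _)).smul _)) (by
      simp only [Fin.sum_univ_three, Matrix.cons_val_zero, Matrix.cons_val_one,
        Matrix.cons_val] at hc
      simp only [map_add, map_smul, ← hc]
      module)
  calc φ = (φ + (-1 : ℝ) • (c 0 • A + c 1 • B + c 2 • C)) + (c 0 • A + c 1 • B + c 2 • C) := by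
        module
    _ = _ := by rw [h0]; module

end SDIn

/-- The matrix of an anti-self-dual form with the components `p, q, r` along `01`, `02`, `03`. -/
def ASDIn.mat (p q r : ℝ) : Fin 4 → Fin 4 → ℝ :=
  ![![0, p, q, r], ![-p, 0, r, -q], ![-q, -r, 0, -p], ![-r, q, p, 0]]

lemma ASDIn.exists_mat {x : M} {b : Module.Basis (Fin 4) ℝ (T x)} {φ : Bil x}
    (h : ASDIn b φ) : ∃ p q r : ℝ, ∀ i j, φ (b i) (b j) = mat p q r i j := by
  refine ⟨φ (b 0) (b 1), φ (b 0) (b 2), φ (b 0) (b 3), fun i j ↦ ?_⟩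
  have s := h.form.swap
  fin_cases i <;> fin_cases j <;>
    simp [mat, h.form _, h.c01, h.c02, h.c03, s (b 1) (b 0), s (b 2) (b 0), s (b 3) (b 0),
      s (b 2) (b 1), s (b 3) (b 1), s (b 3) (b 2)]

namespace NeutralMetric

variable [IsManifold 𝓘(ℝ, E4) ∞ M] (g : NeutralMetric M)
  (o : Π x : M, Orientation ℝ (T x) (Fin 4)) {x : M}

/-- Changing the sign of a vector of an orthonormal basis adjusts its orientation. -/
lemma exists_isPosOrthonormal (x : M) :
    ∃ b : Module.Basis (Fin 4) ℝ (T x), g.IsPosOrthonormal o b := by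
  obtain ⟨b, hb⟩ := g.signature x
  refine ⟨b.adjustToOrientation (o x), b.orientation_adjustToOrientation _, fun i j ↦ ?_⟩
  have h := b.adjustToOrientation_apply_eq_or_eq_neg (o x)
  by_cases hij : i = j
  · subst hij
    rcases h i with h | h <;> simp [h, hb]
  · rcases h i with h1 | h1 <;> rcases h j with h2 | h2 <;> simp [h1, h2, hb, hij]

variable {g o}

lemma SelfDualForm.add {φ ψ : Bil x} (hφ : g.SelfDualForm o φ) (hψ : g.SelfDualForm o ψ) :
    g.SelfDualForm o (φ + ψ) := by
  refine ⟨hφ.1.add hψ.1, fun b hb χ hχ ↦ ?_⟩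
  have h := pairing_add_right g (x := x) (fun u v ↦ χ u v) (fun u v ↦ φ u v) (fun u v ↦ ψ u v)
  have h1 := hφ.2 b hb χ hχ
  have h2 := hψ.2 b hb χ hχ
  simp only [_root_.add_apply]
  rw [h, ← h1, ← h2]
  simp only [wedgeEval, _root_.add_apply]
  ring

lemma SelfDualForm.smul {φ : Bil x} (r : ℝ) (hφ : g.SelfDualForm o φ) :
    g.SelfDualForm o (r • φ) := by
  refine ⟨hφ.1.smul r, fun b hb χ hχ ↦ ?_⟩
  have h := pairing_smul_right g (x := x) r (fun u v ↦ χ u v) (fun u v ↦ φ u v)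
  have h1 := hφ.2 b hb χ hχ
  simp only [_root_.smul_apply, smul_eq_mul]
  rw [h, ← h1]
  simp only [wedgeEval, _root_.smul_apply, smul_eq_mul]
  ring

lemma SelfDualForm.sdIn {φ : Bil x} {b : Module.Basis (Fin 4) ℝ (T x)}
    (hb : g.IsPosOrthonormal o b) (hφ : g.SelfDualForm o φ) : SDIn b φ := by
  have h : ∀ i j, wedgeEval (g.bivector (b i) (b j)) φ b = φ (b i) (b j) := fun i j ↦ by
    rw [hφ.2 b hb _ (g.isTwoForm_bivector _ _), g.pairing_bivector hφ.1]
  refine ⟨hφ.1, ?_, ?_, ?_⟩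
  · rw [← h 0 1]; simp [wedgeEval, bivector_apply, hb.2, sgn]
  · rw [← h 0 2]; simp [wedgeEval, bivector_apply, hb.2, sgn]
  · rw [← h 0 3]; simp [wedgeEval, bivector_apply, hb.2, sgn]

/-- Self-duality of components in one positively oriented orthonormal basis suffices, provided that
`Λ⁺` is known to have three independent elements. -/
lemma selfDualForm_of_sdIn {φ A B C : Bil x} {b : Module.Basis (Fin 4) ℝ (T x)}
    (hb : g.IsPosOrthonormal o b) (hA : g.SelfDualForm o A) (hB : g.SelfDualForm o B)
    (hC : g.SelfDualForm o C) (hLI : Independent A B C) (hφ : SDIn b φ) :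
    g.SelfDualForm o φ := by
  obtain ⟨p, q, r, rfl⟩ := SDIn.exists_eq_comb (hA.sdIn hb) (hB.sdIn hb) (hC.sdIn hb) hLI hφ
  exact ((hA.smul p).add (hB.smul q)).add (hC.smul r)

lemma pairing_add_apply (A : T x → T x → ℝ) (φ ψ : Bil x) :
    g.pairing x (fun u v ↦ (φ + ψ) u v) A =
      g.pairing x (fun u v ↦ φ u v) A + g.pairing x (fun u v ↦ ψ u v) A :=
  g.pairing_add_left A _ _

lemma pairing_smul_apply (A : T x → T x → ℝ) (r : ℝ) (φ : Bil x) :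
    g.pairing x (fun u v ↦ (r • φ) u v) A = r * g.pairing x (fun u v ↦ φ u v) A :=
  g.pairing_smul_left r _ _

/-- A form orthogonal to `Λ⁺` is anti-self-dual in components. -/
lemma asdIn_of_orthogonal {κ A B C : Bil x} {b : Module.Basis (Fin 4) ℝ (T x)}
    (hb : g.IsPosOrthonormal o b) (hA : g.SelfDualForm o A) (hB : g.SelfDualForm o B)
    (hC : g.SelfDualForm o C) (hLI : Independent A B C) (hκ : IsTwoForm κ)
    (h : ∀ φ, g.SelfDualForm o φ → g.pairing x (fun u v ↦ φ u v) (fun u v ↦ κ u v) = 0) :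
    ASDIn b κ := by
  have key : ∀ (r : ℝ) (i j k l : Fin 4),
      SDIn b (g.bivector (b i) (b j) + r • g.bivector (b k) (b l)) →
      κ (b i) (b j) + r * κ (b k) (b l) = 0 := by
    intro r i j k l hs
    have := h _ (selfDualForm_of_sdIn hb hA hB hC hLI hs)
    rwa [pairing_add_apply, pairing_smul_apply,
      g.pairing_bivector hκ, g.pairing_bivector hκ] at this
  have two : ∀ (r : ℝ) (i j k l : Fin 4),
      IsTwoForm (g.bivector (b i) (b j) + r • g.bivector (b k) (b l)) := fun r i j k l ↦
    (g.isTwoForm_bivector _ _).add ((g.isTwoForm_bivector _ _).smul r)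
  have h1 := key 1 0 1 2 3 ⟨two _ _ _ _ _, by simp [bivector_apply, hb.2, sgn],
    by simp [bivector_apply, hb.2, sgn], by simp [bivector_apply, hb.2, sgn]⟩
  have h2 := key 1 0 2 1 3 ⟨two _ _ _ _ _, by simp [bivector_apply, hb.2, sgn],
    by simp [bivector_apply, hb.2, sgn], by simp [bivector_apply, hb.2, sgn]⟩
  have h3 := key (-1) 0 3 1 2 ⟨two _ _ _ _ _, by simp [bivector_apply, hb.2, sgn],
    by simp [bivector_apply, hb.2, sgn], by simp [bivector_apply, hb.2, sgn]⟩
  exact ⟨hκ, by linarith, by linarith, by linarith⟩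

lemma pairing_components {φ ψ : Bil x} {b : Module.Basis (Fin 4) ℝ (T x)}
    (hb : g.IsPosOrthonormal o b) (hφ : IsTwoForm φ) (hψ : IsTwoForm ψ) :
    g.pairing x (fun u v ↦ φ u v) (fun u v ↦ ψ u v) =
      φ (b 0) (b 1) * ψ (b 0) (b 1) - φ (b 0) (b 2) * ψ (b 0) (b 2)
      - φ (b 0) (b 3) * ψ (b 0) (b 3) - φ (b 1) (b 2) * ψ (b 1) (b 2)
      - φ (b 1) (b 3) * ψ (b 1) (b 3) + φ (b 2) (b 3) * ψ (b 2) (b 3) := by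
  rw [g.pairing_orthonormal hb.2]
  have s := hφ.swap
  have s' := hψ.swap
  simp only [Fin.sum_univ_four, hφ _, s (b 1) (b 0), s (b 2) (b 0), s (b 3) (b 0),
    s (b 2) (b 1), s (b 3) (b 1), s (b 3) (b 2), s' (b 1) (b 0), s' (b 2) (b 0), s' (b 3) (b 0),
    s' (b 2) (b 1), s' (b 3) (b 1), s' (b 3) (b 2)]
  simp [sgn]
  ring

lemma antiSelfDualForm_of_orthogonal {κ A B C : Bil x} (hA : g.SelfDualForm o A)
    (hB : g.SelfDualForm o B) (hC : g.SelfDualForm o C)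
    (hLI : Independent A B C) (hκ : IsTwoForm κ)
    (h : ∀ φ, g.SelfDualForm o φ → g.pairing x (fun u v ↦ φ u v) (fun u v ↦ κ u v) = 0) :
    g.AntiSelfDualForm o κ := by
  refine ⟨hκ, fun b hb φ hφ ↦ ?_⟩
  have hs := asdIn_of_orthogonal hb hA hB hC hLI hκ h
  rw [pairing_components hb hφ hκ]
  simp only [wedgeEval, _root_.neg_apply, hs.c01, hs.c02, hs.c03]
  ring

lemma SDIn.pairing_eq {φ ψ : Bil x} {b : Module.Basis (Fin 4) ℝ (T x)}
    (hb : g.IsPosOrthonormal o b) (hφ : SDIn b φ) (hψ : SDIn b ψ) :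
    g.pairing x (fun u v ↦ φ u v) (fun u v ↦ ψ u v) =
      2 * (φ (b 0) (b 1) * ψ (b 0) (b 1) - φ (b 0) (b 2) * ψ (b 0) (b 2)
      - φ (b 0) (b 3) * ψ (b 0) (b 3)) := by
  rw [pairing_components hb hφ.form hψ.form, hφ.c01, hφ.c02, hφ.c03, hψ.c01, hψ.c02, hψ.c03]
  ring

/-! ### The Clifford relations for self-dual forms -/

/-- The bilinear form `(u, v) ↦ φ(ψ^♯ u, v)`, that is, `g(φ^♯ ψ^♯ u, v)`. -/
def compForm (g : NeutralMetric M) (φ ψ : Bil x) : Bil x :=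
  φ ∘L (LinearMap.toContinuousLinearMap (g.sharp ψ))

@[simp] lemma compForm_apply (φ ψ : Bil x) (u v : T x) :
    g.compForm φ ψ u v = φ (g.sharp ψ u) v := rfl

lemma apply_sharp {b : Module.Basis (Fin 4) ℝ (T x)} (hb : g.IsPosOrthonormal o b)
    (φ ψ : Bil x) (u v : T x) :
    φ (g.sharp ψ u) v = ∑ k, sgn k * ψ u (b k) * φ (b k) v := by
  rw [g.sum_sgn_smul hb.2 (g.sharp ψ u)]
  simp [_root_.sum_apply]

/-- The Clifford relation, checked in components. -/
lemma anticomm_sdIn {φ ψ : Bil x} {b : Module.Basis (Fin 4) ℝ (T x)}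
    (hb : g.IsPosOrthonormal o b) (hφ : SDIn b φ) (hψ : SDIn b ψ) (u v : T x) :
    φ (g.sharp ψ u) v + ψ (g.sharp φ u) v =
      -g.pairing x (fun u v ↦ φ u v) (fun u v ↦ ψ u v) * g.val x u v := by
  suffices h : g.compForm φ ψ + g.compForm ψ φ =
      (-g.pairing x (fun u v ↦ φ u v) (fun u v ↦ ψ u v)) • g.val x from
    congrArg (fun χ : Bil x ↦ χ u v) h
  refine bil_ext b fun i j ↦ ?_
  rw [SDIn.pairing_eq hb hφ hψ]
  obtain ⟨p, q, r, hm⟩ := hφ.exists_mat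
  obtain ⟨p', q', r', hm'⟩ := hψ.exists_mat
  simp only [_root_.add_apply, compForm_apply, apply_sharp hb, _root_.smul_apply, smul_eq_mul,
    hb.2, Fin.sum_univ_four, hm, hm']
  fin_cases i <;> fin_cases j <;> simp [SDIn.mat, sgn] <;> ring

/-- Self-dual and anti-self-dual forms commute. -/
lemma comm_asdIn {φ κ : Bil x} {b : Module.Basis (Fin 4) ℝ (T x)}
    (hb : g.IsPosOrthonormal o b) (hφ : SDIn b φ) (hκ : ASDIn b κ) (u v : T x) :
    φ (g.sharp κ u) v = κ (g.sharp φ u) v := by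
  suffices h : g.compForm φ κ = g.compForm κ φ from congrArg (fun χ : Bil x ↦ χ u v) h
  refine bil_ext b fun i j ↦ ?_
  obtain ⟨p, q, r, hm⟩ := hφ.exists_mat
  obtain ⟨p', q', r', hm'⟩ := hκ.exists_mat
  simp only [compForm_apply, apply_sharp hb, Fin.sum_univ_four, hm, hm']
  fin_cases i <;> fin_cases j <;> simp [SDIn.mat, ASDIn.mat, sgn] <;> ring

/-- The composition of two orthogonal self-dual forms is a self-dual form
orthogonal to both of them. -/
lemma compForm_sdIn {φ ψ : Bil x} {b : Module.Basis (Fin 4) ℝ (T x)}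
    (hb : g.IsPosOrthonormal o b) (hφ : SDIn b φ) (hψ : SDIn b ψ)
    (h : g.pairing x (fun u v ↦ φ u v) (fun u v ↦ ψ u v) = 0) :
    SDIn b (g.compForm φ ψ) ∧
      g.pairing x (fun u v ↦ φ u v) (fun u v ↦ g.compForm φ ψ u v) = 0 ∧
      g.pairing x (fun u v ↦ ψ u v) (fun u v ↦ g.compForm φ ψ u v) = 0 := by
  have h' := SDIn.pairing_eq hb hφ hψ
  obtain ⟨p, q, r, hm⟩ := hφ.exists_mat
  obtain ⟨p', q', r', hm'⟩ := hψ.exists_mat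
  have hs : SDIn b (g.compForm φ ψ) := by
    constructor
    · intro v
      have h0 := anticomm_sdIn hb hφ hψ v v
      rw [h, neg_zero, zero_mul] at h0
      have h1 : φ (g.sharp ψ v) v = ψ (g.sharp φ v) v := by
        rw [hφ.form.swap, ← g.val_sharp φ v, g.symm, g.val_sharp, hψ.form.swap]
        ring
      rw [compForm_apply]
      linarith
    all_goals
      rw [h] at h'
      simp only [compForm_apply, apply_sharp hb, Fin.sum_univ_four, hm, hm'] at h' ⊢
      simp [SDIn.mat, sgn] at h' ⊢ <;> linarith
  refine ⟨hs, ?_, ?_⟩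
  · rw [SDIn.pairing_eq hb hφ hs]
    simp only [compForm_apply, apply_sharp hb, Fin.sum_univ_four, hm, hm']
    simp [SDIn.mat, sgn]
    ring
  · rw [SDIn.pairing_eq hb hψ hs]
    simp only [compForm_apply, apply_sharp hb, Fin.sum_univ_four, hm, hm']
    simp [SDIn.mat, sgn]
    ring

end NeutralMetric

end

/-! ### Null frames of the bundle of self-dual forms -/

section

variable {M : Type*} [TopologicalSpace M] [ChartedSpace E4 M]

namespace NeutralMetric

variable [IsManifold 𝓘(ℝ, E4) ∞ M] (g : NeutralMetric M) {x : M}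

/-- The inner product of two twice-covariant tensors. -/
def ip (φ ψ : Bil x) : ℝ := g.pairing x (fun u v ↦ φ u v) (fun u v ↦ ψ u v)

lemma ip_comm (φ ψ : Bil x) : g.ip φ ψ = g.ip ψ φ := g.pairing_comm φ ψ

lemma ip_add_left (φ ψ χ : Bil x) : g.ip (φ + ψ) χ = g.ip φ χ + g.ip ψ χ :=
  pairing_add_apply _ φ ψ

lemma ip_smul_left (r : ℝ) (φ χ : Bil x) : g.ip (r • φ) χ = r * g.ip φ χ :=
  pairing_smul_apply _ r φ

lemma ip_add_right (φ ψ χ : Bil x) : g.ip χ (φ + ψ) = g.ip χ φ + g.ip χ ψ := by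
  simp only [g.ip_comm χ, ip_add_left]

lemma ip_smul_right (r : ℝ) (φ χ : Bil x) : g.ip χ (r • φ) = r * g.ip χ φ := by
  simp only [g.ip_comm χ, ip_smul_left]

lemma ip_zero_left (χ : Bil x) : g.ip 0 χ = 0 := by
  have := g.ip_smul_left 0 0 χ
  rw [zero_mul] at this
  rw [← this]
  congr 1
  module

lemma ip_bivector {φ : Bil x} (hφ : IsTwoForm φ) (u v : T x) :
    g.ip (g.bivector u v) φ = φ u v :=
  g.pairing_bivector hφ u v

lemma sharp_eq_zero_iff {φ : Bil x} {v : T x} : g.sharp φ v = 0 ↔ φ v = 0 := by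
  constructor
  · intro h
    ext u
    rw [← val_sharp, h]
    simp
  · intro h
    refine g.eq_zero_of_forall fun w ↦ ?_
    rw [val_sharp, h]
    simp

variable (o : Π x : M, Orientation ℝ (T x) (Fin 4))

/-- A frame of `Λ⁺_xM` with the inner products `⟨ζ, θ⟩ = 2 = -⟨η, η⟩`,
the other ones being zero. -/
structure IsFrame (ζ η θ : Bil x) : Prop where
  sd_ζ : g.SelfDualForm o ζ
  sd_η : g.SelfDualForm o η
  sd_θ : g.SelfDualForm o θ
  ζθ : g.ip ζ θ = 2
  ηη : g.ip η η = -2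
  ζζ : g.ip ζ ζ = 0
  ζη : g.ip ζ η = 0
  ηθ : g.ip η θ = 0
  θθ : g.ip θ θ = 0

variable {g o}

/-- The Clifford relation `φ^♯ ψ^♯ + ψ^♯ φ^♯ = -⟨φ, ψ⟩ Id` for self-dual forms. -/
lemma SelfDualForm.anticomm {φ ψ : Bil x} (hφ : g.SelfDualForm o φ) (hψ : g.SelfDualForm o ψ)
    (u : T x) : g.sharp φ (g.sharp ψ u) + g.sharp ψ (g.sharp φ u) = (-g.ip φ ψ) • u := by
  obtain ⟨b, hb⟩ := g.exists_isPosOrthonormal o x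
  refine g.eq_of_forall fun w ↦ ?_
  simp only [map_add, map_smul, _root_.add_apply, _root_.smul_apply, val_sharp, smul_eq_mul]
  exact anticomm_sdIn hb (hφ.sdIn hb) (hψ.sdIn hb) u w

namespace IsFrame

variable {ζ η θ : Bil x}

lemma neg (h : g.IsFrame o ζ η θ) :
    g.IsFrame o ((-1 : ℝ) • ζ) ((-1 : ℝ) • η) ((-1 : ℝ) • θ) where
  sd_ζ := h.sd_ζ.smul _
  sd_η := h.sd_η.smul _
  sd_θ := h.sd_θ.smul _
  ζθ := by simp [ip_smul_left, ip_smul_right, h.ζθ]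
  ηη := by simp [ip_smul_left, ip_smul_right, h.ηη]
  ζζ := by simp [ip_smul_left, ip_smul_right, h.ζζ]
  ζη := by simp [ip_smul_left, ip_smul_right, h.ζη]
  ηθ := by simp [ip_smul_left, ip_smul_right, h.ηθ]
  θθ := by simp [ip_smul_left, ip_smul_right, h.θθ]

lemma ip_comb_ζ (h : g.IsFrame o ζ η θ) (p q r : ℝ) :
    g.ip (p • ζ + q • η + r • θ) ζ = 2 * r := by
  simp only [ip_add_left, ip_smul_left, h.ζζ, g.ip_comm η ζ, h.ζη, g.ip_comm θ ζ, h.ζθ]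
  ring

lemma ip_comb_η (h : g.IsFrame o ζ η θ) (p q r : ℝ) :
    g.ip (p • ζ + q • η + r • θ) η = -2 * q := by
  simp only [ip_add_left, ip_smul_left, h.ζη, h.ηη, g.ip_comm θ η, h.ηθ]
  ring

lemma ip_comb_θ (h : g.IsFrame o ζ η θ) (p q r : ℝ) :
    g.ip (p • ζ + q • η + r • θ) θ = 2 * p := by
  simp only [ip_add_left, ip_smul_left, h.ζθ, h.ηθ, h.θθ]
  ring

lemma independent (h : g.IsFrame o ζ η θ) : Independent ζ η θ := by
  intro p q r h0
  have h1 := h.ip_comb_ζ p q r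
  have h2 := h.ip_comb_η p q r
  have h3 := h.ip_comb_θ p q r
  rw [h0, ip_zero_left] at h1 h2 h3
  exact ⟨by linarith, by linarith, by linarith⟩

lemma exists_comb (h : g.IsFrame o ζ η θ) {φ : Bil x} (hφ : g.SelfDualForm o φ) :
    ∃ p q r : ℝ, φ = p • ζ + q • η + r • θ := by
  obtain ⟨b, hb⟩ := g.exists_isPosOrthonormal o x
  exact SDIn.exists_eq_comb (h.sd_ζ.sdIn hb) (h.sd_η.sdIn hb) (h.sd_θ.sdIn hb) h.independent
    (hφ.sdIn hb)

lemma comb (h : g.IsFrame o ζ η θ) (p q r : ℝ) : g.SelfDualForm o (p • ζ + q • η + r • θ) :=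
  ((h.sd_ζ.smul p).add (h.sd_η.smul q)).add (h.sd_θ.smul r)

/-- Every `2`-form is the sum of a self-dual form and a form orthogonal to `Λ⁺`. -/
lemma decompose (h : g.IsFrame o ζ η θ) {φ : Bil x} (hφ : IsTwoForm φ) :
    ∃ (p q r : ℝ) (κ : Bil x), φ = (p • ζ + q • η + r • θ) + κ ∧ IsTwoForm κ ∧
      ∀ ψ, g.SelfDualForm o ψ → g.ip ψ κ = 0 := by
  set p := g.ip φ θ / 2
  set q := -g.ip φ η / 2
  set r := g.ip φ ζ / 2
  refine ⟨p, q, r, φ + (-1 : ℝ) • (p • ζ + q • η + r • θ), by module,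
    hφ.add ((h.comb p q r).1.smul _), fun ψ hψ ↦ ?_⟩
  obtain ⟨p', q', r', rfl⟩ := h.exists_comb hψ
  have h1 := h.ip_comb_ζ p q r
  have h2 := h.ip_comb_η p q r
  have h3 := h.ip_comb_θ p q r
  rw [g.ip_comm, ip_add_left, ip_smul_left]
  simp only [ip_add_right _ _ (_ : Bil x) φ, ip_smul_right _ _ _ φ,
    ip_add_right _ _ _ (p • ζ + q • η + r • θ),
    ip_smul_right _ _ _ (p • ζ + q • η + r • θ), h1, h2, h3]
  simp only [p, q, r]
  ring

lemma antiSelfDual (h : g.IsFrame o ζ η θ) {κ : Bil x} (hκ : IsTwoForm κ)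
    (hk : ∀ ψ, g.SelfDualForm o ψ → g.ip ψ κ = 0) : g.AntiSelfDualForm o κ :=
  antiSelfDualForm_of_orthogonal h.sd_ζ h.sd_η h.sd_θ h.independent hκ hk

/-- A form orthogonal to `Λ⁺` commutes with `Λ⁺`. -/
lemma comm (h : g.IsFrame o ζ η θ) {φ κ : Bil x} (hφ : g.SelfDualForm o φ) (hκ : IsTwoForm κ)
    (hk : ∀ ψ, g.SelfDualForm o ψ → g.ip ψ κ = 0) (u : T x) :
    g.sharp φ (g.sharp κ u) = g.sharp κ (g.sharp φ u) := by
  obtain ⟨b, hb⟩ := g.exists_isPosOrthonormal o x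
  refine g.eq_of_forall fun w ↦ ?_
  rw [val_sharp, val_sharp]
  exact comm_asdIn hb (hφ.sdIn hb)
    (asdIn_of_orthogonal hb h.sd_ζ h.sd_η h.sd_θ h.independent hκ hk) u w

/-- A `2`-form orthogonal to `Λ⁺` and to its orthogonal complement vanishes. -/
lemma eq_zero_of_orthogonal (h : g.IsFrame o ζ η θ) {κ : Bil x} (hκ : IsTwoForm κ)
    (hk : ∀ ψ, g.SelfDualForm o ψ → g.ip ψ κ = 0)
    (hk' : ∀ κ' : Bil x, IsTwoForm κ' → (∀ ψ, g.SelfDualForm o ψ → g.ip ψ κ' = 0) →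
      g.ip κ' κ = 0) : κ = 0 := by
  ext u v
  obtain ⟨p, q, r, κ', he, h1, h2⟩ := h.decompose (g.isTwoForm_bivector u v)
  rw [← g.ip_bivector hκ u v, he, ip_add_left, hk _ (h.comb p q r), hk' κ' h1 h2]
  simp

section relations

variable (h : g.IsFrame o ζ η θ) (u : T x)
include h

lemma ζ_ζ : g.sharp ζ (g.sharp ζ u) = 0 := by
  have := h.sd_ζ.anticomm h.sd_ζ u
  rw [h.ζζ, neg_zero, zero_smul, ← two_smul ℝ] at this
  simpa using this

lemma θ_θ : g.sharp θ (g.sharp θ u) = 0 := by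
  have := h.sd_θ.anticomm h.sd_θ u
  rw [h.θθ, neg_zero, zero_smul, ← two_smul ℝ] at this
  simpa using this

lemma η_η : g.sharp η (g.sharp η u) = u := by
  have := h.sd_η.anticomm h.sd_η u
  rw [h.ηη, neg_neg, ← two_smul ℝ] at this
  exact smul_right_injective _ (two_ne_zero (α := ℝ)) this

lemma ζ_θ : g.sharp ζ (g.sharp θ u) + g.sharp θ (g.sharp ζ u) = (-2 : ℝ) • u := by
  rw [h.sd_ζ.anticomm h.sd_θ u, h.ζθ]

lemma ζ_η : g.sharp ζ (g.sharp η u) = -g.sharp η (g.sharp ζ u) := by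
  have := h.sd_ζ.anticomm h.sd_η u
  rw [h.ζη, neg_zero, zero_smul] at this
  exact eq_neg_of_add_eq_zero_left this

lemma η_θ : g.sharp η (g.sharp θ u) = -g.sharp θ (g.sharp η u) := by
  have := h.sd_η.anticomm h.sd_θ u
  rw [h.ηθ, neg_zero, zero_smul] at this
  exact eq_neg_of_add_eq_zero_left this

/-- The kernel of `ζ` is the image of `ζ^♯`. -/
lemma eq_of_ζ_eq_zero (hu : ζ u = 0) :
    u = g.sharp ζ ((-1 / 2 : ℝ) • g.sharp θ u) := by
  have := h.ζ_θ u
  rw [g.sharp_eq_zero_iff.mpr hu, map_zero, add_zero] at this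
  rw [map_smul, this, smul_smul]
  norm_num

lemma eq_of_θ_eq_zero (hu : θ u = 0) :
    u = g.sharp θ ((-1 / 2 : ℝ) • g.sharp ζ u) := by
  have := h.ζ_θ u
  rw [g.sharp_eq_zero_iff.mpr hu, map_zero, zero_add] at this
  rw [map_smul, this, smul_smul]
  norm_num

lemma ζ_sharp_eq_zero : ζ (g.sharp ζ u) = 0 :=
  g.sharp_eq_zero_iff.mp (h.ζ_ζ u)

end relations

/-- The composition `η^♯ ζ^♯` is `ζ^♯` or `-ζ^♯`: it is a self-dual form orthogonal to `ζ` and `η`,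
hence a multiple of `ζ`, and `η^♯ η^♯ = 1`. -/
lemma exists_sign (h : g.IsFrame o ζ η θ) :
    ∃ k : ℝ, (k = 1 ∨ k = -1) ∧ ∀ u, g.sharp η (g.sharp ζ u) = k • g.sharp ζ u := by
  obtain ⟨b, hb⟩ := g.exists_isPosOrthonormal o x
  obtain ⟨h1, h2, h3⟩ := compForm_sdIn hb (h.sd_η.sdIn hb) (h.sd_ζ.sdIn hb)
    (by change g.ip η ζ = 0; rw [g.ip_comm, h.ζη])
  have hs := selfDualForm_of_sdIn hb h.sd_ζ h.sd_η h.sd_θ h.independent h1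
  obtain ⟨p, q, r, hpqr⟩ := h.exists_comb hs
  have h2' : g.ip (g.compForm η ζ) η = 0 := by rw [g.ip_comm]; exact h2
  have h3' : g.ip (g.compForm η ζ) ζ = 0 := by rw [g.ip_comm]; exact h3
  rw [hpqr, h.ip_comb_η] at h2'
  rw [hpqr, h.ip_comb_ζ] at h3'
  have hq : q = 0 := by linarith
  have hr : r = 0 := by linarith
  subst hq hr
  have key : ∀ u, g.sharp η (g.sharp ζ u) = p • g.sharp ζ u := by
    intro u
    refine g.eq_of_forall fun w ↦ ?_
    have := congrArg (fun χ : Bil x ↦ χ u w) hpqr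
    simpa using this
  refine ⟨p, ?_, key⟩
  have hp : ∀ u, (p * p) • g.sharp ζ u = g.sharp ζ u := by
    intro u
    conv_rhs => rw [← h.η_η (g.sharp ζ u), key, map_smul, key, smul_smul]
  by_contra hne
  have hp1 : p * p - 1 ≠ 0 := fun h0 ↦ hne (by
    have : (p - 1) * (p + 1) = 0 := by linarith
    rcases mul_eq_zero.mp this with h | h
    · left; linarith
    · right; linarith)
  have hz : ζ = 0 := by
    ext u v
    have h5 : (p * p - 1) • g.sharp ζ u = 0 := by rw [sub_smul, hp, one_smul, sub_self]
    rw [← val_sharp, (smul_eq_zero.mp h5).resolve_left hp1]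
    simp
  have := h.ζθ
  rw [hz, ip_zero_left] at this
  norm_num at this

/-- If `η = 1` on the image of `ζ^♯`, then `η = -1` on the image of `θ^♯`. -/
lemma sharp_η_θ (h : g.IsFrame o ζ η θ) (hk : ∀ u, g.sharp η (g.sharp ζ u) = g.sharp ζ u)
    (u : T x) : g.sharp η (g.sharp θ u) = -g.sharp θ u := by
  -- `η θ u + θ u` is annihilated by `ζ` and by `θ`, hence zero since `ζ θ + θ ζ = -2`.
  have h1 := h.ζ_θ (g.sharp η (g.sharp θ u) + g.sharp θ u)
  have h2 : g.sharp θ (g.sharp η (g.sharp θ u) + g.sharp θ u) = 0 := by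
    rw [h.η_θ, map_add, map_neg, h.θ_θ, h.θ_θ]
    simp
  have h3 : g.sharp ζ (g.sharp η (g.sharp θ u) + g.sharp θ u) = 0 := by
    rw [map_add, h.ζ_η, hk]
    simp
  rw [h2, h3, map_zero, map_zero, add_zero] at h1
  have h4 : g.sharp η (g.sharp θ u) + g.sharp θ u = 0 :=
    (smul_eq_zero.mp h1.symm).resolve_left (by norm_num)
  exact eq_neg_of_add_eq_zero_left h4

/-- The distribution `Ker ζ` is null. -/
lemma null (h : g.IsFrame o ζ η θ) {u v : T x} (hu : ζ u = 0) (hv : ζ v = 0) :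
    g.val x u v = 0 := by
  rw [h.eq_of_ζ_eq_zero u hu, val_sharp, h.sd_ζ.1.swap, hv]
  simp

/-- The kernel and the image of `ζ^♯` coincide, so that their dimension is half that of the
tangent space. -/
lemma finrank_ker (h : g.IsFrame o ζ η θ) :
    Module.finrank ℝ (LinearMap.ker ζ.toLinearMap) = 2 := by
  have h1 : LinearMap.ker ζ.toLinearMap = LinearMap.ker (g.sharp ζ) := by
    ext v
    exact g.sharp_eq_zero_iff.symm
  have h2 : LinearMap.ker (g.sharp ζ) = LinearMap.range (g.sharp ζ) := by
    ext v
    constructor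
    · intro hv
      exact ⟨_, (h.eq_of_ζ_eq_zero v (g.sharp_eq_zero_iff.mp hv)).symm⟩
    · rintro ⟨u, rfl⟩
      exact h.ζ_ζ u
  have h3 := (g.sharp ζ).finrank_range_add_finrank_ker
  rw [finrank_tangent, ← h2] at h3
  rw [h1]
  omega

/-- The null plane `Ker ζ` is compatible with the orientation. -/
lemma selfDual_bivector (h : g.IsFrame o ζ η θ) {u v : T x} (hu : ζ u = 0) (hv : ζ v = 0) :
    g.SelfDualForm o (g.bivector u v) := by
  obtain ⟨p, q, r, κ, he, hκ, hk⟩ := h.decompose (g.isTwoForm_bivector u v)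
  have hz : κ = 0 := by
    refine h.eq_zero_of_orthogonal hκ hk fun κ' hκ' hk' ↦ ?_
    -- `κ'` commutes with `ζ`, so it preserves the null plane `Ker ζ`.
    have h1 : g.ip κ' (g.bivector u v) = 0 := by
      rw [g.ip_comm, g.ip_bivector hκ', ← g.val_sharp]
      refine h.null ?_ hv
      rw [← g.sharp_eq_zero_iff, h.comm h.sd_ζ hκ' hk', g.sharp_eq_zero_iff.mpr hu, map_zero]
    rw [he, ip_add_right, g.ip_comm, hk' _ (h.comb p q r), zero_add] at h1
    exact h1
  rw [he, hz]
  have : p • ζ + q • η + r • θ + 0 = p • ζ + q • η + r • θ := by module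
  rw [this]
  exact h.comb p q r

end IsFrame

end NeutralMetric

end

/-! ### The canonical frame at a point -/

section

variable {M : Type*} [TopologicalSpace M] [ChartedSpace E4 M]

namespace NeutralMetric

variable [IsManifold 𝓘(ℝ, E4) ∞ M] {g : NeutralMetric M}
  {o : Π x : M, Orientation ℝ (T x) (Fin 4)} {x : M}

lemma weylOp_add (φ ψ : Bil x) (u v : T x) :
    g.weylOp x (φ + ψ) u v = g.weylOp x φ u v + g.weylOp x ψ u v :=
  g.pairing_add_right _ (fun u v ↦ φ u v) (fun u v ↦ ψ u v)

lemma weylOp_smul (r : ℝ) (φ : Bil x) (u v : T x) :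
    g.weylOp x (r • φ) u v = r * g.weylOp x φ u v :=
  g.pairing_smul_right r _ (fun u v ↦ φ u v)

/-- The inner product of `Λ⁺` has the signature `(+, -, -)`: it is semidefinite on the orthogonal
complement of a null vector. -/
lemma ip_self_nonpos {a b : Bil x} (ha : g.SelfDualForm o a) (hb : g.SelfDualForm o b)
    (ha0 : a ≠ 0) (haa : g.ip a a = 0) (hab : g.ip a b = 0) : g.ip b b ≤ 0 := by
  obtain ⟨e, he⟩ := g.exists_isPosOrthonormal o x
  have sa := ha.sdIn he
  have sb := hb.sdIn he
  unfold ip at haa hab ⊢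
  rw [SDIn.pairing_eq he sa sa] at haa
  rw [SDIn.pairing_eq he sa sb] at hab
  rw [SDIn.pairing_eq he sb sb]
  set p := a (e 0) (e 1)
  set q := a (e 0) (e 2)
  set r := a (e 0) (e 3)
  set p' := b (e 0) (e 1)
  set q' := b (e 0) (e 2)
  set r' := b (e 0) (e 3)
  have hp : p ≠ 0 := by
    intro hp
    have hq : q = 0 := by nlinarith [sq_nonneg q, sq_nonneg r]
    have hr : r = 0 := by nlinarith [sq_nonneg q, sq_nonneg r]
    exact ha0 (sa.eq_zero hp hq hr)
  have hp2 : 0 < p ^ 2 := by positivity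
  -- The Cauchy-Schwarz inequality for `(q, r)` and `(q', r')`.
  have h1 : p * p' = q * q' + r * r' := by linarith
  have h2 : p ^ 2 = q ^ 2 + r ^ 2 := by linarith
  have h3 : (q * q' + r * r') ^ 2 ≤ (q ^ 2 + r ^ 2) * (q' ^ 2 + r' ^ 2) := by
    nlinarith [sq_nonneg (q * r' - r * q')]
  rw [← h1, ← h2, mul_pow] at h3
  have h4 := le_of_mul_le_mul_left h3 hp2
  nlinarith

/-- At each point, an operator of Petrov type III has a canonical frame. -/
lemma IsPetrovIII.exists_frame (hIII : g.IsPetrovIII o) (x : M) :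
    ∃ ζ η θ : Bil x, g.IsFrame o ζ η θ ∧ (∀ u v, g.weylOp x ζ u v = 0) ∧
      (∀ u v, g.weylOp x η u v = -ζ u v) ∧ (∀ u v, g.weylOp x θ u v = η u v) ∧
      ∀ u, g.sharp η (g.sharp ζ u) = g.sharp ζ u := by
  obtain ⟨hsa, a, b, c, ha, hb, hc, hLI, -, hWa, hWb, hWc⟩ := hIII x
  have hind := Independent.of_linearIndependent hLI
  have e1 : g.weylOp x a = fun u v ↦ (0 : Bil x) u v := funext fun u ↦ funext fun v ↦ by
    simp [hWa]
  have e2 : g.weylOp x b = fun u v ↦ a u v := funext fun u ↦ funext fun v ↦ hWb u v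
  have e3 : g.weylOp x c = fun u v ↦ b u v := funext fun u ↦ funext fun v ↦ hWc u v
  have haa : g.ip a a = 0 := by
    have := hsa b a hb ha
    rw [e1, e2] at this
    rw [ip, this]
    exact (g.ip_comm b 0).trans (g.ip_zero_left b)
  have hab : g.ip a b = 0 := by
    have := hsa a c ha hc
    rw [e1, e3] at this
    exact this.symm.trans (g.ip_zero_left c)
  have hac : g.ip a c = g.ip b b := by
    have := hsa b c hb hc
    rwa [e2, e3] at this
  have ha0 : a ≠ 0 := by
    rintro rfl
    have := (hind 1 0 0 (by module)).1
    norm_num at this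
  have hm0 : g.ip b b ≠ 0 := by
    -- Otherwise `a` would be orthogonal to `Λ⁺`.
    intro h0
    apply ha0
    obtain ⟨e, he⟩ := g.exists_isPosOrthonormal o x
    have key : ∀ φ : Bil x, g.SelfDualForm o φ → g.ip φ a = 0 := by
      intro φ hφ
      obtain ⟨p, q, r, rfl⟩ :=
        SDIn.exists_eq_comb (ha.sdIn he) (hb.sdIn he) (hc.sdIn he) hind (hφ.sdIn he)
      simp only [ip_add_left, ip_smul_left, haa, g.ip_comm b a, hab, g.ip_comm c a, hac, h0]
      ring
    have hA := asdIn_of_orthogonal he ha hb hc hind ha.1 key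
    have hS := ha.sdIn he
    exact hS.eq_zero (by linarith [hA.c01, hS.c01]) (by linarith [hA.c02, hS.c02])
      (by linarith [hA.c03, hS.c03])
  have hm : g.ip b b < 0 := lt_of_le_of_ne (ip_self_nonpos ha hb ha0 haa hab) hm0
  set m := g.ip b b with hmdef
  set n := g.ip b c with hn
  set l := g.ip c c with hl
  -- Solve `⟨W²θ, θ⟩ = -2`, `⟨Wθ, θ⟩ = 0`, `⟨θ, θ⟩ = 0` for `θ = ρc + σb + τa`.
  obtain ⟨ρ, hρ⟩ : ∃ ρ : ℝ, ρ ^ 2 * m = -2 := by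
    refine ⟨Real.sqrt (-2 / m), ?_⟩
    rw [Real.sq_sqrt (div_nonneg_of_nonpos (by norm_num) hm.le)]
    field_simp
  have hρ0 : ρ ≠ 0 := by
    rintro rfl
    norm_num at hρ
  obtain ⟨σ, hσ⟩ : ∃ σ : ℝ, ρ * n + 2 * σ * m = 0 := ⟨-(ρ * n) / (2 * m), by field_simp; ring⟩
  obtain ⟨τ, hτ⟩ : ∃ τ : ℝ, ρ ^ 2 * l + σ ^ 2 * m + 2 * ρ * σ * n + 2 * ρ * τ * m = 0 :=
    ⟨-(ρ ^ 2 * l + σ ^ 2 * m + 2 * ρ * σ * n) / (2 * ρ * m), by field_simp; ring⟩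
  have hF : g.IsFrame o ((-ρ) • a) (ρ • b + σ • a) (ρ • c + σ • b + τ • a) := by
    refine ⟨ha.smul _, (hb.smul _).add (ha.smul _),
      ((hc.smul _).add (hb.smul _)).add (ha.smul _), ?_, ?_, ?_, ?_, ?_, ?_⟩ <;>
    simp only [ip_add_left, ip_smul_left, ip_add_right, ip_smul_right, haa, g.ip_comm b a, hab,
      g.ip_comm c a, hac, g.ip_comm c b, ← hmdef, ← hn, ← hl]
    · linarith
    · linarith
    · ring
    · ring
    · linear_combination ρ * hσ
    · linear_combination hτ
  have w1 : ∀ u v, g.weylOp x ((-ρ) • a) u v = 0 := fun u v ↦ by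
    rw [weylOp_smul, hWa, mul_zero]
  have w2 : ∀ u v, g.weylOp x (ρ • b + σ • a) u v = -((-ρ) • a) u v := fun u v ↦ by
    rw [weylOp_add, weylOp_smul, weylOp_smul, hWa, hWb]
    simp
  have w3 : ∀ u v, g.weylOp x (ρ • c + σ • b + τ • a) u v = (ρ • b + σ • a) u v := fun u v ↦ by
    rw [weylOp_add, weylOp_add, weylOp_smul, weylOp_smul, weylOp_smul, hWa, hWb, hWc]
    simp
  generalize (-ρ) • a = ζ at *
  generalize ρ • b + σ • a = η at *
  generalize ρ • c + σ • b + τ • a = θ at *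
  have sharp_neg : ∀ (φ : Bil x) (u : T x), g.sharp ((-1 : ℝ) • φ) u = -g.sharp φ u := by
    intro φ u
    refine g.eq_of_forall fun w ↦ ?_
    simp
  -- The sign is chosen so that `η = 1` on `Ker ζ`.
  obtain ⟨k, rfl | rfl, hk⟩ := hF.exists_sign
  · exact ⟨ζ, η, θ, hF, w1, w2, w3, fun u ↦ by rw [hk, one_smul]⟩
  · refine ⟨_, _, _, hF.neg, fun u v ↦ ?_, fun u v ↦ ?_, fun u v ↦ ?_, fun u ↦ ?_⟩
    · rw [weylOp_smul, w1, mul_zero]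
    · rw [weylOp_smul, w2]
      simp
    · rw [weylOp_smul, w3]
      simp
    · rw [sharp_neg, sharp_neg, map_neg, hk]
      module

end NeutralMetric

end

/-! ### Smooth functions and directional derivatives -/

section

variable {M : Type*} [TopologicalSpace M] [ChartedSpace E4 M]

/-- `f` is a function which is `C^∞` near `x`. (For `ContMDiffAt` with the exponent `∞`, smoothness
at `x` does not pass to nearby points, but iterated derivatives require it there.) -/
def SmoothFunAt (f : M → ℝ) (x : M) : Prop :=
  ∀ᶠ y in 𝓝 x, ContMDiffAt 𝓘(ℝ, E4) 𝓘(ℝ, ℝ) ∞ f y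

namespace SmoothFunAt

variable {f f' : M → ℝ} {x : M}

lemma eventually_mdifferentiableAt (h : SmoothFunAt f x) :
    ∀ᶠ y in 𝓝 x, MDifferentiableAt 𝓘(ℝ, E4) 𝓘(ℝ, ℝ) f y :=
  h.mono fun _ hy ↦ hy.mdifferentiableAt (by simp)

lemma mdifferentiableAt (h : SmoothFunAt f x) : MDifferentiableAt 𝓘(ℝ, E4) 𝓘(ℝ, ℝ) f x :=
  h.eventually_mdifferentiableAt.self_of_nhds

lemma eventually (h : SmoothFunAt f x) : ∀ᶠ y in 𝓝 x, SmoothFunAt f y :=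
  eventually_eventually_nhds.mpr h

lemma const (r : ℝ) : SmoothFunAt (fun _ : M ↦ r) x :=
  Filter.Eventually.of_forall fun _ ↦ contMDiffAt_const

lemma add (hf : SmoothFunAt f x) (hf' : SmoothFunAt f' x) :
    SmoothFunAt (fun y ↦ f y + f' y) x := by
  filter_upwards [hf, hf'] with y h h' using ContMDiffAt.add h h'

lemma sub (hf : SmoothFunAt f x) (hf' : SmoothFunAt f' x) :
    SmoothFunAt (fun y ↦ f y - f' y) x := by
  filter_upwards [hf, hf'] with y h h' using ContMDiffAt.sub h h'

lemma mul (hf : SmoothFunAt f x) (hf' : SmoothFunAt f' x) :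
    SmoothFunAt (fun y ↦ f y * f' y) x := by
  filter_upwards [hf, hf'] with y h h' using ContMDiffAt.mul h h'

lemma eventually_ne_zero (hf : SmoothFunAt f x) (h : f x ≠ 0) : ∀ᶠ y in 𝓝 x, f y ≠ 0 :=
  (ContMDiffAt.continuousAt hf.self_of_nhds).eventually_ne h

lemma div (hf : SmoothFunAt f x) (hf' : SmoothFunAt f' x) (h : f' x ≠ 0) :
    SmoothFunAt (fun y ↦ f y / f' y) x := by
  filter_upwards [hf, hf', hf'.eventually_ne_zero h] with y h h' h0 using ContMDiffAt.div₀ h h' h0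

lemma sum {ι : Type*} {s : Finset ι} {f : ι → M → ℝ} (hf : ∀ i ∈ s, SmoothFunAt (f i) x) :
    SmoothFunAt (fun y ↦ ∑ i ∈ s, f i y) x := by
  filter_upwards [(Filter.eventually_all_finset s).mpr hf] with y h using ContMDiffAt.sum h

lemma prod {ι : Type*} {s : Finset ι} {f : ι → M → ℝ} (hf : ∀ i ∈ s, SmoothFunAt (f i) x) :
    SmoothFunAt (fun y ↦ ∏ i ∈ s, f i y) x := by
  filter_upwards [(Filter.eventually_all_finset s).mpr hf] with y h using ContMDiffAt.prod h

lemma congr (hf : SmoothFunAt f x) (h : ∀ᶠ y in 𝓝 x, f' y = f y) : SmoothFunAt f' x := by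
  filter_upwards [hf, eventually_eventually_nhds.mpr h] with y h1 h2
    using ContMDiffAt.congr_of_eventuallyEq h1 h2

end SmoothFunAt

section dirDeriv

variable {x : M} {f f' : M → ℝ}

lemma dirDeriv_add (hf : SmoothFunAt f x) (hf' : SmoothFunAt f' x) (v : T x) :
    dirDeriv (fun y ↦ f y + f' y) x v = dirDeriv f x v + dirDeriv f' x v := by
  unfold dirDeriv
  rw [mvfderiv_fun_add hf.mdifferentiableAt hf'.mdifferentiableAt]
  rfl

lemma dirDeriv_mul (hf : SmoothFunAt f x) (hf' : SmoothFunAt f' x) (v : T x) :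
    dirDeriv (fun y ↦ f y * f' y) x v = f x * dirDeriv f' x v + f' x * dirDeriv f x v := by
  unfold dirDeriv
  rw [mvfderiv_fun_mul hf.mdifferentiableAt hf'.mdifferentiableAt]
  rfl

lemma dirDeriv_congr (h : ∀ᶠ y in 𝓝 x, f y = f' y) (v : T x) :
    dirDeriv f x v = dirDeriv f' x v := by
  unfold dirDeriv mvfderiv
  have h1 : f =ᶠ[𝓝 x] f' := h
  have h2 := h1.mfderiv_eq (I := 𝓘(ℝ, E4)) (I' := 𝓘(ℝ, ℝ))
  have h3 : f x = f' x := h.self_of_nhds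
  simp only [ContinuousLinearMap.comp_apply]
  rw [h2]
  rfl

lemma dirDeriv_const (r : ℝ) (v : T x) : dirDeriv (fun _ : M ↦ r) x v = 0 := by
  unfold dirDeriv
  rw [mvfderiv_const]
  rfl

lemma isLinearMap_dirDeriv : IsLinearMap ℝ (fun v : T x ↦ dirDeriv f x v) :=
  ⟨fun u v ↦ map_add _ u v, fun r u ↦ map_smul _ r u⟩

variable {X Y : Π x : M, T x}

lemma bracket_swap : bracket X Y x = -bracket Y X x := VectorField.mlieBracket_swap_apply

lemma bracket_congr {X' Y' : Π x : M, T x} (hX : ∀ᶠ y in 𝓝 x, X y = X' y)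
    (hY : ∀ᶠ y in 𝓝 x, Y y = Y' y) : bracket X Y x = bracket X' Y' x :=
  Filter.EventuallyEq.mlieBracket_vectorField_eq hX hY

end dirDeriv

variable [IsManifold 𝓘(ℝ, E4) ∞ M]

lemma two_le_infty : (2 : WithTop ℕ∞) ≤ ∞ := WithTop.coe_le_coe.2 (le_top : (2 : ℕ∞) ≤ ⊤)

lemma three_le_infty : (3 : WithTop ℕ∞) ≤ ∞ := WithTop.coe_le_coe.2 (le_top : (3 : ℕ∞) ≤ ⊤)

/-! ### Smooth vector fields near a point -/

/-- `X` is a vector field which is `C^∞` near `x`, and not only at `x`. -/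
def SmoothFieldAt (X : Π x : M, T x) (x : M) : Prop :=
  ∀ᶠ y in 𝓝 x, ContMDiffAt 𝓘(ℝ, E4) (𝓘(ℝ, E4)).tangent ∞
    (fun x ↦ (⟨x, X x⟩ : TangentBundle 𝓘(ℝ, E4) M)) y

lemma SmoothFieldOn.smoothFieldAt {X : Π x : M, T x} {U : Set M} (h : SmoothFieldOn X U)
    (hU : IsOpen U) {x : M} (hx : x ∈ U) : SmoothFieldAt X x := by
  filter_upwards [hU.mem_nhds hx] with y hy using (h y hy).contMDiffAt (hU.mem_nhds hy)

lemma smoothFieldAt_ext {x : M} (v : T x) : SmoothFieldAt (ext v) x := by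
  obtain ⟨s, hs, h⟩ := FiberBundle.exists_contMDiffOn_extend (k := ∞) 𝓘(ℝ, E4) E4 v
  filter_upwards [eventually_mem_nhds_iff.mpr hs] with y hy
  exact (h y (mem_of_mem_nhds hy)).contMDiffAt hy

@[simp] lemma ext_self {x : M} (v : T x) : ext v x = v :=
  FiberBundle.extend_apply_self _ v

namespace SmoothFieldAt

variable {X Y : Π x : M, T x} {x : M}

lemma eventually_mdifferentiableAt (hX : SmoothFieldAt X x) :
    ∀ᶠ y in 𝓝 x, MDifferentiableAt 𝓘(ℝ, E4) (𝓘(ℝ, E4)).tangent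
      (fun x ↦ (⟨x, X x⟩ : TangentBundle 𝓘(ℝ, E4) M)) y :=
  hX.mono fun _ hy ↦ hy.mdifferentiableAt (by simp)

lemma mdifferentiableAt (h : SmoothFieldAt X x) :
    MDifferentiableAt 𝓘(ℝ, E4) (𝓘(ℝ, E4)).tangent
      (fun x ↦ (⟨x, X x⟩ : TangentBundle 𝓘(ℝ, E4) M)) x :=
  h.eventually_mdifferentiableAt.self_of_nhds

lemma eventually (h : SmoothFieldAt X x) : ∀ᶠ y in 𝓝 x, SmoothFieldAt X y :=
  eventually_eventually_nhds.mpr h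

lemma add (hX : SmoothFieldAt X x) (hY : SmoothFieldAt Y x) : SmoothFieldAt (X + Y) x := by
  filter_upwards [hX, hY] with y h h' using ContMDiffAt.add_section h h'

lemma smul {f : M → ℝ} (hf : SmoothFunAt f x) (hX : SmoothFieldAt X x) :
    SmoothFieldAt (f • X) x := by
  filter_upwards [hf, hX] with y h h' using ContMDiffAt.smul_section h h'

lemma const_smul (r : ℝ) (hX : SmoothFieldAt X x) : SmoothFieldAt (r • X) x := by
  filter_upwards [hX] with y h using ContMDiffAt.const_smul_section h

lemma sum {ι : Type*} {s : Finset ι} {X : ι → Π x : M, T x}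
    (hX : ∀ i ∈ s, SmoothFieldAt (X i) x) : SmoothFieldAt (fun y ↦ ∑ i ∈ s, X i y) x := by
  filter_upwards [(Filter.eventually_all_finset s).mpr hX] with y h using ContMDiffAt.sum_section h

lemma congr (hX : SmoothFieldAt X x) (h : ∀ᶠ y in 𝓝 x, Y y = X y) : SmoothFieldAt Y x := by
  filter_upwards [hX, eventually_eventually_nhds.mpr h] with y h1 h2
  refine ContMDiffAt.congr_of_eventuallyEq h1 ?_
  filter_upwards [h2] with z hz
  rw [hz]

lemma bracket (hX : SmoothFieldAt X x) (hY : SmoothFieldAt Y x) :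
    SmoothFieldAt (bracket X Y) x := by
  have : IsManifold 𝓘(ℝ, E4) (((⊤ : ℕ∞) : WithTop ℕ∞) + 1) M := by
    simpa using (inferInstance : IsManifold 𝓘(ℝ, E4) ∞ M)
  have : IsManifold 𝓘(ℝ, E4) (minSmoothness ℝ 2) M := IsManifold.of_le (n := ∞) (by
    rw [minSmoothness_of_isRCLikeNormedField]; exact two_le_infty)
  have : IsManifold 𝓘(ℝ, E4) (minSmoothness ℝ 3) M := IsManifold.of_le (n := ∞) (by
    rw [minSmoothness_of_isRCLikeNormedField]; exact three_le_infty)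
  filter_upwards [hX, hY] with y h h'
  exact ContMDiffAt.mlieBracket_vectorField (m := ⊤) (n := ⊤) h h' (by simp)

end SmoothFieldAt

/-- The domain of the preferred chart at `x₀`. -/
def chartDomain (x₀ : M) : Set M :=
  (trivializationAt E4 (TangentSpace 𝓘(ℝ, E4) : M → Type _) x₀).baseSet

lemma isOpen_chartDomain (x₀ : M) : IsOpen (chartDomain x₀) :=
  (trivializationAt E4 (TangentSpace 𝓘(ℝ, E4) : M → Type _) x₀).open_baseSet

lemma mem_chartDomain (x₀ : M) : x₀ ∈ chartDomain x₀ :=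
  FiberBundle.mem_baseSet_trivializationAt' x₀

lemma eventually_chartDomain (x₀ : M) : ∀ᶠ y in 𝓝 x₀, y ∈ chartDomain x₀ :=
  (isOpen_chartDomain x₀).mem_nhds (mem_chartDomain x₀)

/-- The coordinate frame of the preferred chart at `x₀`. -/
def frame (x₀ : M) (i : Fin 4) : Π y : M, T y :=
  (trivializationAt E4 (TangentSpace 𝓘(ℝ, E4) : M → Type _) x₀).localFrame
    (EuclideanSpace.basisFun (Fin 4) ℝ).toBasis i

lemma isLocalFrameOn_frame (x₀ : M) :
    IsLocalFrameOn 𝓘(ℝ, E4) E4 ∞ (frame x₀) (chartDomain x₀) :=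
  Bundle.Trivialization.isLocalFrameOn_localFrame_baseSet _ _ _ _

/-- The coordinate frame as a basis of the tangent space. -/
def frameBasis {x₀ y : M} (hy : y ∈ chartDomain x₀) : Module.Basis (Fin 4) ℝ (T y) :=
  (isLocalFrameOn_frame x₀).toBasisAt hy

@[simp] lemma frameBasis_apply {x₀ y : M} (hy : y ∈ chartDomain x₀) (i : Fin 4) :
    frameBasis hy i = frame x₀ i y :=
  (isLocalFrameOn_frame x₀).toBasisAt_coe hy i

lemma smoothFieldAt_frame {x₀ y : M} (hy : y ∈ chartDomain x₀) (i : Fin 4) :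
    SmoothFieldAt (frame x₀ i) y := by
  filter_upwards [(isOpen_chartDomain x₀).mem_nhds hy] with z hz
    using (isLocalFrameOn_frame x₀).contMDiffAt (isOpen_chartDomain x₀) hz i

/-- A vector field is, near `x₀`, a combination of the coordinate frame with smooth coefficients. -/
lemma SmoothFieldAt.exists_coeff {X : Π x : M, T x} {x₀ : M} (hX : SmoothFieldAt X x₀) :
    ∃ c : Fin 4 → M → ℝ, (∀ i, SmoothFunAt (c i) x₀) ∧
      (∀ y (hy : y ∈ chartDomain x₀) i, c i y = (frameBasis hy).repr (X y) i) ∧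
      ∀ y ∈ chartDomain x₀, X y = ∑ i, c i y • frame x₀ i y := by
  let t := trivializationAt E4 (TangentSpace 𝓘(ℝ, E4) : M → Type _) x₀
  let b := (EuclideanSpace.basisFun (Fin 4) ℝ).toBasis
  have h : ∀ y (hy : y ∈ chartDomain x₀) i,
      t.localFrameCoeff 𝓘(ℝ, E4) b i y (X y) = (frameBasis hy).repr (X y) i := by
    intro y hy i
    rw [t.localFrameCoeff_apply_of_mem_baseSet b hy X i]
    have hB : t.basisAt b hy = frameBasis hy := by
      apply Module.Basis.eq_of_apply_eq
      intro j
      rw [frameBasis_apply, frame, t.localFrame_apply_of_mem_baseSet b hy]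
    rw [hB]
  refine ⟨fun i y ↦ t.localFrameCoeff 𝓘(ℝ, E4) b i y (X y), fun i ↦ ?_, h, fun y hy ↦ ?_⟩
  · filter_upwards [hX, eventually_chartDomain x₀] with y hy hd
    exact contMDiffAt_localFrameCoeff b hd hy i
  · conv_lhs => rw [← (frameBasis hy).sum_repr (X y)]
    exact Finset.sum_congr rfl fun i _ ↦ by
      rw [frameBasis_apply]
      exact congrArg (· • _) (h y hy i).symm

/-! ### Tensorial operations on vector fields -/

/-- An operation on vector fields, with values at `x`, that is additive and linear over the
functions smooth near `x`; only its values on the fields smooth near `x` matter. -/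
structure Tensorial {A : Type*} [AddCommGroup A] [Module ℝ A] (Φ : (Π x : M, T x) → A)
    (x : M) : Prop where
  smul : ∀ {f : M → ℝ} {X : Π x : M, T x}, SmoothFunAt f x → SmoothFieldAt X x →
    Φ (f • X) = f x • Φ X
  add : ∀ {X Y : Π x : M, T x}, SmoothFieldAt X x → SmoothFieldAt Y x → Φ (X + Y) = Φ X + Φ Y

namespace Tensorial

variable {A : Type*} [AddCommGroup A] [Module ℝ A] {Φ : (Π x : M, T x) → A} {x : M}

lemma local_congr (h : Tensorial Φ x) {X Y : Π x : M, T x} (hX : SmoothFieldAt X x)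
    (hY : SmoothFieldAt Y x) (hXY : ∀ᶠ y in 𝓝 x, X y = Y y) : Φ X = Φ Y := by
  classical
  -- Cut both fields off by the indicator function of the set where they agree.
  let ψ (y : M) : ℝ := if X y = Y y then 1 else 0
  have hψx : ψ x = 1 := by simp [ψ, hXY.self_of_nhds]
  have hψ : SmoothFunAt ψ x :=
    (SmoothFunAt.const 1).congr (hXY.mono fun y hy ↦ by simp [ψ, hy])
  have he : ψ • X = ψ • Y := by
    funext y
    simp only [Pi.smul_apply', ψ]
    split_ifs with hy <;> simp [hy]
  calc Φ X = Φ (ψ • X) := by rw [h.smul hψ hX, hψx, one_smul]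
    _ = Φ (ψ • Y) := by rw [he]
    _ = Φ Y := by rw [h.smul hψ hY, hψx, one_smul]

lemma sum (h : Tensorial Φ x) {ι : Type*} (s : Finset ι) (hs : s.Nonempty)
    {X : ι → Π x : M, T x} (hX : ∀ i ∈ s, SmoothFieldAt (X i) x) :
    Φ (fun y ↦ ∑ i ∈ s, X i y) = ∑ i ∈ s, Φ (X i) := by
  classical
  induction hs using Finset.Nonempty.cons_induction with
  | singleton a => simp
  | cons a s ha hs ih =>
    simp only [Finset.mem_cons, forall_eq_or_imp] at hX
    simp only [Finset.sum_cons, ← ih hX.2]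
    exact h.add hX.1 (SmoothFieldAt.sum hX.2)

/-- A tensorial operation depends only on the value of the field at the point. -/
theorem congr (h : Tensorial Φ x) {X Y : Π x : M, T x} (hX : SmoothFieldAt X x)
    (hY : SmoothFieldAt Y x) (hXY : X x = Y x) : Φ X = Φ Y := by
  have key : ∀ {X : Π x : M, T x} (hX : SmoothFieldAt X x),
      Φ X = ∑ i, (frameBasis (mem_chartDomain x)).repr (X x) i • Φ (frame x i) := by
    intro X hX
    obtain ⟨c, hc, hr, hs⟩ := hX.exists_coeff
    have h1 : ∀ i ∈ Finset.univ, SmoothFieldAt (c i • frame x i) x := fun i _ ↦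
      (smoothFieldAt_frame (mem_chartDomain x) i).smul (hc i)
    rw [h.local_congr hX (SmoothFieldAt.sum h1)
      ((eventually_chartDomain x).mono fun y hy ↦ hs y hy),
      h.sum _ Finset.univ_nonempty h1]
    refine Finset.sum_congr rfl fun i _ ↦ ?_
    rw [h.smul (hc i) (smoothFieldAt_frame (mem_chartDomain x) i), hr x (mem_chartDomain x)]
  rw [key hX, key hY, hXY]

lemma isLinearMap (h : Tensorial Φ x) : IsLinearMap ℝ fun v : T x ↦ Φ (ext v) where
  map_add u v := by
    rw [← h.add (smoothFieldAt_ext u) (smoothFieldAt_ext v)]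
    exact h.congr (smoothFieldAt_ext _) ((smoothFieldAt_ext u).add (smoothFieldAt_ext v))
      (by simp)
  map_smul r u := by
    have := h.smul (SmoothFunAt.const r) (smoothFieldAt_ext u)
    rw [← this]
    exact h.congr (smoothFieldAt_ext _) ((smoothFieldAt_ext u).smul (SmoothFunAt.const r))
      (by simp)

end Tensorial

/-! ### Directional derivatives and brackets -/

section dirDeriv

variable {x : M} {f f' : M → ℝ}

variable {X Y : Π x : M, T x}

lemma bracket_smul_right (hf : SmoothFunAt f x) (hY : SmoothFieldAt Y x) :
    bracket X (f • Y) x = dirDeriv f x (X x) • Y x + f x • bracket X Y x :=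
  VectorField.mlieBracket_smul_right hf.mdifferentiableAt hY.mdifferentiableAt

lemma bracket_smul_left (hf : SmoothFunAt f x) (hX : SmoothFieldAt X x) :
    bracket (f • X) Y x = -dirDeriv f x (Y x) • X x + f x • bracket X Y x :=
  VectorField.mlieBracket_smul_left hf.mdifferentiableAt hX.mdifferentiableAt

lemma bracket_add_left {X' : Π x : M, T x} (hX : SmoothFieldAt X x) (hX' : SmoothFieldAt X' x) :
    bracket (X + X') Y x = bracket X Y x + bracket X' Y x :=
  VectorField.mlieBracket_add_left hX.mdifferentiableAt hX'.mdifferentiableAt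

lemma bracket_add_right {Y' : Π x : M, T x} (hY : SmoothFieldAt Y x)
    (hY' : SmoothFieldAt Y' x) :
    bracket X (Y + Y') x = bracket X Y x + bracket X Y' x :=
  VectorField.mlieBracket_add_right hY.mdifferentiableAt hY'.mdifferentiableAt

/-- Directional derivatives of smooth functions are smooth, since brackets of smooth fields are. -/
lemma SmoothFunAt.dirDeriv (hf : SmoothFunAt f x) (hX : SmoothFieldAt X x) :
    SmoothFunAt (fun y ↦ dirDeriv f y (X y)) x := by
  -- `(d_X f) W = [X, f W] - f [X, W]` for a vector field `W` of the coordinate frame.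
  set W := frame x 0
  have hW : SmoothFieldAt W x := smoothFieldAt_frame (mem_chartDomain x) 0
  have hZ : SmoothFieldAt (fun y ↦ NeutralFour.dirDeriv f y (X y) • W y) x := by
    have h1 : SmoothFieldAt
        (NeutralFour.bracket X (f • W) + (-1 : ℝ) • (f • NeutralFour.bracket X W)) x :=
      (hX.bracket (hW.smul hf)).add (((hX.bracket hW).smul hf).const_smul _)
    refine h1.congr ?_
    filter_upwards [hf.eventually_mdifferentiableAt, hW.eventually_mdifferentiableAt] with y h2 h3
    have h4 : NeutralFour.bracket X (f • W) y =
        NeutralFour.dirDeriv f y (X y) • W y + f y • NeutralFour.bracket X W y :=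
      VectorField.mlieBracket_smul_right h2 h3
    simp only [Pi.add_apply, Pi.smul_apply, Pi.smul_apply', h4]
    module
  obtain ⟨c, hc, hr, -⟩ := hZ.exists_coeff
  refine (hc 0).congr ?_
  filter_upwards [eventually_chartDomain x] with y hy
  rw [hr y hy, map_smul]
  have : W y = frameBasis hy 0 := (frameBasis_apply hy 0).symm
  rw [this, Module.Basis.repr_self]
  simp

/-- The bracket of vector fields is the commutator of derivations. -/
lemma dirDeriv_bracket (hX : SmoothFieldAt X x) (hY : SmoothFieldAt Y x) (hf : SmoothFunAt f x) :
    dirDeriv f x (bracket X Y x) = dirDeriv (fun y ↦ dirDeriv f y (Y y)) x (X x)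
      - dirDeriv (fun y ↦ dirDeriv f y (X y)) x (Y x) := by
  -- Compare the coefficients at `W` in the Jacobi identity for `X`, `Y` and `f W`.
  set W := frame x 0
  have hW : SmoothFieldAt W x := smoothFieldAt_frame (mem_chartDomain x) 0
  have le2 : minSmoothness ℝ 2 ≤ (∞ : WithTop ℕ∞) := by
    rw [minSmoothness_of_isRCLikeNormedField]
    exact two_le_infty
  have : IsManifold 𝓘(ℝ, E4) (minSmoothness ℝ 3) M := IsManifold.of_le (n := ∞) (by
    rw [minSmoothness_of_isRCLikeNormedField]
    exact three_le_infty)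
  have jac : ∀ {Z : Π x : M, T x}, SmoothFieldAt Z x → bracket X (bracket Y Z) x =
      bracket (bracket X Y) Z x + bracket Y (bracket X Z) x := fun hZ ↦
    VectorField.leibniz_identity_mlieBracket_apply (ContMDiffAt.of_le hX.self_of_nhds le2)
      (ContMDiffAt.of_le hY.self_of_nhds le2) (ContMDiffAt.of_le hZ.self_of_nhds le2)
  have ev : ∀ Z : Π x : M, T x, ∀ᶠ y in 𝓝 x, bracket Z (f • W) y =
      ((fun y ↦ dirDeriv f y (Z y)) • W + f • bracket Z W) y := by
    intro Z
    filter_upwards [hf.eventually_mdifferentiableAt, hW.eventually_mdifferentiableAt] with y h2 h3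
    exact VectorField.mlieBracket_smul_right h2 h3
  have two : ∀ {X Y : Π x : M, T x}, SmoothFieldAt X x → SmoothFieldAt Y x →
      bracket X (bracket Y (f • W)) x =
        dirDeriv (fun y ↦ dirDeriv f y (Y y)) x (X x) • W x
        + dirDeriv f x (Y x) • bracket X W x + dirDeriv f x (X x) • bracket Y W x
        + f x • bracket X (bracket Y W) x := by
    intro X Y hX hY
    rw [bracket_congr (Filter.Eventually.of_forall fun _ ↦ rfl) (ev Y),
      bracket_add_right (hW.smul (hf.dirDeriv hY)) ((hY.bracket hW).smul hf),
      bracket_smul_right (hf.dirDeriv hY) hW, bracket_smul_right hf (hY.bracket hW)]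
    module
  have h1 := jac (hW.smul hf)
  rw [two hX hY, two hY hX, bracket_smul_right hf hW, jac hW] at h1
  have h2 : (dirDeriv (fun y ↦ dirDeriv f y (Y y)) x (X x)
      - dirDeriv (fun y ↦ dirDeriv f y (X y)) x (Y x) - dirDeriv f x (bracket X Y x)) • W x
      = 0 := by
    linear_combination (norm := module) h1
  have h3 : W x ≠ 0 := by
    have : W x = frameBasis (mem_chartDomain x) 0 := (frameBasis_apply _ 0).symm
    rw [this]
    exact Module.Basis.ne_zero _ 0
  have h4 := (smul_eq_zero.mp h2).resolve_right h3
  linarith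

end dirDeriv

end

/-! ### Smooth twice-covariant tensor fields -/

section

variable {M : Type*} [TopologicalSpace M] [ChartedSpace E4 M]

lemma smooth_det {A : M → Matrix (Fin 4) (Fin 4) ℝ} {x : M}
    (hA : ∀ i j, SmoothFunAt (fun y ↦ A y i j) x) : SmoothFunAt (fun y ↦ (A y).det) x := by
  simp only [Matrix.det_apply]
  refine SmoothFunAt.sum fun σ _ ↦ ?_
  simp only [Units.smul_def, zsmul_eq_mul]
  exact (SmoothFunAt.const _).mul (SmoothFunAt.prod fun i _ ↦ hA _ _)

variable [IsManifold 𝓘(ℝ, E4) ∞ M]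

/-- `φ` is a twice-covariant tensor field which is `C^∞` near `x`, in the sense that its components
in the coordinate frame are. -/
def SmoothBilAt (φ : Π x : M, Bil x) (x : M) : Prop :=
  ∀ i j, SmoothFunAt (fun y ↦ φ y (frame x i y) (frame x j y)) x

lemma SmoothBil.smoothBilAt {φ : Π x : M, Bil x} (hφ : SmoothBil φ) (x : M) :
    SmoothBilAt φ x := by
  intro i j
  filter_upwards [smoothFieldAt_frame (mem_chartDomain x) i,
    smoothFieldAt_frame (mem_chartDomain x) j] with y hX hY
  have h : ContMDiffAt 𝓘(ℝ, E4) (𝓘(ℝ, E4).prod 𝓘(ℝ, ℝ)) ∞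
      (fun m : M ↦ Bundle.TotalSpace.mk' ℝ (E := Bundle.Trivial M ℝ) m
        (φ m (frame x i m) (frame x j m))) y := by
    apply ContMDiffAt.clm_bundle_apply₂ (F₁ := E4) (F₂ := E4)
    · exact hφ y
    · exact hX
    · exact hY
  exact (Bundle.contMDiffAt_totalSpace.mp h).2

lemma SmoothBilAt.apply {φ : Π x : M, Bil x} {X Y : Π x : M, T x} {x : M}
    (hφ : SmoothBilAt φ x) (hX : SmoothFieldAt X x) (hY : SmoothFieldAt Y x) :
    SmoothFunAt (fun y ↦ φ y (X y) (Y y)) x := by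
  obtain ⟨a, ha, -, hXa⟩ := hX.exists_coeff
  obtain ⟨b, hb, -, hYb⟩ := hY.exists_coeff
  have h : SmoothFunAt (fun y ↦ ∑ i, ∑ j, b i y * (a j y *
      φ y (frame x j y) (frame x i y))) x :=
    SmoothFunAt.sum fun i _ ↦ SmoothFunAt.sum fun j _ ↦ (hb i).mul ((ha j).mul (hφ j i))
  refine h.congr ?_
  filter_upwards [eventually_chartDomain x] with y hy
  rw [hXa y hy, hYb y hy]
  simp only [map_sum, map_smul, _root_.sum_apply, _root_.smul_apply, smul_eq_mul, Finset.mul_sum]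

lemma frame_eq_symm {x₀ y : M} (hy : y ∈ chartDomain x₀) (i : Fin 4) :
    frame x₀ i y = (trivializationAt E4 (TangentSpace 𝓘(ℝ, E4) : M → Type _) x₀).symm y
      (EuclideanSpace.basisFun (Fin 4) ℝ i) := by
  rw [frame, Bundle.Trivialization.localFrame_apply_of_mem_baseSet _ _ hy]
  simp [Bundle.Trivialization.basisAt]
  rfl

/-- Smoothness of the components is smoothness as a section of the bundle of bilinear forms. -/
lemma SmoothBilAt.contMDiffAt {φ : Π x : M, Bil x} {x₀ : M} (h : SmoothBilAt φ x₀) :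
    ContMDiffAt 𝓘(ℝ, E4) (𝓘(ℝ, E4).prod 𝓘(ℝ, E4 →L[ℝ] E4 →L[ℝ] ℝ)) ∞
    (fun x ↦ Bundle.TotalSpace.mk' (E4 →L[ℝ] E4 →L[ℝ] ℝ)
      (E := fun x : M ↦ (T x →L[ℝ] T x →L[ℝ] ℝ)) x (φ x)) x₀ := by
  let e := EuclideanSpace.basisFun (Fin 4) ℝ
  let p : Fin 4 → E4 →L[ℝ] ℝ := fun i ↦ EuclideanSpace.proj i
  -- A bilinear form on `ℝ⁴` is the sum of its components.
  have key : ∀ A : E4 →L[ℝ] E4 →L[ℝ] ℝ,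
      A = ∑ i, ∑ j, A (e i) (e j) • (p i).smulRight (p j) := by
    intro A
    have h1 : A.toLinearMap₁₂ =
        (∑ i, ∑ j, A (e i) (e j) • (p i).smulRight (p j) : E4 →L[ℝ] E4 →L[ℝ] ℝ).toLinearMap₁₂ := by
      refine e.toBasis.ext fun k ↦ e.toBasis.ext fun l ↦ ?_
      have h2 : ∀ i j, (e.toBasis j : E4) i = if i = j then 1 else 0 := fun i j ↦ by simp [e]
      have h3 : ∀ u v : E4, (∑ i, ∑ j, A (e i) (e j) • (p i).smulRight (p j) :
          E4 →L[ℝ] E4 →L[ℝ] ℝ) u v = ∑ i, ∑ j, A (e i) (e j) * (u i * v j) := fun u v ↦ by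
        simp only [_root_.sum_apply, _root_.smul_apply, ContinuousLinearMap.smulRight_apply,
          smul_eq_mul]
        rfl
      refine Eq.trans ?_ (h3 _ _).symm
      simp only [h2]
      simp
    ext u v
    exact congrArg (fun f ↦ f u v) h1
  have h2 : ContMDiffAt 𝓘(ℝ, E4) 𝓘(ℝ, E4 →L[ℝ] E4 →L[ℝ] ℝ) ∞
      (fun y : M ↦ ∑ i, ∑ j, φ y (frame x₀ i y) (frame x₀ j y) • (p i).smulRight (p j)) x₀ := by
    refine ContMDiffAt.sum fun i _ ↦ ContMDiffAt.sum fun j _ ↦ ?_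
    exact ContMDiffAt.smul (h i j).self_of_nhds contMDiffAt_const
  refine (contMDiffAt_hom_bundle _).mpr ⟨contMDiffAt_id, h2.congr_of_eventuallyEq ?_⟩
  filter_upwards [eventually_chartDomain x₀] with y hy
  refine (key _).trans ?_
  refine Finset.sum_congr rfl fun i _ ↦ Finset.sum_congr rfl fun j _ ↦ ?_
  congr 1
  have h3 := inCoordinates_apply_eq₂ (E₃ := Bundle.Trivial M ℝ)
    (F₃ := ℝ) (ϕ := φ y) (v := e i) (w := e j) (x₀ := x₀) (x := y) hy hy (Set.mem_univ _)
  refine Eq.trans h3 ?_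
  rw [frame_eq_symm hy, frame_eq_symm hy]
  simp [e]

namespace NeutralMetric

variable (g : NeutralMetric M)

lemma smooth_val {X Y : Π x : M, T x} {x : M} (hX : SmoothFieldAt X x) (hY : SmoothFieldAt Y x) :
    SmoothFunAt (fun y ↦ g.val y (X y) (Y y)) x :=
  (SmoothBil.smoothBilAt g.smooth x).apply hX hY

/-- The components of the metric in the coordinate frame at `x₀`. -/
def frameGram (x₀ y : M) : Matrix (Fin 4) (Fin 4) ℝ :=
  Matrix.of fun i j ↦ g.val y (frame x₀ i y) (frame x₀ j y)

lemma gram_frameBasis {x₀ y : M} (hy : y ∈ chartDomain x₀) :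
    g.gram (frameBasis hy) = g.frameGram x₀ y := by
  simp [gram, frameGram]

/-- The components of the inverse metric are smooth, by Cramer's rule. -/
lemma smooth_frameGram_inv (x₀ : M) (i j : Fin 4) :
    SmoothFunAt (fun y ↦ (g.frameGram x₀ y)⁻¹ i j) x₀ := by
  have h : ∀ i j, SmoothFunAt (fun y ↦ g.frameGram x₀ y i j) x₀ := fun i j ↦
    g.smooth_val (smoothFieldAt_frame (mem_chartDomain x₀) i)
      (smoothFieldAt_frame (mem_chartDomain x₀) j)
  have hdet : (g.frameGram x₀ x₀).det ≠ 0 := by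
    rw [← g.gram_frameBasis (mem_chartDomain x₀)]
    exact g.gram_det_ne_zero _
  have hadj : SmoothFunAt (fun y ↦ (g.frameGram x₀ y).adjugate i j) x₀ := by
    simp only [Matrix.adjugate_apply]
    refine smooth_det fun k l ↦ ?_
    by_cases hk : k = j
    · subst hk
      simp only [Matrix.updateRow_self]
      exact SmoothFunAt.const _
    · simp only [Matrix.updateRow_ne hk]
      exact h k l
  refine (hadj.div (smooth_det h) hdet).congr (Filter.Eventually.of_forall fun y ↦ ?_)
  rw [Matrix.inv_def]
  simp [Ring.inverse_eq_inv', div_eq_inv_mul]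

/-- A vector field is smooth if its inner products with the coordinate frame are. -/
lemma smoothFieldAt_of_val {Z : Π x : M, T x} {x₀ : M}
    (h : ∀ i, SmoothFunAt (fun y ↦ g.val y (Z y) (frame x₀ i y)) x₀) : SmoothFieldAt Z x₀ := by
  have h1 : SmoothFieldAt (fun y ↦ ∑ i, ((fun y ↦ ∑ j, (g.frameGram x₀ y)⁻¹ i j *
      g.val y (Z y) (frame x₀ j y)) • frame x₀ i) y) x₀ := by
    refine SmoothFieldAt.sum fun i _ ↦ SmoothFieldAt.smul (SmoothFunAt.sum fun j _ ↦ ?_)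
      (smoothFieldAt_frame (mem_chartDomain x₀) i)
    exact (g.smooth_frameGram_inv x₀ i j).mul (h j)
  refine h1.congr ?_
  filter_upwards [eventually_chartDomain x₀] with y hy
  rw [g.sum_gram_inv (frameBasis hy) (Z y)]
  simp only [gram_frameBasis, frameBasis_apply, Pi.smul_apply', Finset.sum_smul]

lemma smooth_contract {B : Π x : M, T x → T x → ℝ} {x₀ : M}
    (hB : ∀ᶠ y in 𝓝 x₀, IsBilinearMap ℝ (B y))
    (h : ∀ i j, SmoothFunAt (fun y ↦ B y (frame x₀ i y) (frame x₀ j y)) x₀) :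
    SmoothFunAt (fun y ↦ g.contract y (B y)) x₀ := by
  have h1 : SmoothFunAt (fun y ↦ ∑ i, ∑ j, (g.frameGram x₀ y)⁻¹ i j *
      B y (frame x₀ i y) (frame x₀ j y)) x₀ :=
    SmoothFunAt.sum fun i _ ↦ SmoothFunAt.sum fun j _ ↦
      (g.smooth_frameGram_inv x₀ i j).mul (h i j)
  refine h1.congr ?_
  filter_upwards [eventually_chartDomain x₀, hB] with y hy hb
  rw [g.contract_eq_basis (frameBasis hy) hb]
  simp only [gram_frameBasis, frameBasis_apply]

lemma smooth_sharp {φ : Π x : M, Bil x} {X : Π x : M, T x} {x : M}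
    (hφ : SmoothBilAt φ x) (hX : SmoothFieldAt X x) :
    SmoothFieldAt (fun y ↦ g.sharp (φ y) (X y)) x := by
  refine g.smoothFieldAt_of_val fun i ↦ ?_
  simp only [val_sharp]
  exact hφ.apply hX (smoothFieldAt_frame (mem_chartDomain x) i)

/-! ### The Levi-Civita connection -/

variable {g} {x : M}

lemma tensorial_koszul_left {u w : Π x : M, T x} (hu : SmoothFieldAt u x)
    (hw : SmoothFieldAt w x) : Tensorial (fun v ↦ g.koszul v u w x) x where
  smul {f v} hf hv := by
    have e1 : dirDeriv (fun y ↦ g.val y ((f • v) y) (w y)) x (u x) =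
        f x * dirDeriv (fun y ↦ g.val y (v y) (w y)) x (u x)
          + g.val x (v x) (w x) * dirDeriv f x (u x) := by
      rw [← dirDeriv_mul hf (g.smooth_val hv hw)]
      congr 1
      ext y
      simp
    have e2 : dirDeriv (fun y ↦ g.val y ((f • v) y) (u y)) x (w x) =
        f x * dirDeriv (fun y ↦ g.val y (v y) (u y)) x (w x)
          + g.val x (v x) (u x) * dirDeriv f x (w x) := by
      rw [← dirDeriv_mul hf (g.smooth_val hv hu)]
      congr 1
      ext y
      simp
    simp only [koszul]
    rw [e1, e2, bracket_smul_right hf hv, bracket_smul_left hf hv]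
    simp only [Pi.smul_apply', map_add, map_smul, smul_eq_mul, _root_.smul_apply,
      isLinearMap_dirDeriv.map_smul, g.symm x (v x)]
    ring
  add {v v'} hv hv' := by
    have e1 : ∀ {z : Π x : M, T x}, SmoothFieldAt z x → ∀ t : T x,
        dirDeriv (fun y ↦ g.val y ((v + v') y) (z y)) x t =
        dirDeriv (fun y ↦ g.val y (v y) (z y)) x t
          + dirDeriv (fun y ↦ g.val y (v' y) (z y)) x t := by
      intro z hz t
      rw [← dirDeriv_add (g.smooth_val hv hz) (g.smooth_val hv' hz)]
      congr 1
      ext y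
      simp
    simp only [koszul]
    rw [e1 hw, e1 hu, bracket_add_right hv hv', bracket_add_left hv hv']
    simp only [Pi.add_apply, map_add, _root_.add_apply, isLinearMap_dirDeriv.map_add]
    ring

lemma tensorial_koszul_right {v u : Π x : M, T x} (hv : SmoothFieldAt v x)
    (hu : SmoothFieldAt u x) : Tensorial (fun w ↦ g.koszul v u w x) x where
  smul {f w} hf hw := by
    have e1 : ∀ {z : Π x : M, T x}, SmoothFieldAt z x → ∀ t : T x,
        dirDeriv (fun y ↦ g.val y (z y) ((f • w) y)) x t =
        f x * dirDeriv (fun y ↦ g.val y (z y) (w y)) x t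
          + g.val x (z x) (w x) * dirDeriv f x t := by
      intro z hz t
      rw [← dirDeriv_mul hf (g.smooth_val hz hw)]
      congr 1
      ext y
      simp
    simp only [koszul]
    rw [e1 hu, e1 hv, bracket_smul_right hf hw, bracket_smul_left hf hw]
    simp only [Pi.smul_apply', map_add, map_smul, smul_eq_mul, _root_.smul_apply,
      isLinearMap_dirDeriv.map_smul, g.symm x (w x)]
    ring
  add {w w'} hw hw' := by
    have e1 : ∀ {z : Π x : M, T x}, SmoothFieldAt z x → ∀ t : T x,
        dirDeriv (fun y ↦ g.val y (z y) ((w + w') y)) x t =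
        dirDeriv (fun y ↦ g.val y (z y) (w y)) x t
          + dirDeriv (fun y ↦ g.val y (z y) (w' y)) x t := by
      intro z hz t
      rw [← dirDeriv_add (g.smooth_val hz hw) (g.smooth_val hz hw')]
      congr 1
      ext y
      simp
    simp only [koszul]
    rw [e1 hu, e1 hv, bracket_add_right hw hw', bracket_add_left hw hw']
    simp only [Pi.add_apply, map_add, _root_.add_apply, isLinearMap_dirDeriv.map_add]
    ring

/-- The Koszul formula for arbitrary vector fields. -/
lemma two_mul_val_nabla {V X W : Π x : M, T x} (hV : SmoothFieldAt V x)
    (hX : SmoothFieldAt X x) (hW : SmoothFieldAt W x) :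
    2 * g.val x (g.nabla X x (V x)) (W x) = g.koszul V X W x := by
  have hlin := (tensorial_koszul_right (g := g) (smoothFieldAt_ext (V x)) hX).isLinearMap
  have hlin' : IsLinearMap ℝ fun w : T x ↦ (1 / 2 : ℝ) * g.koszul (ext (V x)) X (ext w) x :=
    ⟨fun u v ↦ by rw [hlin.map_add, mul_add], fun r u ↦ by
      rw [hlin.map_smul, smul_eq_mul, smul_eq_mul]; ring⟩
  have h1 := g.val_sum_inv hlin' (W x)
  have h2 : g.nabla X x (V x) = ∑ i, ∑ j, (g.inv x i j * ((1 / 2 : ℝ) *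
      g.koszul (ext (V x)) X (ext (coordVec x j)) x)) • coordVec x i := by
    unfold nabla
    refine Finset.sum_congr rfl fun i _ ↦ Finset.sum_congr rfl fun j _ ↦ ?_
    congr 1
    ring
  rw [h2, h1, (tensorial_koszul_right (smoothFieldAt_ext (V x)) hX).congr
    (smoothFieldAt_ext (W x)) hW (by simp), (tensorial_koszul_left hX hW).congr
    (smoothFieldAt_ext (V x)) hV (by simp)]
  ring

/-- The Koszul expression is local in the differentiated field. -/
lemma koszul_congr_mid {V X X' W : Π x : M, T x} (h : ∀ᶠ y in 𝓝 x, X y = X' y) :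
    g.koszul V X W x = g.koszul V X' W x := by
  simp only [koszul]
  rw [dirDeriv_congr (h.mono fun y hy ↦ by rw [hy] :
      ∀ᶠ y in 𝓝 x, g.val y (X y) (W y) = g.val y (X' y) (W y)),
    dirDeriv_congr (h.mono fun y hy ↦ by rw [hy] :
      ∀ᶠ y in 𝓝 x, g.val y (V y) (X y) = g.val y (V y) (X' y)),
    bracket_congr (Filter.Eventually.of_forall fun _ ↦ rfl) h,
    bracket_congr h (Filter.Eventually.of_forall fun _ ↦ rfl), h.self_of_nhds]

lemma nabla_congr {X X' : Π x : M, T x} (h : ∀ᶠ y in 𝓝 x, X y = X' y) (v : T x) :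
    g.nabla X x v = g.nabla X' x v := by
  simp only [nabla, koszul_congr_mid h]

lemma isLinearMap_nabla {X : Π x : M, T x} (hX : SmoothFieldAt X x) :
    IsLinearMap ℝ fun v ↦ g.nabla X x v := by
  have key : ∀ v w : T x, 2 * g.val x (g.nabla X x v) w = g.koszul (ext v) X (ext w) x := by
    intro v w
    rw [← two_mul_val_nabla (smoothFieldAt_ext v) hX (smoothFieldAt_ext w)]
    simp
  have hl := fun w : T x ↦
    (tensorial_koszul_left (g := g) hX (smoothFieldAt_ext w)).isLinearMap
  constructor
  · intro u v
    refine g.eq_of_forall fun w ↦ ?_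
    have h1 := key (u + v) w
    rw [(hl w).map_add, ← key, ← key] at h1
    simp only [map_add, _root_.add_apply]
    linarith
  · intro r v
    refine g.eq_of_forall fun w ↦ ?_
    have h1 := key (r • v) w
    rw [(hl w).map_smul, ← key, smul_eq_mul] at h1
    simp only [map_smul, _root_.smul_apply, smul_eq_mul]
    linarith

/-- The connection is compatible with the metric. -/
lemma dirDeriv_val {X Y : Π x : M, T x} (hX : SmoothFieldAt X x) (hY : SmoothFieldAt Y x)
    (w : T x) : dirDeriv (fun y ↦ g.val y (X y) (Y y)) x w =
      g.val x (g.nabla X x w) (Y x) + g.val x (X x) (g.nabla Y x w) := by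
  have hw := smoothFieldAt_ext w
  have h1 := two_mul_val_nabla (g := g) hw hX hY
  have h2 := two_mul_val_nabla (g := g) hw hY hX
  rw [ext_self] at h1 h2
  rw [g.symm x (X x)]
  have e : ∀ A B : Π x : M, T x, (fun y ↦ g.val y (A y) (B y)) = fun y ↦ g.val y (B y) (A y) :=
    fun A B ↦ funext fun y ↦ g.symm y _ _
  simp only [koszul, ext_self] at h1 h2
  rw [e Y X, bracket_swap (X := X) (Y := ext w), bracket_swap (X := Y) (Y := X)] at h2
  rw [bracket_swap (X := Y) (Y := ext w)] at h1
  simp only [map_neg] at h1 h2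
  linarith

lemma nabla_add {X Y : Π x : M, T x} (hX : SmoothFieldAt X x) (hY : SmoothFieldAt Y x)
    (v : T x) : g.nabla (X + Y) x v = g.nabla X x v + g.nabla Y x v := by
  refine g.eq_of_forall fun w ↦ ?_
  have hw := smoothFieldAt_ext w
  have h1 := dirDeriv_val (g := g) (hX.add hY) hw v
  have h2 := dirDeriv_val (g := g) hX hw v
  have h3 := dirDeriv_val (g := g) hY hw v
  have h4 := dirDeriv_add (g.smooth_val hX hw) (g.smooth_val hY hw) v
  simp only [Pi.add_apply, map_add, _root_.add_apply, ext_self] at h1 h2 h3 ⊢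
  linarith

/-- The Leibniz rule. -/
lemma nabla_smul {f : M → ℝ} {X : Π x : M, T x} (hf : SmoothFunAt f x) (hX : SmoothFieldAt X x)
    (v : T x) : g.nabla (f • X) x v = dirDeriv f x v • X x + f x • g.nabla X x v := by
  refine g.eq_of_forall fun w ↦ ?_
  have hw := smoothFieldAt_ext w
  have h1 := dirDeriv_val (g := g) (hX.smul hf) hw v
  have h2 := dirDeriv_val (g := g) hX hw v
  have h4 := dirDeriv_mul hf (g.smooth_val hX hw) v
  simp only [Pi.smul_apply', map_smul, _root_.smul_apply, smul_eq_mul, map_add,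
    _root_.add_apply, ext_self] at h1 h2 h4 ⊢
  rw [h4, h2] at h1
  linarith

lemma nabla_const_smul (r : ℝ) {X : Π x : M, T x} (hX : SmoothFieldAt X x)
    (v : T x) : g.nabla (r • X) x v = r • g.nabla X x v := by
  have h := nabla_smul (g := g) (SmoothFunAt.const r) hX v
  rw [dirDeriv_const, zero_smul, zero_add] at h
  exact h

end NeutralMetric

end

/-! ### Curvature -/

section

variable {M : Type*} [TopologicalSpace M] [ChartedSpace E4 M]

lemma isBilinearMap_mul {x : M} {A B : T x → T x → ℝ} (hA : IsBilinearMap ℝ A)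
    (hB : IsBilinearMap ℝ B) (u v : T x) : IsBilinearMap ℝ fun a b ↦ A u a * B v b where
  add_left a a' b := by rw [hA.add_right, add_mul]
  smul_left r a b := by rw [hA.smul_right, smul_eq_mul, smul_eq_mul, mul_assoc]
  add_right a b b' := by rw [hB.add_right, mul_add]
  smul_right r a b := by rw [hB.smul_right, smul_eq_mul, smul_eq_mul, mul_left_comm]

variable [IsManifold 𝓘(ℝ, E4) ∞ M]

namespace NeutralMetric

variable {g : NeutralMetric M} {x : M}

lemma smooth_koszul {V X W : Π x : M, T x} (hV : SmoothFieldAt V x) (hX : SmoothFieldAt X x)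
    (hW : SmoothFieldAt W x) : SmoothFunAt (fun y ↦ g.koszul V X W y) x := by
  unfold koszul
  exact ((((((g.smooth_val hX hW).dirDeriv hV).add ((g.smooth_val hV hW).dirDeriv hX)).sub
    ((g.smooth_val hV hX).dirDeriv hW)).add (g.smooth_val hX (hW.bracket hV))).add
    (g.smooth_val hW (hV.bracket hX))).sub (g.smooth_val hV (hX.bracket hW))

lemma smooth_nabla {V X : Π x : M, T x} (hV : SmoothFieldAt V x) (hX : SmoothFieldAt X x) :
    SmoothFieldAt (fun y ↦ g.nabla X y (V y)) x := by
  refine g.smoothFieldAt_of_val fun i ↦ ?_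
  have hW := smoothFieldAt_frame (mem_chartDomain x) i
  refine ((SmoothFunAt.const (1 / 2)).mul (smooth_koszul (g := g) hV hX hW)).congr ?_
  filter_upwards [hV.eventually, hX.eventually, hW.eventually] with y h1 h2 h3
  rw [← two_mul_val_nabla h1 h2 h3]
  ring

lemma smooth_curvField {X Y Z : Π x : M, T x} (hX : SmoothFieldAt X x) (hY : SmoothFieldAt Y x)
    (hZ : SmoothFieldAt Z x) : SmoothFieldAt (fun y ↦ g.curvField X Y Z y) x := by
  have h := ((smooth_nabla (g := g) hY (smooth_nabla (g := g) hX hZ)).add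
    ((smooth_nabla (g := g) hX (smooth_nabla (g := g) hY hZ)).const_smul (-1))).add
    (smooth_nabla (g := g) (hX.bracket hY) hZ)
  refine h.congr (Filter.Eventually.of_forall fun y ↦ ?_)
  simp only [curvField, Pi.add_apply, Pi.smul_apply]
  module

/-- The curvature is skew-symmetric in its first two arguments. -/
lemma curvField_swap {X Y Z : Π x : M, T x} (hZ : SmoothFieldAt Z x) :
    g.curvField X Y Z x = -g.curvField Y X Z x := by
  simp only [curvField]
  rw [bracket_swap, (isLinearMap_nabla hZ).map_neg]
  abel

lemma tensorial_curvField_left {Y Z : Π x : M, T x} (hY : SmoothFieldAt Y x)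
    (hZ : SmoothFieldAt Z x) : Tensorial (fun X ↦ g.curvField X Y Z x) x where
  smul {f X} hf hX := by
    have h1 : ∀ᶠ y in 𝓝 x, g.nabla Z y ((f • X) y) = (f • fun y ↦ g.nabla Z y (X y)) y :=
      hZ.eventually.mono fun y hy ↦ (isLinearMap_nabla hy).map_smul _ _
    simp only [curvField]
    rw [nabla_congr h1, nabla_smul hf (smooth_nabla hX hZ), bracket_smul_left hf hX,
      Pi.smul_apply', (isLinearMap_nabla (smooth_nabla hY hZ)).map_smul,
      (isLinearMap_nabla hZ).map_add, (isLinearMap_nabla hZ).map_smul,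
      (isLinearMap_nabla hZ).map_smul]
    module
  add {X X'} hX hX' := by
    have h1 : ∀ᶠ y in 𝓝 x, g.nabla Z y ((X + X') y) =
        ((fun y ↦ g.nabla Z y (X y)) + fun y ↦ g.nabla Z y (X' y)) y :=
      hZ.eventually.mono fun y hy ↦ (isLinearMap_nabla hy).map_add _ _
    simp only [curvField]
    rw [nabla_congr h1, nabla_add (smooth_nabla hX hZ) (smooth_nabla hX' hZ),
      bracket_add_left hX hX', Pi.add_apply, (isLinearMap_nabla (smooth_nabla hY hZ)).map_add,
      (isLinearMap_nabla hZ).map_add]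
    abel

lemma tensorial_curvField_mid {X Z : Π x : M, T x} (hX : SmoothFieldAt X x)
    (hZ : SmoothFieldAt Z x) : Tensorial (fun Y ↦ g.curvField X Y Z x) x where
  smul {f Y} hf hY := by
    rw [curvField_swap hZ, curvField_swap (X := X) hZ, (tensorial_curvField_left hX hZ).smul hf hY,
      smul_neg]
  add {Y Y'} hY hY' := by
    rw [curvField_swap hZ, curvField_swap (X := X) hZ, curvField_swap (X := X) (Y := Y') hZ,
      (tensorial_curvField_left hX hZ).add hY hY', neg_add]

/-- The second derivatives of the coefficient function cancel, by `dirDeriv_bracket`. -/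
lemma tensorial_curvField_right {X Y : Π x : M, T x} (hX : SmoothFieldAt X x)
    (hY : SmoothFieldAt Y x) : Tensorial (fun Z ↦ g.curvField X Y Z x) x where
  smul {f Z} hf hZ := by
    have h1 : ∀ {V : Π x : M, T x}, SmoothFieldAt V x → ∀ v : T x,
        g.nabla (fun y ↦ g.nabla (f • Z) y (V y)) x v =
          dirDeriv (fun y ↦ dirDeriv f y (V y)) x v • Z x
          + dirDeriv f x (V x) • g.nabla Z x v + dirDeriv f x v • g.nabla Z x (V x)
          + f x • g.nabla (fun y ↦ g.nabla Z y (V y)) x v := by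
      intro V hV v
      have h2 : ∀ᶠ y in 𝓝 x, g.nabla (f • Z) y (V y) =
          ((fun y ↦ dirDeriv f y (V y)) • Z + f • fun y ↦ g.nabla Z y (V y)) y := by
        filter_upwards [hf.eventually, hZ.eventually] with y h3 h4 using nabla_smul h3 h4 _
      rw [nabla_congr h2, nabla_add (hZ.smul (hf.dirDeriv hV)) ((smooth_nabla hV hZ).smul hf),
        nabla_smul (hf.dirDeriv hV) hZ, nabla_smul hf (smooth_nabla hV hZ)]
      module
    simp only [curvField]
    rw [h1 hX, h1 hY, nabla_smul hf hZ, dirDeriv_bracket hX hY hf]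
    module
  add {Z Z'} hZ hZ' := by
    have h1 : ∀ {V : Π x : M, T x}, SmoothFieldAt V x → ∀ v : T x,
        g.nabla (fun y ↦ g.nabla (Z + Z') y (V y)) x v =
          g.nabla (fun y ↦ g.nabla Z y (V y)) x v + g.nabla (fun y ↦ g.nabla Z' y (V y)) x v := by
      intro V hV v
      have h2 : ∀ᶠ y in 𝓝 x, g.nabla (Z + Z') y (V y) =
          ((fun y ↦ g.nabla Z y (V y)) + fun y ↦ g.nabla Z' y (V y)) y := by
        filter_upwards [hZ.eventually, hZ'.eventually] with y h3 h4 using nabla_add h3 h4 _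
      rw [nabla_congr h2, nabla_add (smooth_nabla hV hZ) (smooth_nabla hV hZ')]
    simp only [curvField]
    rw [h1 hX, h1 hY, nabla_add hZ hZ']
    abel

/-- The curvature tensor evaluated on vector fields. -/
lemma curv_eq {X Y Z : Π x : M, T x} (hX : SmoothFieldAt X x) (hY : SmoothFieldAt Y x)
    (hZ : SmoothFieldAt Z x) (d : T x) :
    g.curv x (X x) (Y x) (Z x) d = g.val x (g.curvField X Y Z x) d := by
  unfold curv
  rw [(tensorial_curvField_left (smoothFieldAt_ext _) (smoothFieldAt_ext _)).congr
      (smoothFieldAt_ext _) hX (ext_self _),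
    (tensorial_curvField_mid hX (smoothFieldAt_ext _)).congr (smoothFieldAt_ext _) hY (ext_self _),
    (tensorial_curvField_right hX hY).congr (smoothFieldAt_ext _) hZ (ext_self _)]

lemma isBilinearMap_curv (a b : T x) : IsBilinearMap ℝ fun c d ↦ g.curv x a b c d := by
  have h := (tensorial_curvField_right (g := g) (smoothFieldAt_ext a)
    (smoothFieldAt_ext b)).isLinearMap
  unfold curv
  constructor
  · intro c c' d
    rw [h.map_add, map_add, _root_.add_apply]
  · intro r c d
    rw [h.map_smul, map_smul, _root_.smul_apply]
  · intro c d d'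
    rw [map_add]
  · intro r c d
    rw [map_smul]

/-! ### The Weyl tensor of an Einstein metric -/

section Einstein

variable {c : ℝ} (hc : ∀ (x : M) (u v : T x), g.ricci x u v = c * g.val x u v)

include hc

/-- The Einstein equation reduces the Weyl tensor to the curvature tensor and a multiple of
`g ∧ g`. -/
lemma weyl_eq (u v a b : T x) : g.weyl x u v a b =
    g.curv x u v a b - c / 3 * (g.val x u a * g.val x v b - g.val x v a * g.val x u b) := by
  have hs : g.scal x = c * 4 := by
    unfold scal
    simp only [hc]
    rw [← g.contract_metric (x := x), g.contract_mul_left]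
  unfold weyl
  rw [hs]
  simp only [hc]
  ring

lemma isBilinearMap_weyl (u v : T x) : IsBilinearMap ℝ fun a b ↦ g.weyl x u v a b := by
  have h := isBilinearMap_curv (g := g) u v
  constructor
  · intro a a' b
    simp only [weyl_eq hc, h.add_left, map_add]
    ring
  · intro r a b
    simp only [weyl_eq hc, h.smul_left, map_smul, smul_eq_mul]
    ring
  · intro a b b'
    simp only [weyl_eq hc, h.add_right, map_add]
    ring
  · intro r a b
    simp only [weyl_eq hc, h.smul_right, map_smul, smul_eq_mul]
    ring

lemma smooth_weyl {X Y Z V : Π x : M, T x} (hX : SmoothFieldAt X x) (hY : SmoothFieldAt Y x)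
    (hZ : SmoothFieldAt Z x) (hV : SmoothFieldAt V x) :
    SmoothFunAt (fun y ↦ g.weyl y (X y) (Y y) (Z y) (V y)) x := by
  refine ((g.smooth_val (smooth_curvField (g := g) hX hY hZ) hV).sub
    ((SmoothFunAt.const (c / 3)).mul (((g.smooth_val hX hZ).mul (g.smooth_val hY hV)).sub
      ((g.smooth_val hY hZ).mul (g.smooth_val hX hV))))).congr ?_
  filter_upwards [hX.eventually, hY.eventually, hZ.eventually] with y h1 h2 h3
  rw [weyl_eq hc, curv_eq h1 h2 h3]

end Einstein

lemma isBilinearMap_contract {x : M} {A B : T x → T x → ℝ} (hA : IsBilinearMap ℝ A)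
    (hB : IsBilinearMap ℝ B) :
    IsBilinearMap ℝ fun u v ↦ g.contract x fun a b ↦ A u a * B v b where
  add_left u u' v := by
    rw [← g.contract_add]
    simp only [hA.add_left, add_mul]
  smul_left r u v := by
    rw [smul_eq_mul, ← g.contract_mul_left]
    simp only [hA.smul_left, smul_eq_mul, mul_assoc]
  add_right u v v' := by
    rw [← g.contract_add]
    simp only [hB.add_left, mul_add]
  smul_right r u v := by
    rw [smul_eq_mul, ← g.contract_mul_left]
    simp only [hB.smul_left, smul_eq_mul, mul_left_comm]

lemma smooth_pairing {A B : Π x : M, T x → T x → ℝ}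
    (hA : ∀ᶠ y in 𝓝 x, IsBilinearMap ℝ (A y)) (hB : ∀ᶠ y in 𝓝 x, IsBilinearMap ℝ (B y))
    (hA' : ∀ i j, SmoothFunAt (fun y ↦ A y (frame x i y) (frame x j y)) x)
    (hB' : ∀ i j, SmoothFunAt (fun y ↦ B y (frame x i y) (frame x j y)) x) :
    SmoothFunAt (fun y ↦ g.pairing y (A y) (B y)) x := by
  unfold pairing
  refine (SmoothFunAt.const _).mul
    (g.smooth_contract ?_ fun i j ↦ g.smooth_contract ?_ fun k l ↦ ?_)
  · filter_upwards [hA, hB] with y h1 h2 using isBilinearMap_contract h1 h2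
  · filter_upwards [hA, hB] with y h1 h2 using isBilinearMap_mul h1 h2 _ _
  · exact (hA' i k).mul (hB' j l)

lemma smooth_ip {φ ψ : Π x : M, Bil x} (hφ : SmoothBilAt φ x) (hψ : SmoothBilAt ψ x) :
    SmoothFunAt (fun y ↦ g.ip (φ y) (ψ y)) x :=
  smooth_pairing (Filter.Eventually.of_forall fun _ ↦ isBilinearMap_bil _)
    (Filter.Eventually.of_forall fun _ ↦ isBilinearMap_bil _) hφ hψ

/-- The Weyl operator preserves smoothness. -/
lemma smooth_weylOp (hE : g.IsEinstein) {φ ψ : Π x : M, Bil x} (hφ : SmoothBilAt φ x)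
    (h : ∀ y u v, g.weylOp y (φ y) u v = ψ y u v) : SmoothBilAt ψ x := by
  obtain ⟨c, hc⟩ := hE
  intro i j
  have hf : ∀ i, SmoothFieldAt (frame x i) x := fun i ↦ smoothFieldAt_frame (mem_chartDomain x) i
  simp only [← h]
  exact smooth_pairing (Filter.Eventually.of_forall fun y ↦ isBilinearMap_weyl hc _ _)
    (Filter.Eventually.of_forall fun _ ↦ isBilinearMap_bil _)
    (fun k l ↦ smooth_weyl hc (hf i) (hf j) (hf k) (hf l)) hφ

/-! ### Covariant derivatives of twice-covariant tensor fields -/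

/-- The difference `∇_w(φ^♯ X) - φ^♯ ∇_w X` depends only on the value of `X` at `x`. -/
lemma tensorial_nabla_sharp {φ : Π x : M, Bil x} (hφ : SmoothBilAt φ x) (w : T x) :
    Tensorial (fun X ↦ g.nabla (fun y ↦ g.sharp (φ y) (X y)) x w
      - g.sharp (φ x) (g.nabla X x w)) x where
  smul {f X} hf hX := by
    have h1 : (fun y ↦ g.sharp (φ y) ((f • X) y)) = f • fun y ↦ g.sharp (φ y) (X y) := by
      funext y
      simp
    rw [h1, nabla_smul hf (g.smooth_sharp hφ hX), nabla_smul hf hX]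
    simp only [map_add, map_smul]
    module
  add {X Y} hX hY := by
    have h1 : (fun y ↦ g.sharp (φ y) ((X + Y) y)) =
        (fun y ↦ g.sharp (φ y) (X y)) + fun y ↦ g.sharp (φ y) (Y y) := by
      funext y
      simp
    rw [h1, nabla_add (g.smooth_sharp hφ hX) (g.smooth_sharp hφ hY), nabla_add hX hY]
    simp only [map_add]
    abel

/-- The covariant derivative of `φ` in terms of an arbitrary extension `X` of its first
argument. -/
lemma nablaBil_eq {φ : Π x : M, Bil x} (hφ : SmoothBilAt φ x) {X : Π x : M, T x}
    (hX : SmoothFieldAt X x) (w v : T x) :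
    g.nablaBil φ x w (X x) v =
      g.val x (g.nabla (fun y ↦ g.sharp (φ y) (X y)) x w) v - φ x (g.nabla X x w) v := by
  have h1 := (tensorial_nabla_sharp (g := g) hφ w).congr (smoothFieldAt_ext (X x)) hX (ext_self _)
  have h2 := congrArg (fun z ↦ g.val x z v) h1
  have h3 := dirDeriv_val (g := g) (g.smooth_sharp hφ (smoothFieldAt_ext (X x)))
    (smoothFieldAt_ext v) w
  simp only [map_sub, _root_.sub_apply, val_sharp, ext_self] at h2 h3
  unfold nablaBil
  rw [h3]
  linarith

lemma isLinearMap_nablaBil (φ : Π x : M, Bil x) (u v : T x) :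
    IsLinearMap ℝ fun w ↦ g.nablaBil φ x w u v := by
  have h1 := isLinearMap_nabla (g := g) (smoothFieldAt_ext u)
  have h2 := isLinearMap_nabla (g := g) (smoothFieldAt_ext v)
  unfold nablaBil
  constructor
  · intro w w'
    rw [isLinearMap_dirDeriv.map_add, h1.map_add, h2.map_add]
    simp only [map_add, _root_.add_apply]
    ring
  · intro r w
    rw [isLinearMap_dirDeriv.map_smul, h1.map_smul, h2.map_smul]
    simp only [map_smul, _root_.smul_apply, smul_eq_mul]
    ring

/-- The covariant derivative of a twice-covariant tensor field is a twice-covariant tensor. -/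
lemma exists_nablaBil {φ : Π x : M, Bil x} (hφ : SmoothBilAt φ x) (w : T x) :
    ∃ ψ : Bil x, ∀ u v, ψ u v = g.nablaBil φ x w u v := by
  let L : T x →ₗ[ℝ] T x := (tensorial_nabla_sharp (g := g) hφ w).isLinearMap.mk'
  let L' : T x →L[ℝ] T x := L.toContinuousLinearMap
  refine ⟨(g.val x).comp L', fun u v ↦ ?_⟩
  have h := nablaBil_eq (g := g) hφ (smoothFieldAt_ext u) w v
  rw [ext_self] at h
  rw [h]
  change g.val x (g.nabla (fun y ↦ g.sharp (φ y) (ext u y)) x w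
      - g.sharp (φ x) (g.nabla (ext u) x w)) v = _
  rw [map_sub, _root_.sub_apply, val_sharp]

end NeutralMetric

end

/-! ### Smoothness of the canonical frame -/

section

variable {M : Type*} [TopologicalSpace M] [ChartedSpace E4 M] [IsManifold 𝓘(ℝ, E4) ∞ M]

namespace NeutralMetric

variable {g : NeutralMetric M} {o : Π x : M, Orientation ℝ (T x) (Fin 4)} {x : M}

lemma val_sharp_right {φ : Bil x} (hφ : IsTwoForm φ) (u v : T x) :
    g.val x u (g.sharp φ v) = -φ u v := by
  rw [g.symm, val_sharp, hφ.swap]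

/-- The compression `φ ↦ φ((1 + η)·, (1 + η)·)` picks out the coefficient of `θ`, since
`(1 + η) / 2` is the projection onto `Ker ζ` along `Ker θ`. -/
lemma IsFrame.compression {ζ η θ κ : Bil x} (h : g.IsFrame o ζ η θ)
    (hk : ∀ u, g.sharp η (g.sharp ζ u) = g.sharp ζ u) (hκ : IsTwoForm κ)
    (hκ' : ∀ ψ, g.SelfDualForm o ψ → g.ip ψ κ = 0) (p q r : ℝ) (u v : T x) :
    ((p • ζ + q • η + r • θ) + κ) (u + g.sharp η u) (v + g.sharp η v) = 4 * r * θ u v := by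
  have hη := h.sd_η.1
  have hθ := h.sd_θ.1
  have e1 : ζ (u + g.sharp η u) = 0 := by
    rw [← g.sharp_eq_zero_iff, map_add, h.ζ_η, hk]
    abel
  -- `η` is an anti-isometry.
  have e2 : ∀ a b : T x, g.val x (g.sharp η a) (g.sharp η b) = -g.val x a b := by
    intro a b
    rw [val_sharp_right hη, ← val_sharp, h.η_η]
  have e3 : η (u + g.sharp η u) (v + g.sharp η v) = 0 := by
    rw [← g.val_sharp η, map_add (g.sharp η), h.η_η]
    simp only [map_add, _root_.add_apply]
    rw [e2, val_sharp_right hη, val_sharp]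
    ring
  have e4 : ∀ a : T x, g.sharp θ (a + g.sharp η a) = (2 : ℝ) • g.sharp θ a := by
    intro a
    have h1 := h.η_θ a
    have h2 := h.sharp_η_θ hk a
    rw [h2] at h1
    rw [map_add, ← neg_inj.mp h1]
    module
  have e5 : θ (u + g.sharp η u) (v + g.sharp η v) = 4 * θ u v := by
    rw [← val_sharp, e4, map_smul, _root_.smul_apply, val_sharp, hθ.swap, ← val_sharp, e4,
      map_smul, _root_.smul_apply, val_sharp, hθ.swap u]
    simp only [smul_eq_mul]
    ring
  have e6 : κ (u + g.sharp η u) (v + g.sharp η v) = 0 := by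
    rw [← g.val_sharp κ, map_add (g.sharp κ), ← h.comm h.sd_η hκ hκ']
    simp only [map_add, _root_.add_apply]
    rw [e2, val_sharp_right hη]
    simp only [val_sharp]
    ring
  simp only [_root_.add_apply, _root_.smul_apply, smul_eq_mul, e3, e5, e6, e1]
  simp
  ring

/-- The canonical frame is smooth since it is obtained from a smooth `2`-form `φ` with
`⟨φ, ζ⟩ ≠ 0` by operations that preserve smoothness. -/
lemma smooth_frame (hE : g.IsEinstein) (hSD : g.IsSelfDual o) {ζ η θ : Π y : M, Bil y}
    (hF : ∀ y, g.IsFrame o (ζ y) (η y) (θ y)) (hζ : ∀ y u v, g.weylOp y (ζ y) u v = 0)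
    (hη : ∀ y u v, g.weylOp y (η y) u v = -ζ y u v)
    (hθ : ∀ y u v, g.weylOp y (θ y) u v = η y u v)
    (hk : ∀ y u, g.sharp (η y) (g.sharp (ζ y) u) = g.sharp (ζ y) u) (x : M) :
    SmoothBilAt ζ x ∧ SmoothBilAt η x ∧ SmoothBilAt θ x := by
  obtain ⟨u₀, v₀, h₀⟩ : ∃ u v, ζ x u v ≠ 0 := by
    by_contra! h
    have h1 : ζ x = 0 := by
      ext u v
      exact h u v
    have h2 := (hF x).ζθ
    rw [h1, ip_zero_left] at h2
    norm_num at h2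
  set X : Π y : M, T y := ext u₀
  set Y : Π y : M, T y := ext v₀
  have hX : SmoothFieldAt X x := smoothFieldAt_ext u₀
  have hY : SmoothFieldAt Y x := smoothFieldAt_ext v₀
  set φ : Π y : M, Bil y := fun y ↦ g.bivector (X y) (Y y) with hφdef
  choose p q r κ hφ hκ hκ' using fun y ↦ (hF y).decompose (g.isTwoForm_bivector (X y) (Y y))
  have hf : ∀ i, SmoothFieldAt (frame x i) x := fun i ↦ smoothFieldAt_frame (mem_chartDomain x) i
  have sφ : SmoothBilAt φ x := by
    intro i j
    simp only [hφdef, bivector_apply]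
    exact ((g.smooth_val hX (hf i)).mul (g.smooth_val hY (hf j))).sub
      ((g.smooth_val hY (hf i)).mul (g.smooth_val hX (hf j)))
  -- `Wφ = -q ζ + r η` and `W²φ = -r ζ`.
  set ψ : Π y : M, Bil y := fun y ↦ (-q y) • ζ y + r y • η y with hψdef
  set χ : Π y : M, Bil y := fun y ↦ (-r y) • ζ y with hχdef
  have hWφ : ∀ y u v, g.weylOp y (φ y) u v = ψ y u v := by
    intro y u v
    simp only [hφdef]
    rw [hφ y]
    simp only [weylOp_add, weylOp_smul, hζ, hη, hθ, hSD y _ ((hF y).antiSelfDual (hκ y) (hκ' y)),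
      hψdef, _root_.add_apply, _root_.smul_apply, smul_eq_mul]
    ring
  have hWψ : ∀ y u v, g.weylOp y (ψ y) u v = χ y u v := by
    intro y u v
    simp only [hψdef, weylOp_add, weylOp_smul, hζ, hη, hχdef, _root_.smul_apply, smul_eq_mul]
    ring
  have sψ : SmoothBilAt ψ x := smooth_weylOp hE sφ hWφ
  have sχ : SmoothBilAt χ x := smooth_weylOp hE sψ hWψ
  have hr : ∀ y, ζ y (X y) (Y y) = 2 * r y := by
    intro y
    rw [← g.ip_bivector (hF y).sd_ζ.1, hφ y, ip_add_left, (hF y).ip_comb_ζ,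
      g.ip_comm (κ y), hκ' y _ (hF y).sd_ζ, add_zero]
  have hr₀ : r x ≠ 0 := by
    intro h
    apply h₀
    have := hr x
    rw [h] at this
    simpa [X, Y] using this
  have hχ : ∀ y, χ y (X y) (Y y) = -2 * r y ^ 2 := by
    intro y
    simp only [hχdef, _root_.smul_apply, smul_eq_mul, hr]
    ring
  have hψχ : ∀ y, ψ y (g.sharp (χ y) (X y)) (Y y) = -2 * r y ^ 3 := by
    intro y
    have h1 : g.sharp (χ y) (X y) = (-r y) • g.sharp (ζ y) (X y) :=
      g.eq_of_forall fun w ↦ by simp [hχdef]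
    rw [h1]
    simp only [hψdef, map_smul, _root_.smul_apply, _root_.add_apply, smul_eq_mul,
      (hF y).ζ_sharp_eq_zero]
    rw [← g.val_sharp (η y), hk, val_sharp, hr]
    simp
    ring
  -- The quotient of the last two expressions determines `r`, including its sign.
  have sr : SmoothFunAt r x := by
    have hne : χ x (X x) (Y x) ≠ 0 := by
      rw [hχ]
      simpa using hr₀
    have s1 := sχ.apply hX hY
    refine ((sψ.apply (g.smooth_sharp sχ hX) hY).div s1 hne).congr ?_
    filter_upwards [s1.eventually_ne_zero hne] with y hy
    rw [hχ] at hy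
    rw [hψχ, hχ, eq_div_iff hy]
    ring
  have hne : ∀ᶠ y in 𝓝 x, r y ≠ 0 := sr.eventually_ne_zero hr₀
  have sq : SmoothFunAt q x := by
    have h4 : (-4 : ℝ) * r x ≠ 0 := mul_ne_zero (by norm_num) hr₀
    refine ((smooth_ip (g := g) sφ sψ).div ((SmoothFunAt.const (-4)).mul sr) h4).congr ?_
    filter_upwards [hne] with y hy
    have h1 : g.SelfDualForm o (ψ y) := ((hF y).sd_ζ.smul _).add ((hF y).sd_η.smul _)
    have h2 : g.ip (φ y) (ψ y) = -4 * r y * q y := by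
      simp only [hφdef]
      rw [hφ y, ip_add_left, g.ip_comm (κ y), hκ' y _ h1]
      simp only [hψdef]
      rw [ip_add_right, ip_smul_right, ip_smul_right, (hF y).ip_comb_ζ, (hF y).ip_comb_η]
      ring
    rw [h2]
    field_simp
  have sri : SmoothFunAt (fun y ↦ 1 / r y) x := (SmoothFunAt.const 1).div sr hr₀
  have sζ : SmoothBilAt ζ x := by
    intro i j
    refine (((SmoothFunAt.const (-1)).mul sri).mul (sχ i j)).congr ?_
    filter_upwards [hne] with y hy
    simp only [hχdef, _root_.smul_apply, smul_eq_mul]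
    field_simp
  have sη : SmoothBilAt η x := by
    intro i j
    refine (sri.mul ((sψ i j).add (sq.mul (sζ i j)))).congr ?_
    filter_upwards [hne] with y hy
    simp only [hψdef, _root_.add_apply, _root_.smul_apply, smul_eq_mul]
    field_simp
    ring
  refine ⟨sζ, sη, fun i j ↦ ?_⟩
  have s2 := sφ.apply ((hf i).add (g.smooth_sharp sη (hf i)))
    ((hf j).add (g.smooth_sharp sη (hf j)))
  refine (((SmoothFunAt.const (1 / 4)).mul sri).mul s2).congr ?_
  filter_upwards [hne] with y hy
  simp only [hφdef, Pi.add_apply]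
  rw [hφ y, (hF y).compression (hk y) (hκ y) (hκ' y)]
  field_simp

/-! ### The connection forms of the canonical frame -/

lemma isTwoForm_nablaBil {φ : Π y : M, Bil y} (hφ : ∀ y, IsTwoForm (φ y)) {w : T x} {ψ : Bil x}
    (hψ : ∀ u v, ψ u v = g.nablaBil φ x w u v) : IsTwoForm ψ := by
  intro u
  rw [hψ, nablaBil, (hφ x).swap u]
  have h : (fun y ↦ φ y (ext u y) (ext u y)) = fun _ ↦ 0 := funext fun y ↦ hφ y _
  rw [h, dirDeriv_const]
  ring

lemma nabla_sharp {φ : Π y : M, Bil y} (hφ : SmoothBilAt φ x) {X : Π y : M, T y}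
    (hX : SmoothFieldAt X x) {w : T x} {ψ : Bil x} (hψ : ∀ u v, ψ u v = g.nablaBil φ x w u v) :
    g.nabla (fun y ↦ g.sharp (φ y) (X y)) x w =
      g.sharp ψ (X x) + g.sharp (φ x) (g.nabla X x w) := by
  refine g.eq_of_forall fun v ↦ ?_
  rw [map_add, _root_.add_apply, val_sharp, val_sharp, hψ, nablaBil_eq hφ hX]
  ring

/-- The derivative of a Clifford relation. -/
lemma nabla_anticomm {φ ψ : Π y : M, Bil y} (hφ : SmoothBilAt φ x) (hψ : SmoothBilAt ψ x) {k : ℝ}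
    (hk : ∀ y (u : T y), g.sharp (φ y) (g.sharp (ψ y) u) + g.sharp (ψ y) (g.sharp (φ y) u) = k • u)
    {w : T x} {φ' ψ' : Bil x} (hφ' : ∀ u v, φ' u v = g.nablaBil φ x w u v)
    (hψ' : ∀ u v, ψ' u v = g.nablaBil ψ x w u v) (u : T x) :
    (g.sharp φ' (g.sharp (ψ x) u) + g.sharp (ψ x) (g.sharp φ' u)) +
      (g.sharp (φ x) (g.sharp ψ' u) + g.sharp ψ' (g.sharp (φ x) u)) = 0 := by
  have hX := smoothFieldAt_ext u
  have s1 := g.smooth_sharp hψ hX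
  have s2 := g.smooth_sharp hφ hX
  have h1 : (fun y ↦ g.sharp (φ y) (g.sharp (ψ y) (ext u y))) +
      (fun y ↦ g.sharp (ψ y) (g.sharp (φ y) (ext u y))) = k • ext u := funext fun y ↦ hk y _
  have h2 := congrArg (fun Z ↦ g.nabla Z x w) h1
  have h3 := hk x (g.nabla (ext u) x w)
  rw [nabla_add (g.smooth_sharp hφ s1) (g.smooth_sharp hψ s2), nabla_const_smul k hX,
    nabla_sharp hφ s1 hφ', nabla_sharp hψ s2 hψ', nabla_sharp hψ hX hψ', nabla_sharp hφ hX hφ',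
    ← h3] at h2
  simp only [map_add, ext_self] at h2
  linear_combination (norm := module) h2

/-- A `2`-form that anticommutes with `η` up to scalars is self-dual. This applies to the
derivatives of `ζ, η, θ` by the differentiated Clifford relations. -/
lemma IsFrame.selfDual_of_anticomm {ζ η θ φ : Bil x} (h : g.IsFrame o ζ η θ) (hφ : IsTwoForm φ)
    {c : ℝ} (hc : ∀ u, g.sharp φ (g.sharp η u) + g.sharp η (g.sharp φ u) = c • u) :
    g.SelfDualForm o φ := by
  obtain ⟨p, q, r, κ, he, hκ, hκ'⟩ := h.decompose hφ
  set ξ := p • ζ + q • η + r • θ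
  have hξ : g.SelfDualForm o ξ := h.comb p q r
  have hsum : ∀ u, g.sharp φ u = g.sharp ξ u + g.sharp κ u := fun u ↦
    g.eq_of_forall fun v ↦ by rw [he]; simp
  -- The part `κ` of `φ` commutes with `η`, so that it is a multiple of `η`.
  have h1 : κ = ((c + g.ip ξ η) / 2) • η := by
    ext u v
    have h2 := hc (g.sharp η u)
    have h3 := hξ.anticomm h.sd_η (g.sharp η u)
    have h4 := h.comm h.sd_η hκ hκ' u
    simp only [hsum, map_add, h.η_η] at h2 h3
    rw [h4] at *
    rw [← h4, h.comm h.sd_η hκ hκ' (g.sharp η u), h.η_η] at h2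
    have h5 : g.sharp κ u = ((c + g.ip ξ η) / 2) • g.sharp η u := by
      linear_combination (norm := module) (1 / 2 : ℝ) • h2 - (1 / 2 : ℝ) • h3
    have h6 := congrArg (fun z ↦ g.val x z v) h5
    simpa using h6
  have h2 := hκ' η h.sd_η
  rw [h1, ip_smul_right, h.ηη] at h2
  have h3 : (c + g.ip ξ η) / 2 = 0 := by linarith
  have h4 : κ = 0 := by
    ext u v
    rw [h1, h3]
    simp
  have h5 : φ = ξ := by
    rw [he, h4]
    exact add_zero ξ
  rw [h5]
  exact hξ

/-- The covariant derivatives of a smooth frame of `Λ⁺M` with constant inner products: they are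
self-dual, and the matrix of their coefficients is skew-adjoint. -/
lemma exists_connection {ζ η θ : Π y : M, Bil y} (hF : ∀ y, g.IsFrame o (ζ y) (η y) (θ y))
    (sζ : SmoothBilAt ζ x) (sη : SmoothBilAt η x) (sθ : SmoothBilAt θ x) (w : T x) :
    ∃ a b c : ℝ, (∀ u v, g.nablaBil ζ x w u v = 2 * a * ζ x u v + 2 * b * η x u v) ∧
      (∀ u v, g.nablaBil η x w u v = 2 * c * ζ x u v + 2 * b * θ x u v) ∧
      ∀ u v, g.nablaBil θ x w u v = 2 * c * η x u v - 2 * a * θ x u v := by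
  obtain ⟨ζ', hζ'⟩ := exists_nablaBil (g := g) sζ w
  obtain ⟨η', hη'⟩ := exists_nablaBil (g := g) sη w
  obtain ⟨θ', hθ'⟩ := exists_nablaBil (g := g) sθ w
  have h := hF x
  have cliff : ∀ {φ ψ : Π y : M, Bil y} (_ : ∀ y, g.SelfDualForm o (φ y))
      (_ : ∀ y, g.SelfDualForm o (ψ y)) {k : ℝ} (_ : ∀ y, g.ip (φ y) (ψ y) = k) (y : M) (u : T y),
      g.sharp (φ y) (g.sharp (ψ y) u) + g.sharp (ψ y) (g.sharp (φ y) u) = (-k) • u :=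
    fun hφ hψ k hk y u ↦ by rw [(hφ y).anticomm (hψ y), hk]
  have dζ := fun y ↦ (hF y).sd_ζ
  have dη := fun y ↦ (hF y).sd_η
  have dθ := fun y ↦ (hF y).sd_θ
  have hη1 : g.SelfDualForm o η' := by
    refine h.selfDual_of_anticomm (c := 0) (isTwoForm_nablaBil (fun y ↦ (dη y).1) hη') fun u ↦ ?_
    have h1 := nabla_anticomm sη sη (cliff dη dη fun y ↦ (hF y).ηη) hη' hη' u
    linear_combination (norm := module) (1 / 2 : ℝ) • h1
  have hζ1 : g.SelfDualForm o ζ' := by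
    refine h.selfDual_of_anticomm (c := g.ip (ζ x) η')
      (isTwoForm_nablaBil (fun y ↦ (dζ y).1) hζ') fun u ↦ ?_
    have h1 := nabla_anticomm sζ sη (cliff dζ dη fun y ↦ (hF y).ζη) hζ' hη' u
    rw [h.sd_ζ.anticomm hη1] at h1
    linear_combination (norm := module) h1
  have hθ1 : g.SelfDualForm o θ' := by
    refine h.selfDual_of_anticomm (c := g.ip η' (θ x))
      (isTwoForm_nablaBil (fun y ↦ (dθ y).1) hθ') fun u ↦ ?_
    have h1 := nabla_anticomm sη sθ (cliff dη dθ fun y ↦ (hF y).ηθ) hη' hθ' u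
    rw [hη1.anticomm h.sd_θ] at h1
    linear_combination (norm := module) h1
  -- Differentiating the inner products.
  have inner : ∀ {φ ψ : Π y : M, Bil y} (_ : ∀ y, g.SelfDualForm o (φ y))
      (_ : ∀ y, g.SelfDualForm o (ψ y)) {k : ℝ} (_ : ∀ y, g.ip (φ y) (ψ y) = k)
      (_ : SmoothBilAt φ x) (_ : SmoothBilAt ψ x) {φ' ψ' : Bil x}
      (_ : ∀ u v, φ' u v = g.nablaBil φ x w u v) (_ : ∀ u v, ψ' u v = g.nablaBil ψ x w u v)
      (_ : g.SelfDualForm o φ') (_ : g.SelfDualForm o ψ'),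
      g.ip φ' (ψ x) + g.ip ψ' (φ x) = 0 := by
    intro φ ψ hφ hψ k hk sφ sψ φ' ψ' hφ' hψ' hφ1 hψ1
    have hu : coordVec x 0 ≠ 0 := by
      rw [← coordBasis_apply]
      exact (coordBasis x).ne_zero 0
    have h1 := nabla_anticomm sφ sψ (cliff hφ hψ hk) hφ' hψ' (coordVec x 0)
    rw [hφ1.anticomm (hψ x), (hφ x).anticomm hψ1, g.ip_comm (φ x), ← add_smul] at h1
    have h2 := (smul_eq_zero.mp h1).resolve_right hu
    linarith
  obtain ⟨a₁, b₁, c₁, e₁⟩ := h.exists_comb hζ1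
  obtain ⟨a₂, b₂, c₂, e₂⟩ := h.exists_comb hη1
  obtain ⟨a₃, b₃, c₃, e₃⟩ := h.exists_comb hθ1
  have i₁ := inner dζ dζ (fun y ↦ (hF y).ζζ) sζ sζ hζ' hζ' hζ1 hζ1
  have i₂ := inner dη dη (fun y ↦ (hF y).ηη) sη sη hη' hη' hη1 hη1
  have i₃ := inner dθ dθ (fun y ↦ (hF y).θθ) sθ sθ hθ' hθ' hθ1 hθ1
  have i₄ := inner dζ dη (fun y ↦ (hF y).ζη) sζ sη hζ' hη' hζ1 hη1
  have i₅ := inner dζ dθ (fun y ↦ (hF y).ζθ) sζ sθ hζ' hθ' hζ1 hθ1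
  have i₆ := inner dη dθ (fun y ↦ (hF y).ηθ) sη sθ hη' hθ' hη1 hθ1
  rw [e₁, h.ip_comb_ζ] at i₁
  rw [e₂, h.ip_comb_η] at i₂
  rw [e₃, h.ip_comb_θ] at i₃
  rw [e₁, e₂, h.ip_comb_η, h.ip_comb_ζ] at i₄
  rw [e₁, e₃, h.ip_comb_θ, h.ip_comb_ζ] at i₅
  rw [e₂, e₃, h.ip_comb_θ, h.ip_comb_η] at i₆
  obtain rfl : c₁ = 0 := by linarith
  obtain rfl : b₂ = 0 := by linarith
  obtain rfl : a₃ = 0 := by linarith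
  obtain rfl : c₂ = b₁ := by linarith
  obtain rfl : c₃ = -a₁ := by linarith
  obtain rfl : b₃ = a₂ := by linarith
  refine ⟨a₁ / 2, c₂ / 2, b₃ / 2, fun u v ↦ ?_, fun u v ↦ ?_, fun u v ↦ ?_⟩
  · rw [← hζ', e₁]
    simp only [_root_.add_apply, _root_.smul_apply, smul_eq_mul]
    ring
  · rw [← hη', e₂]
    simp only [_root_.add_apply, _root_.smul_apply, smul_eq_mul]
    ring
  · rw [← hθ', e₃]
    simp only [_root_.add_apply, _root_.smul_apply, smul_eq_mul]
    ring

lemma isLinearMap_pairing_nablaBil (φ : Π y : M, Bil y) (ψ : Bil x) (r : ℝ) :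
    IsLinearMap ℝ fun w ↦ r * g.pairing x (g.nablaBil φ x w) fun u v ↦ ψ u v where
  map_add w w' := by
    have h : g.nablaBil φ x (w + w') =
        fun u v ↦ g.nablaBil φ x w u v + g.nablaBil φ x w' u v :=
      funext fun u ↦ funext fun v ↦ (isLinearMap_nablaBil φ u v).map_add w w'
    rw [h, pairing_add_left, mul_add]
  map_smul s w := by
    have h : g.nablaBil φ x (s • w) = fun u v ↦ s * g.nablaBil φ x w u v :=
      funext fun u ↦ funext fun v ↦ (isLinearMap_nablaBil φ u v).map_smul s w
    rw [h, pairing_smul_left, smul_eq_mul]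
    ring

lemma pairing_comb (a b : ℝ) (φ ψ χ : Bil x) :
    g.pairing x (fun u v ↦ a * φ u v + b * ψ u v) (fun u v ↦ χ u v) =
      a * g.ip φ χ + b * g.ip ψ χ := by
  rw [pairing_add_left, pairing_smul_left, pairing_smul_left]
  rfl

/-- The coefficients of `exists_connection` are linear in the direction of differentiation, being
inner products of derivatives: `4α = ⟨∇ζ, θ⟩`, `-4β = ⟨∇ζ, η⟩`, `4γ = ⟨∇η, θ⟩`. -/
lemma exists_connection_forms {ζ η θ : Π y : M, Bil y}
    (hF : ∀ y, g.IsFrame o (ζ y) (η y) (θ y)) (hs : ∀ x, SmoothBilAt ζ x ∧ SmoothBilAt η x ∧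
      SmoothBilAt θ x) :
    ∃ α β γ : Π x : M, T x →L[ℝ] ℝ,
      (∀ x w u v, g.nablaBil ζ x w u v = 2 * α x w * ζ x u v + 2 * β x w * η x u v) ∧
      (∀ x w u v, g.nablaBil η x w u v = 2 * γ x w * ζ x u v + 2 * β x w * θ x u v) ∧
      ∀ x w u v, g.nablaBil θ x w u v = 2 * γ x w * η x u v - 2 * α x w * θ x u v := by
  let F (φ ψ : Π y : M, Bil y) (r : ℝ) (x : M) : T x →L[ℝ] ℝ :=
    (isLinearMap_pairing_nablaBil (g := g) φ (ψ x) r).mk'.toContinuousLinearMap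
  have key : ∀ x w, ∃ a b c : ℝ, a = F ζ θ (1 / 4) x w ∧ b = F ζ η (-1 / 4) x w ∧
      c = F η θ (1 / 4) x w ∧
      (∀ u v, g.nablaBil ζ x w u v = 2 * a * ζ x u v + 2 * b * η x u v) ∧
      (∀ u v, g.nablaBil η x w u v = 2 * c * ζ x u v + 2 * b * θ x u v) ∧
      ∀ u v, g.nablaBil θ x w u v = 2 * c * η x u v - 2 * a * θ x u v := by
    intro x w
    obtain ⟨a, b, c, h1, h2, h3⟩ := exists_connection hF (hs x).1 (hs x).2.1 (hs x).2.2 w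
    have h := hF x
    refine ⟨a, b, c, ?_, ?_, ?_, h1, h2, h3⟩
    · change a = 1 / 4 * g.pairing x (g.nablaBil ζ x w) fun u v ↦ θ x u v
      rw [show g.nablaBil ζ x w = _ from funext fun u ↦ funext fun v ↦ h1 u v, pairing_comb,
        h.ζθ, h.ηθ]
      ring
    · change b = -1 / 4 * g.pairing x (g.nablaBil ζ x w) fun u v ↦ η x u v
      rw [show g.nablaBil ζ x w = _ from funext fun u ↦ funext fun v ↦ h1 u v, pairing_comb,
        h.ζη, h.ηη]
      ring
    · change c = 1 / 4 * g.pairing x (g.nablaBil η x w) fun u v ↦ θ x u v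
      rw [show g.nablaBil η x w = _ from funext fun u ↦ funext fun v ↦ h2 u v, pairing_comb,
        h.ζθ, h.θθ]
      ring
  refine ⟨F ζ θ (1 / 4), F ζ η (-1 / 4), F η θ (1 / 4), fun x w ↦ ?_, fun x w ↦ ?_,
    fun x w ↦ ?_⟩ <;>
  · obtain ⟨a, b, c, rfl, rfl, rfl, h1, h2, h3⟩ := key x w
    assumption

/-- Existence of the canonical trivialization of `Λ⁺M`. -/
theorem exists_isCanonical (hE : g.IsEinstein) (hSD : g.IsSelfDual o) (hIII : g.IsPetrovIII o) :
    ∃ F : FrameData M, F.IsCanonical g o := by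
  choose ζ η θ hF hζ hη hθ hk using fun x ↦ hIII.exists_frame x
  have hs := smooth_frame hE hSD hF hζ hη hθ hk
  obtain ⟨α, β, γ, h1, h2, h3⟩ := exists_connection_forms hF hs
  refine ⟨⟨ζ, η, θ, α, β, γ⟩, ?_⟩
  constructor
  case smooth_ζ => exact fun x ↦ (hs x).1.contMDiffAt
  case smooth_η => exact fun x ↦ (hs x).2.1.contMDiffAt
  case smooth_θ => exact fun x ↦ (hs x).2.2.contMDiffAt
  case η_V =>
    intro x v hv u
    have h4 : v = _ := (hF x).eq_of_ζ_eq_zero v hv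
    change η x v u = _
    rw [← val_sharp, h4, hk]
  case η_H =>
    intro x v hv u
    have h4 : v = _ := (hF x).eq_of_θ_eq_zero v hv
    change η x v u = _
    rw [← val_sharp, h4, (hF x).sharp_η_θ (hk x), map_neg, _root_.neg_apply]
  case nabla_ζ => exact h1
  case nabla_η => exact h2
  case nabla_θ => exact h3
  case weyl_ζ => exact hζ
  case weyl_η => exact hη
  case weyl_θ => exact hθ
  case selfDual_ζ => exact fun x ↦ (hF x).sd_ζ
  case selfDual_η => exact fun x ↦ (hF x).sd_η
  case selfDual_θ => exact fun x ↦ (hF x).sd_θ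
  case ζθ => exact fun x ↦ (hF x).ζθ
  case ηη => exact fun x ↦ (hF x).ηη
  case ζζ => exact fun x ↦ (hF x).ζζ
  case ζη => exact fun x ↦ (hF x).ζη
  case ηθ => exact fun x ↦ (hF x).ηθ
  case θθ => exact fun x ↦ (hF x).θθ

end NeutralMetric

end

/-! ### The null distribution `Ker ζ` -/

section

variable {M : Type*} [TopologicalSpace M] [ChartedSpace E4 M]

lemma exists_bil {x : M} {A : T x → T x → ℝ} (hA : IsBilinearMap ℝ A) :
    ∃ φ : Bil x, ∀ u v, φ u v = A u v := by
  let L : T x →ₗ[ℝ] T x →ₗ[ℝ] ℝ := hA.toLinearMap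
  refine ⟨(LinearMap.toContinuousLinearMap.toLinearMap ∘ₗ L).toContinuousLinearMap, ?_⟩
  intro u v
  rfl

variable [IsManifold 𝓘(ℝ, E4) ∞ M]

variable {g : NeutralMetric M} {o : Π x : M, Orientation ℝ (T x) (Fin 4)} {x : M}

lemma SmoothFieldAt.exists_isOpen {X : Π y : M, T y} (hX : SmoothFieldAt X x) :
    ∃ U : Set M, IsOpen U ∧ x ∈ U ∧ SmoothFieldOn X U := by
  obtain ⟨U, hU, hUo, hx⟩ := eventually_nhds_iff.mp hX
  exact ⟨U, hUo, hx, fun y hy ↦ (hU y hy).contMDiffWithinAt⟩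

namespace FrameData.IsCanonical

variable {F : FrameData M}

lemma isFrame (h : F.IsCanonical g o) (x : M) : g.IsFrame o (F.ζ x) (F.η x) (F.θ x) where
  sd_ζ := h.selfDual_ζ x
  sd_η := h.selfDual_η x
  sd_θ := h.selfDual_θ x
  ζθ := h.ζθ x
  ηη := h.ηη x
  ζζ := h.ζζ x
  ζη := h.ζη x
  ηθ := h.ηθ x
  θθ := h.θθ x

lemma isNullDistribution_V (h : F.IsCanonical g o) : g.IsNullDistribution F.V where
  dim x := (h.isFrame x).finrank_ker
  null x _ hu _ hv := (h.isFrame x).null hu hv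
  smooth x v hv := by
    have hs := g.smooth_sharp (h.smooth_ζ.smoothBilAt x)
      (smoothFieldAt_ext ((-1 / 2 : ℝ) • g.sharp (F.θ x) v))
    obtain ⟨U, hU, hx, hX⟩ := hs.exists_isOpen
    refine ⟨U, hU, hx, _, hX, ?_, fun y _ ↦ (h.isFrame y).ζ_sharp_eq_zero _⟩
    rw [ext_self]
    exact ((h.isFrame x).eq_of_ζ_eq_zero v hv).symm

lemma isCompatible_V (h : F.IsCanonical g o) : g.IsCompatible o F.V :=
  fun x _ hu _ hv _ ↦ (h.isFrame x).selfDual_bivector hu hv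

/-- The second fundamental form of `Ker ζ` is given by `β`. -/
lemma ζ_nabla (h : F.IsCanonical g o) {X : Π y : M, T y} (hX : SmoothFieldAt X x)
    (hV : ∀ᶠ y in 𝓝 x, X y ∈ F.V y) (w v : T x) :
    F.ζ x (g.nabla X x w) v = -2 * F.β x w * g.val x (X x) v := by
  have h1 := NeutralMetric.nablaBil_eq (g := g) (h.smooth_ζ.smoothBilAt x) hX w v
  have h2 : ∀ᶠ y in 𝓝 x, g.sharp (F.ζ y) (X y) = ((0 : ℝ) • X) y := by
    filter_upwards [hV] with y hy
    rw [Pi.smul_apply, zero_smul, g.sharp_eq_zero_iff]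
    exact hy
  have hx : X x ∈ F.V x := hV.self_of_nhds
  have h3 : F.ζ x (X x) = 0 := hx
  rw [NeutralMetric.nabla_congr h2, NeutralMetric.nabla_const_smul 0 hX, zero_smul, h.nabla_ζ,
    h.η_V x _ hx, h3] at h1
  simp only [map_zero, _root_.zero_apply] at h1
  linarith

lemma isParallel_V_iff (h : F.IsCanonical g o) : g.IsParallel F.V ↔ ∀ x, F.β x = 0 := by
  constructor
  · intro hpar x
    ext w
    obtain ⟨v, hv, hv0⟩ : ∃ v ∈ F.V x, v ≠ 0 := by
      refine (Submodule.ne_bot_iff _).mp fun hbot ↦ ?_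
      have h1 := h.isNullDistribution_V.dim x
      rw [hbot, finrank_bot] at h1
      norm_num at h1
    obtain ⟨U, hU, hx, X, hX, rfl, hXV⟩ := h.isNullDistribution_V.smooth x v hv
    have h1 : F.ζ x (g.nabla X x w) = 0 := hpar U hU X hX hXV x hx w
    by_contra hβ
    apply hv0
    refine g.eq_zero_of_forall fun u ↦ ?_
    have h2 := h.ζ_nabla (hX.smoothFieldAt hU hx) (Filter.mem_of_superset (hU.mem_nhds hx) hXV) w u
    rw [h1] at h2
    simpa using (mul_eq_zero.mp h2.symm).resolve_left (mul_ne_zero (by norm_num) hβ)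
  · intro hβ U hU X hX hXV x hx w
    change F.ζ x (g.nabla X x w) = 0
    ext v
    rw [h.ζ_nabla (hX.smoothFieldAt hU hx) (Filter.mem_of_superset (hU.mem_nhds hx) hXV), hβ]
    simp

end FrameData.IsCanonical

/-! ### Parallel null distributions -/

namespace NeutralMetric

/-- A parallel distribution is invariant under the curvature operators. -/
lemma IsParallel.curvField_mem {D : Π y : M, Submodule ℝ (T y)} (hD : g.IsParallel D)
    {U : Set M} (hU : IsOpen U) (hx : x ∈ U) {X Y Z : Π y : M, T y} (hX : SmoothFieldAt X x)
    (hY : SmoothFieldAt Y x) (hZ : SmoothFieldOn Z U) (hZD : ∀ y ∈ U, Z y ∈ D y) :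
    g.curvField X Y Z x ∈ D x := by
  have key : ∀ {V : Π y : M, T y}, SmoothFieldAt V x → ∀ w : T x,
      g.nabla (fun y ↦ g.nabla Z y (V y)) x w ∈ D x := by
    intro V hV w
    obtain ⟨U', hU', hx', hs⟩ := (smooth_nabla (g := g) hV (hZ.smoothFieldAt hU hx)).exists_isOpen
    exact hD (U ∩ U') (hU.inter hU') _ (hs.mono Set.inter_subset_right)
      (fun y hy ↦ hD U hU Z hZ hZD y hy.1 _) x ⟨hx, hx'⟩ w
  exact add_mem (sub_mem (key hX _) (key hY _)) (hD U hU Z hZ hZD x hx _)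

lemma IsParallel.curv_eq_zero {D : Π y : M, Submodule ℝ (T y)} (hD : g.IsParallel D)
    (hN : g.IsNullDistribution D) (a b : T x) {d d' : T x} (hd : d ∈ D x) (hd' : d' ∈ D x) :
    g.curv x a b d d' = 0 := by
  obtain ⟨U, hU, hx, Z, hZ, rfl, hZD⟩ := hN.smooth x d hd
  have h := curv_eq (g := g) (smoothFieldAt_ext a) (smoothFieldAt_ext b)
    (hZ.smoothFieldAt hU hx) d'
  rw [ext_self, ext_self] at h
  rw [h]
  exact hN.null x _ (hD.curvField_mem hU hx (smoothFieldAt_ext a) (smoothFieldAt_ext b) hZ hZD)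
    _ hd'

/-- On an Einstein manifold, the bivector of a parallel null plane field is an eigenvector of the
Weyl tensor, with an eigenvalue proportional to the scalar curvature. -/
lemma weylOp_bivector {c : ℝ} (hc : ∀ (x : M) (u v : T x), g.ricci x u v = c * g.val x u v)
    {D : Π y : M, Submodule ℝ (T y)} (hN : g.IsNullDistribution D)
    (hD : g.IsParallel D) {d d' : T x} (hd : d ∈ D x) (hd' : d' ∈ D x) (a b : T x) :
    g.weylOp x (g.bivector d d') a b = -(c / 3) * g.bivector d d' a b := by
  obtain ⟨A, hA⟩ := exists_bil (isBilinearMap_weyl hc a b)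
  have h1 : g.weylOp x (g.bivector d d') a b =
      g.pairing x (fun u v ↦ g.bivector d d' u v) fun u v ↦ A u v := by
    rw [g.pairing_comm]
    simp only [hA]
    rfl
  rw [h1]
  have h2 := g.two_mul_pairing_bivector (isBilinearMap_bil A) d d'
  rw [hA, hA, weyl_eq hc, weyl_eq hc, hD.curv_eq_zero hN a b hd hd',
    hD.curv_eq_zero hN a b hd' hd] at h2
  rw [bivector_apply, g.symm x d a, g.symm x d b, g.symm x d' a, g.symm x d' b]
  linarith

lemma bivector_ne_zero {u v : T x} (h : LinearIndependent ℝ ![u, v]) : g.bivector u v ≠ 0 := by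
  intro h0
  have hv : v ≠ 0 := h.ne_zero 1
  apply hv
  refine g.eq_zero_of_forall fun a ↦ ?_
  have h1 : g.val x u a • v + (-g.val x v a) • u = 0 := by
    refine g.eq_of_forall fun b ↦ ?_
    have h2 := congrArg (fun φ : Bil x ↦ φ a b) h0
    simp only [bivector_apply, _root_.zero_apply] at h2
    simp only [map_add, map_smul, map_zero, _root_.add_apply, _root_.smul_apply, smul_eq_mul,
      _root_.zero_apply]
    linarith
  rw [add_comm] at h1
  have h3 := (LinearIndependent.pair_iff.mp h _ _ h1).1
  linarith

/-- A compatible parallel null plane field on an Einstein manifold of Petrov type III is `Ker ζ`,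
and its existence makes the manifold Ricci-flat: the Weyl operator is nilpotent, with the kernel
spanned by `ζ`. -/
theorem eq_V_of_isParallel {F : FrameData M} (h : F.IsCanonical g o) {c : ℝ}
    (hc : ∀ (x : M) (u v : T x), g.ricci x u v = c * g.val x u v)
    {D : Π y : M, Submodule ℝ (T y)} (hN : g.IsNullDistribution D) (hD : g.IsParallel D)
    (hC : g.IsCompatible o D) (x : M) : c = 0 ∧ D x = F.V x := by
  have hF := h.isFrame x
  let b : Module.Basis (Fin 2) ℝ (D x) := Module.finBasisOfFinrankEq ℝ (D x) (hN.dim x)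
  set d : T x := (b 0).1
  set d' : T x := (b 1).1
  have hd : d ∈ D x := (b 0).2
  have hd' : d' ∈ D x := (b 1).2
  have hli : LinearIndependent ℝ ![d, d'] := by
    have h1 := b.linearIndependent.map' (D x).subtype (Submodule.ker_subtype _)
    have h2 : ![d, d'] = (D x).subtype ∘ b := by
      funext i
      fin_cases i <;> rfl
    rw [h2]
    exact h1
  have hne := g.bivector_ne_zero hli
  obtain ⟨p, q, r, he⟩ := hF.exists_comb (hC x d hd d' hd' hli)
  have hW : (-q) • F.ζ x + r • F.η x + (0 : ℝ) • F.θ x =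
      (-(c / 3)) • (p • F.ζ x + q • F.η x + r • F.θ x) := by
    ext u v
    have h1 := weylOp_bivector hc hN hD hd hd' u v
    rw [he] at h1
    simp only [weylOp_add, weylOp_smul, h.weyl_ζ, h.weyl_η, h.weyl_θ] at h1
    simp only [_root_.add_apply, _root_.smul_apply, smul_eq_mul] at h1 ⊢
    linarith
  have e1 := congrArg (fun φ ↦ g.ip φ (F.ζ x)) hW
  have e2 := congrArg (fun φ ↦ g.ip φ (F.η x)) hW
  have e3 := congrArg (fun φ ↦ g.ip φ (F.θ x)) hW
  simp only [ip_smul_left _ (-(c / 3)), hF.ip_comb_ζ, hF.ip_comb_η, hF.ip_comb_θ] at e1 e2 e3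
  have hcz : c = 0 := by
    by_contra hcn
    have hr : r = 0 := by
      have : c * r = 0 := by linarith
      exact (mul_eq_zero.mp this).resolve_left hcn
    have hq : q = 0 := by
      rw [hr] at e2
      have : c * q = 0 := by linarith
      exact (mul_eq_zero.mp this).resolve_left hcn
    have hp : p = 0 := by
      rw [hq] at e3
      have : c * p = 0 := by linarith
      exact (mul_eq_zero.mp this).resolve_left hcn
    apply hne
    rw [he, hp, hq, hr]
    ext u v
    simp
  have hr : r = 0 := by
    rw [hcz] at e2
    linarith
  have hq : q = 0 := by
    rw [hcz] at e3
    linarith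
  have hξ : ∀ u v, g.bivector d d' u v = p * F.ζ x u v := by
    intro u v
    rw [he, hq, hr]
    simp
  have hp : p ≠ 0 := by
    intro hp
    apply hne
    ext u v
    rw [hξ, hp]
    simp
  refine ⟨hcz, Submodule.eq_of_le_of_finrank_eq (fun t ht ↦ ?_)
    ((hN.dim x).trans (h.isNullDistribution_V.dim x).symm)⟩
  change F.ζ x t = 0
  ext v
  have h1 := hξ t v
  rw [bivector_apply, hN.null x d hd t ht, hN.null x d' hd' t ht] at h1
  simp only [zero_mul, sub_zero] at h1
  simpa using (mul_eq_zero.mp h1.symm).resolve_left hp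

end NeutralMetric

end

end NeutralFour

end

theorem theorem6p2 {M : Type*} [TopologicalSpace M] [T2Space M] [ConnectedSpace M]
    [ChartedSpace NeutralFour.E4 M] [IsManifold 𝓘(ℝ, NeutralFour.E4) ∞ M]
    (g : NeutralFour.NeutralMetric M)
    (o : Π x : M, Orientation ℝ (NeutralFour.T x) (Fin 4))
    (ho : NeutralFour.IsOrientation o)
    (hE : g.IsEinstein) (hSD : g.IsSelfDual o) (hIII : g.IsPetrovIII o) :
    (∃ F : NeutralFour.FrameData M, F.IsCanonical g o) ∧
    ∀ F : NeutralFour.FrameData M, F.IsCanonical g o →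
      (g.IsNullDistribution F.V ∧ g.IsCompatible o F.V) ∧
      (g.IsParallel F.V ↔ ∀ x, F.β x = 0) ∧
      (g.IsParallel F.V → g.IsRicciFlat) ∧
      ((∀ x, F.β x ≠ 0) →
        ¬ ∃ D : Π x : M, Submodule ℝ (NeutralFour.T x),
          g.IsNullDistribution D ∧ g.IsParallel D ∧ g.IsCompatible o D) := by
  refine ⟨NeutralFour.NeutralMetric.exists_isCanonical hE hSD hIII, fun F hF ↦ ?_⟩
  obtain ⟨c, hc⟩ := hE
  refine ⟨⟨hF.isNullDistribution_V, hF.isCompatible_V⟩, hF.isParallel_V_iff, ?_, ?_⟩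
  · intro hpar x u v
    have h0 := (NeutralFour.NeutralMetric.eq_V_of_isParallel hF hc hF.isNullDistribution_V hpar
      hF.isCompatible_V x).1
    rw [hc, h0, zero_mul]
  · rintro hβ ⟨D, hN, hD, hC⟩
    have hDV : D = F.V := funext fun x ↦
      (NeutralFour.NeutralMetric.eq_V_of_isParallel hF hc hN hD hC x).2
    rw [hDV] at hD
    obtain ⟨x⟩ : Nonempty M := inferInstance
    exact hβ x (hF.isParallel_V_iff.mp hD x)
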